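/- **Setting.** Let $n\ge1$. An instance $\mathbf D=(D_1,\dots,D_n;\Pi)$ consists of probability distributions $D_i$ on $[0,1]$ and a distribution $\Pi$ on the permutations of $[n]$. A round draws independent $y_i\sim D_i$ and $\tau\sim\Pi$ and presents $x_i=y_{\tau(i)}$ together with $\tau(i)$, for $i=1,\dots,n$. A deterministic online algorithm is a family of measurable maps $f_i:[0,1]^i\times\mathrm{Inj}([i],[n])\to\{0,1\}$; it stops at the first $i$ with $f_i(x_{\le i},\tau_{\le i})=1$, and at $i=n+1$ if there is none. A randomized algorithm is a probability distribution over deterministic ones, and its profit is averaged over its internal randomness. The profit is $p(x,i)=\mathbf 1\{x_i=\max_{j\in[n]}x_j\}$, with $x_{n+1}=0$. Let $\mathrm{Opt}_{\rm online}(\mathbf D)$ be the supremum of the expected profit over deterministic online algorithms and $\mathrm{Opt}_{\rm offline}(\mathbf D)=\mathbb E[\max_{i\in[n+1]}p(x,i)]$. Rounds $1,2,\dots$ are i.i.d. copies; the algorithm used in round $t$ may depend on the complete data of rounds $1,\dots,t-1$. It is $\alpha$-competitive in round $t$ on $\mathbf D$ if its expected profit there is at least $\alpha\,\mathrm{Opt}_{\rm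 offline}(\mathbf D)$. The regret over $T$ rounds is the expectation of $\sum_{t\le T}(\mathrm{Opt}_{\rm online}(\mathbf D)-\text{profit in round }t)$. The adversarial order model is the case where $\Pi$ is the point mass at the identity; in the general order model $\Pi$ is arbitrary. **The algorithms.** *Baseline:* $g_1$ accepts a uniformly random position. For $t\ge2$, $g_t$ is the single-sample algorithm with threshold $\theta=\max_j x^{(1)}_j$: it accepts the first $x_i\ge\theta$ or the first $x_i>\theta$, where the choice between $\ge$ and $>$ is made once, at random, according to a fixed *tie rule* (a distribution on $\{\ge,>\}$; always choosing $\ge$ is allowed). *Empirical optimizer:* an essentially threshold algorithm has thresholds $\theta_i(\tau_{\le i})\in[0,1]\cup\{\infty\}$ and accepts $x_i$ iff $x_i\ge\max_{j<i}x_j$ and $x_i\ge\theta_i(\tau_{\le i})$, where for each $(i,\tau_{\le i})$ the last comparison may instead be strict. Let $h_t$ be an essentially threshold algorithm, chosen measurably from rounds $1,\dots,t-1$, that is optimal among all of these for the empirical distribution of those rounds. *Switching:* for an integer $\kappa\ge1$ put $$\zeta(t)=\min\{t,\max\{2,\lfloor (t+1)/2\rfloor\}\},\quad \epsilon_1(t)=6\sqrt{\tfrac{2\kappa\ln(4t)}{t-1}},\quad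 \delta_1(t)=\tfrac1{2t^{\kappa}},$$ $$\epsilon(t)=\epsilon_1(\zeta(t)),\qquad \delta(t)=4e^{-2(t-\zeta(t))\epsilon(t)^2}+\delta_1(\zeta(t)).$$ Let $\hat g,\hat h$ be the mean profits of $g_{\zeta(t)},h_{\zeta(t)}$ (which depend on rounds $1,\dots,\zeta(t)-1$) over rounds $\zeta(t),\dots,t-1$. In round $t$ the algorithm $h^{\mathrm{AS}}_t$ uses $h_{\zeta(t)}$ if $\zeta(t)<t$ and $\hat g+\epsilon(t)+\delta(t)\le(1-\delta(t))(\hat h-\epsilon(t))$, and $g_{\zeta(t)}$ otherwise. **Claim.** For every $n\ge1$ a measurable empirical optimizer exists. There is an absolute constant $C>0$ such that for every $n\ge1$, every tie rule and every choice of empirical optimizer the following hold. *Adversarial order*, with $\kappa=n$, for every adversarial-order instance $\mathbf D$: 1. $h^{\mathrm{AS}}_1$ is $1/n$-competitive; 2. if the tie rule is a fair coin, or if no $D_i$ has an atom, then $h^{\mathrm{AS}}_t$ is $1/4$-competitive for all $t\ge2$; 3. the regret is at most $C\sqrt{nT\log T}$ for all $T\ge2$. *General order*, for every integer $\kappa$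 with $n\le\kappa\le 2\,n!$ (so in particular for the same algorithms, $\kappa=n$, and for $\kappa=\min(n|\mathrm{supp}\,\Pi|,2\,n!)$) and every instance $\mathbf D$: statements 1 and 2 hold, and the regret is at most $C\sqrt{n!\,T\log T}$ for all $T\ge2$. -/

import Mathlib

namespace OptStop

noncomputable section

open MeasureTheory

/-- The discrete σ-algebra on the finite set of permutations of `[n]`. -/
instance permMeasurableSpace (n : ℕ) : MeasurableSpace (Equiv.Perm (Fin n)) := ⊤

/-! ### Optimal stopping -/

/-- What one round reveals: the values `x = (x₁, …, xₙ)` in order of arrival, and the permutation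
`τ` (the `i`-th arriving value was drawn from the `τ i`-th distribution). -/
abbrev Outcome (n : ℕ) : Type := (Fin n → unitInterval) × Equiv.Perm (Fin n)

/-- An instance `𝔻 = (D₁, …, Dₙ; Π)`. -/
structure Distributions (n : ℕ) where
  dist : Fin n → ProbabilityMeasure unitInterval
  order : PMF (Equiv.Perm (Fin n))

/-- Law of `((y_{τ(1)}, …, y_{τ(n)}), τ)` with independent `yᵢ ∼ Dᵢ` and `τ ∼ Π`. -/
def Distributions.law {n : ℕ} (𝔻 : Distributions n) : Measure (Outcome n) :=
  ((Measure.pi fun i => (𝔻.dist i : Measure unitInterval)).prod 𝔻.order.toMeasure).map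
    fun q => (fun i => q.1 (q.2 i), q.2)

/-- Adversarial order: `Π` is the point mass at the identity. -/
def Distributions.IsAdversarialOrder {n : ℕ} (𝔻 : Distributions n) : Prop :=
  𝔻.order = PMF.pure (Equiv.refl (Fin n))

/-- No `Dᵢ` has an atom. -/
def Distributions.Atomless {n : ℕ} (𝔻 : Distributions n) : Prop :=
  ∀ (i : Fin n) (x : unitInterval), (𝔻.dist i : Measure unitInterval) {x} = 0

/-- A profit function; the index `Fin.last n` means that every value was rejected. -/
abbrev ProfitFn (n : ℕ) : Type := (Fin n → unitInterval) → Fin (n + 1) → ℝ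

/-- A deterministic online algorithm: (measurable) functions
`fᵢ : [0,1]^i × Inj([i],[n]) → {0,1}`; the step `i : Fin n` (counted from `0`) sees `i + 1`
values and `i + 1` labels. -/
structure OnlineAlg (n : ℕ) where
  accept : (i : Fin n) → (Fin (i.val + 1) → unitInterval) → (Fin (i.val + 1) ↪ Fin n) → Bool
  measurable_accept : ∀ i σ, Measurable fun x => accept i x σ

/-- `x_{≤ i}` -/
def valuesUpTo {n : ℕ} (x : Fin n → unitInterval) (i : Fin n) : Fin (i.val + 1) → unitInterval :=
  fun j => x (Fin.castLE i.isLt j)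

/-- `τ_{≤ i}` -/
def labelsUpTo {n : ℕ} (τ : Equiv.Perm (Fin n)) (i : Fin n) : Fin (i.val + 1) ↪ Fin n :=
  (Fin.castLEEmb i.isLt).trans τ.toEmbedding

open Classical in
/-- The first index accepted by `a`, or `Fin.last n` if there is none. -/
def stopIndex {n : ℕ} (a : OnlineAlg n) (ω : Outcome n) : Fin (n + 1) :=
  (Finset.univ.filter fun k : Fin (n + 1) => k = Fin.last n ∨
      ∃ i : Fin n, k = i.castSucc ∧
        a.accept i (valuesUpTo ω.1 i) (labelsUpTo ω.2 i) = true).min'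
    ⟨Fin.last n, by simp⟩

/-- `h(x, τ; p)` for a deterministic algorithm. -/
def profit {n : ℕ} (p : ProfitFn n) (a : OnlineAlg n) (ω : Outcome n) : ℝ :=
  p ω.1 (stopIndex a ω)

/-- `h(x, τ; p)` for a randomized algorithm, averaged over its internal randomness. -/
def randProfit {n : ℕ} (p : ProfitFn n) (r : PMF (OnlineAlg n)) (ω : Outcome n) : ℝ :=
  ∑' a, (r a).toReal * profit p a ω

/-- `Opt_online(𝔻; p)` -/
def optOnline {n : ℕ} (p : ProfitFn n) (𝔻 : Distributions n) : ℝ :=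
  ⨆ a : OnlineAlg n, ∫ ω, profit p a ω ∂𝔻.law

/-- `Opt_offline(𝔻; p)` -/
def optOffline {n : ℕ} (p : ProfitFn n) (𝔻 : Distributions n) : ℝ :=
  ∫ ω, (⨆ k : Fin (n + 1), p ω.1 k) ∂𝔻.law

open Classical in
/-- Best choice: `p(x, i) = 𝟙{x_i = max_{j ∈ [n]} x_j}`, where `x_{n+1} = 0`. -/
def bestChoice (n : ℕ) : ProfitFn n := fun x k =>
  if Fin.snoc (α := fun _ => unitInterval) x 0 k = Finset.univ.sup x then 1 else 0

/-! ### Repeated optimal stopping -/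

/-- A (randomized) online algorithm for each number `m` of previously observed rounds, chosen as a
function of these rounds. The algorithm for round `t` is the one with `m = t - 1`. -/
abbrev Policy (n : ℕ) : Type := (m : ℕ) → (Fin m → Outcome n) → PMF (OnlineAlg n)

/-- Expected profit in round `m + 1`, over `m + 1` i.i.d. rounds. -/
def expectedProfit {n : ℕ} (p : ProfitFn n) (𝔻 : Distributions n) (P : Policy n) (m : ℕ) : ℝ :=
  ∫ w : Fin (m + 1) → Outcome n, randProfit p (P m (Fin.init w)) (w (Fin.last m))
    ∂(Measure.pi fun _ => 𝔻.law)

/-- In round `m + 1` the policy is `α`-competitive on `𝔻`. -/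
def CompetitiveAt {n : ℕ} (p : ProfitFn n) (𝔻 : Distributions n) (P : Policy n) (m : ℕ)
    (α : ℝ) : Prop :=
  α * optOffline p 𝔻 ≤ expectedProfit p 𝔻 P m

/-- Regret over `T` rounds; the entry `t : Fin T` is round `t + 1`. -/
def regret {n : ℕ} (p : ProfitFn n) (𝔻 : Distributions n) (P : Policy n) (T : ℕ) : ℝ :=
  ∫ w : Fin T → Outcome n,
    (∑ t : Fin T, (optOnline p 𝔻 -
      randProfit p (P t.val fun j => w (Fin.castLE t.isLt.le j)) (w t)))
    ∂(Measure.pi fun _ => 𝔻.law)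

/-! ### Threshold algorithms and empirical optimization -/

/-- The comparison `θ < v` (if `strict`) or `θ ≤ v`, for a threshold `θ ∈ [0,1] ∪ {∞}`. -/
def Passes (strict : Bool) (θ : WithTop unitInterval) (v : unitInterval) : Prop :=
  if strict = true then θ < (v : WithTop unitInterval) else θ ≤ (v : WithTop unitInterval)

/-- Essentially threshold algorithms: `x_i` is accepted iff it is at least all earlier values and
passes the threshold `θ_i(τ_{≤ i})`, where each comparison is either `≥` or `>`. -/
def IsEssThreshold {n : ℕ} (a : OnlineAlg n) : Prop :=
  ∃ (θ : (i : Fin n) → (Fin (i.val + 1) ↪ Fin n) → WithTop unitInterval)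
    (strict : (i : Fin n) → (Fin (i.val + 1) ↪ Fin n) → Bool),
    ∀ i x σ, a.accept i x σ = true ↔
      (∀ j, x j ≤ x (Fin.last i.val)) ∧ Passes (strict i σ) (θ i σ) (x (Fin.last i.val))

/-- Expected profit under the empirical distribution of `m` observed rounds. -/
def empProfit {n m : ℕ} (p : ProfitFn n) (s : Fin m → Outcome n) (a : OnlineAlg n) : ℝ :=
  (∑ j, profit p a (s j)) / m

/-- `h` picks, measurably in the observed rounds, an essentially threshold algorithm that is optimal
among all of these for the empirical distribution. -/
structure IsEmpiricalOptimizer {n : ℕ} (p : ProfitFn n)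
    (h : (m : ℕ) → (Fin m → Outcome n) → OnlineAlg n) : Prop where
  essThreshold : ∀ m s, IsEssThreshold (h m s)
  optimal : ∀ m s a, IsEssThreshold a → empProfit p s a ≤ empProfit p s (h m s)
  measurable : ∀ m i σ, Measurable
    fun q : (Fin m → Outcome n) × (Fin (i.val + 1) → unitInterval) => (h m q.1).accept i q.2 σ

/-! ### The switching framework -/

/-- `ζ(t) = min {t, max {t₀ + 1, ⌊(t + 1) / 2⌋}}` -/
def zeta (t₀ t : ℕ) : ℕ := min t (max (t₀ + 1) ((t + 1) / 2))

/-- `ε₁(t) = 6 B √(2 κ ln(4t) / (t - 1))` -/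
def eps₁ (B : ℝ) (κ t : ℕ) : ℝ :=
  6 * B * Real.sqrt (2 * κ * Real.log (4 * t) / ((t : ℝ) - 1))

/-- `δ₁(t) = 1 / (2 t^κ)` -/
def delta₁ (κ t : ℕ) : ℝ := 1 / (2 * (t : ℝ) ^ κ)

/-- `δ₀(m, η) = 2 exp(-2 m η² / B²)` -/
def delta₀ (B : ℝ) (m : ℕ) (η : ℝ) : ℝ := 2 * Real.exp (-(2 * m * η ^ 2) / B ^ 2)

/-- `ε(t) = ε₁(ζ(t))` -/
def eps (B : ℝ) (κ t₀ t : ℕ) : ℝ := eps₁ B κ (zeta t₀ t)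

/-- `δ(t) = 2 δ₀(t - ζ(t), ε₁(ζ(t))) + δ₁(ζ(t))` -/
def delta (B : ℝ) (κ t₀ t : ℕ) : ℝ :=
  2 * delta₀ B (t - zeta t₀ t) (eps₁ B κ (zeta t₀ t)) + delta₁ κ (zeta t₀ t)

theorem zeta_pred_le (t₀ m : ℕ) : zeta t₀ (m + 1) - 1 ≤ m := by
  unfold zeta; omega

/-- The first `ζ(m + 1) - 1` of `m` observed rounds, used for training. -/
def train {n : ℕ} (t₀ : ℕ) {m : ℕ} (s : Fin m → Outcome n) :
    Fin (zeta t₀ (m + 1) - 1) → Outcome n :=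
  fun j => s (Fin.castLE (zeta_pred_le t₀ m) j)

/-- Mean profit of `r` over the test rounds `ζ(t), …, t - 1`, where `t = m + 1`. -/
def testMean {n : ℕ} (p : ProfitFn n) (t₀ : ℕ) {m : ℕ} (s : Fin m → Outcome n)
    (r : PMF (OnlineAlg n)) : ℝ :=
  (∑ j ∈ Finset.univ.filter (fun j : Fin m => zeta t₀ (m + 1) ≤ j.val + 1), randProfit p r (s j))
    / ((m + 1 - zeta t₀ (m + 1) : ℕ) : ℝ)

/-- The event `𝒞_t` for `t = m + 1`, where `g`, `h` have been trained on the first `ζ(t) - 1`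
rounds; it does not occur when there is no test round. -/
def SwitchEvent {n : ℕ} (p : ProfitFn n) (B : ℝ) (κ t₀ : ℕ) {m : ℕ} (s : Fin m → Outcome n)
    (g h : PMF (OnlineAlg n)) : Prop :=
  zeta t₀ (m + 1) < m + 1 ∧
    testMean p t₀ s g + eps B κ t₀ (m + 1) + B * delta B κ t₀ (m + 1) ≤
      (1 - delta B κ t₀ (m + 1)) * (testMean p t₀ s h - eps B κ t₀ (m + 1))

open Classical in
/-- In round `t = m + 1`, use `h_{ζ(t)}` if `𝒞_t` occurs and the baseline `g_{ζ(t)}` otherwise. -/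
def switching {n : ℕ} (p : ProfitFn n) (B : ℝ) (κ t₀ : ℕ) (g h : Policy n) : Policy n :=
  fun _ s =>
    if SwitchEvent p B κ t₀ s (g _ (train t₀ s)) (h _ (train t₀ s)) then h _ (train t₀ s)
    else g _ (train t₀ s)

/-! ### The baseline for best choice -/

/-- Accept the `i`-th arriving value, whatever it is. -/
def pickAlg {n : ℕ} (i : Fin n) : OnlineAlg n where
  accept j _ _ := decide (j = i)
  measurable_accept _ _ := measurable_const

open Classical in
/-- Accept the first value that is `≥ θ` (if `strict` is false) or `> θ` (if `strict` is true). -/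
def constThreshold (n : ℕ) (strict : Bool) (θ : unitInterval) : OnlineAlg n where
  accept i x _ := if strict = true then decide (θ < x (Fin.last i.val))
    else decide (θ ≤ x (Fin.last i.val))
  measurable_accept i _ := by
    have hx : Measurable fun x : Fin (i.val + 1) → unitInterval => x (Fin.last i.val) :=
      measurable_pi_apply _
    by_cases hs : strict = true
    · simp only [hs, if_true]
      refine measurable_to_bool ?_
      have he : (fun x : Fin (i.val + 1) → unitInterval => decide (θ < x (Fin.last i.val))) ⁻¹' {true}
          = {x | θ < x (Fin.last i.val)} := by ext; simp
      rw [he]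
      exact measurableSet_lt measurable_const hx
    · simp only [hs]
      refine measurable_to_bool ?_
      have he : (fun x : Fin (i.val + 1) → unitInterval => decide (θ ≤ x (Fin.last i.val))) ⁻¹' {true}
          = {x | θ ≤ x (Fin.last i.val)} := by ext; simp
      simp only [Bool.false_eq_true, if_false]
      rw [he]
      exact measurableSet_le measurable_const hx

/-- With no sample: accept a uniformly random position. With at least one sample: use the maximum of
the first observed round as a threshold; `tie` is the law of the choice between `>` (`true`) and
`≥` (`false`), so that `PMF.pure false` is the rule "accept the first value `≥` the threshold". -/
def singleSampleBaseline (n : ℕ) [NeZero n] (tie : PMF Bool) : Policy n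
  | 0, _ => (PMF.uniformOfFintype (Fin n)).map pickAlg
  | _ + 1, s => tie.map fun strict => constThreshold n strict (Finset.univ.sup (s 0).1)

/-- The switching framework for best choice (`B = 1`, `t₀ = 1`) with the single-sample baseline,
the empirical optimizer `h` and the complexity parameter `κ`. -/
def secretaryPolicy (n : ℕ) [NeZero n] (κ : ℕ) (tie : PMF Bool)
    (h : (m : ℕ) → (Fin m → Outcome n) → OnlineAlg n) : Policy n :=
  switching (bestChoice n) 1 κ 1 (singleSampleBaseline n tie) fun m s => PMF.pure (h m s)

end

end OptStop

namespace OptStop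

noncomputable section

open MeasureTheory

/-! ### Stopping indices and measurability -/

/-! Four facts combine.

(a) The online optimum is attained by an essentially threshold algorithm. For an accepted record
`z`, the chance `winValue` that it stays the maximum increases with `z`. The chance `contValue` of
still winning after rejecting decreases with the running maximum. When a record `z` arrives, the
running maximum after rejecting it is `z` itself, so both options depend on `z` and the labels only.
Accepting is therefore right on an up-set of values, that is, beyond a threshold.
`integral_profit_le_optimalAlg` proves optimality with a potential that no algorithm can increase
and that this rule keeps constant.

(b) On `2m` rounds such an algorithm is determined by one sample value (or none) for each label
prefix in a set `K` that carries the order, so there are at most `(2m+1)^|K|` behaviours.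
Symmetrization and exponential moments (`integral_gap_le`) bound the expected suboptimality of the
empirical optimizer by `√(2|K| log(2m+1)/m)`. In adversarial order `|K| = n`; in general `|K| ≤ 3
n!`.

(c) The single-sample rule wins with probability at least `1/4 + 1/(256 n²)`
(`integral_baseline_ge`), whatever the order. Exchanging values between the round and the sample
shows that, on average over the exchanges, the rules `>` and `≥` together win at least half a time.
The surplus comes from the event that one position holds the two largest values in both rounds.

(d) Given the training rounds, Hoeffding's inequality on the test rounds shows that switching costs
at most `2 exp(-2kε²)` against the baseline and `O(ε + δ)` against the optimizer, where `k` is the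
number of test rounds. For `κ ≥ n` the first loss is at most `1/(256 n²)`, so the surplus in (c)
pays for it and the constant `1/4` is met exactly. For `κ ≤ 2L` and `|K| ≤ 3L` (with `L = n` or `L =
n!`) the expected loss in round `t` is `O(√(L log T / t))`, and summing over `t ≤ T` gives the
regret bound. -/

instance (n : ℕ) : DiscreteMeasurableSpace (Equiv.Perm (Fin n)) := ⟨fun _ => trivial⟩

variable {n : ℕ}

/-- The algorithm accepts at step `i` (if it gets there). -/
def Accepts (a : OnlineAlg n) (ω : Outcome n) (i : Fin n) : Prop :=
  a.accept i (valuesUpTo ω.1 i) (labelsUpTo ω.2 i) = true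

open Classical in
theorem isLeast_stopIndex (a : OnlineAlg n) (ω : Outcome n) :
    IsLeast {k : Fin (n + 1) | k = Fin.last n ∨ ∃ i : Fin n, k = i.castSucc ∧ Accepts a ω i}
      (stopIndex a ω) := by
  have h := Finset.isLeast_min' (Finset.univ.filter fun k : Fin (n + 1) => k = Fin.last n ∨
      ∃ i : Fin n, k = i.castSucc ∧
        a.accept i (valuesUpTo ω.1 i) (labelsUpTo ω.2 i) = true) ⟨Fin.last n, by simp⟩
  refine ⟨(Finset.mem_filter.1 h.1).2, fun k hk => h.2 ?_⟩
  exact Finset.mem_coe.2 (Finset.mem_filter.2 ⟨Finset.mem_univ _, hk⟩)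

theorem stopIndex_eq_castSucc {a : OnlineAlg n} {ω : Outcome n} {i : Fin n} :
    stopIndex a ω = i.castSucc ↔ Accepts a ω i ∧ ∀ j < i, ¬ Accepts a ω j := by
  have h := isLeast_stopIndex a ω
  constructor
  · intro he
    rw [he] at h
    refine ⟨?_, fun j hj hacc => ?_⟩
    · rcases h.1 with h | ⟨k, hk, hacc⟩
      · exact absurd h (Fin.castSucc_lt_last i).ne
      · rw [Fin.castSucc_inj] at hk
        subst hk
        exact hacc
    · exact absurd (h.2 (Or.inr ⟨j, rfl, hacc⟩)) (not_le.2 (Fin.castSucc_lt_castSucc_iff.2 hj))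
  · rintro ⟨h1, h2⟩
    refine h.unique ⟨Or.inr ⟨i, rfl, h1⟩, ?_⟩
    rintro b (rfl | ⟨k, rfl, hacc⟩)
    · exact Fin.le_last _
    · by_contra hlt
      exact h2 k (Fin.castSucc_lt_castSucc_iff.1 (not_le.1 hlt)) hacc

theorem stopIndex_eq_last {a : OnlineAlg n} {ω : Outcome n} :
    stopIndex a ω = Fin.last n ↔ ∀ j, ¬ Accepts a ω j := by
  have h := isLeast_stopIndex a ω
  constructor
  · intro he j hacc
    rw [he] at h
    exact absurd (h.2 (Or.inr ⟨j, rfl, hacc⟩)) (not_le.2 (Fin.castSucc_lt_last j))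
  · intro h'
    rcases h.1 with h1 | ⟨k, -, hacc⟩
    · exact h1
    · exact absurd hacc (h' k)

theorem stopIndex_congr {a b : OnlineAlg n} {ω : Outcome n}
    (h : ∀ i, Accepts a ω i ↔ Accepts b ω i) : stopIndex a ω = stopIndex b ω := by
  refine Fin.lastCases (motive := fun k => stopIndex b ω = k → stopIndex a ω = k) ?_ ?_ _ rfl
  · intro hb
    rw [stopIndex_eq_last] at hb ⊢
    simpa only [h] using hb
  · intro i hb
    rw [stopIndex_eq_castSucc] at hb ⊢
    simpa only [h] using hb

/-- A family of algorithms that depends measurably on a parameter. -/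
def MeasurableFamily {X : Type*} [MeasurableSpace X] (A : X → OnlineAlg n) : Prop :=
  ∀ i σ, Measurable fun q : X × (Fin (i.val + 1) → unitInterval) => (A q.1).accept i q.2 σ

theorem measurableFamily_const {X : Type*} [MeasurableSpace X] (a : OnlineAlg n) :
    MeasurableFamily fun _ : X => a :=
  fun i σ => (a.measurable_accept i σ).comp measurable_snd

theorem MeasurableFamily.comp {X Y : Type*} [MeasurableSpace X] [MeasurableSpace Y]
    {A : X → OnlineAlg n} (hA : MeasurableFamily A) {f : Y → X} (hf : Measurable f) :
    MeasurableFamily fun y => A (f y) :=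
  fun i σ => (hA i σ).comp (hf.prodMap measurable_id)

theorem measurable_valuesUpTo (i : Fin n) : Measurable fun x => valuesUpTo x i :=
  measurable_pi_iff.2 fun _ => measurable_pi_apply _

/-- There are finitely many permutations, so measurability can be checked with the permutation, and
hence the labels, held fixed. -/
theorem MeasurableFamily.measurableSet_accepts {X : Type*} [MeasurableSpace X]
    {A : X → OnlineAlg n} (hA : MeasurableFamily A) (i : Fin n) :
    MeasurableSet {q : X × Outcome n | Accepts (A q.1) q.2 i} := by
  have h : Measurable fun r : (X × (Fin n → unitInterval)) × Equiv.Perm (Fin n) =>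
      (A r.1.1).accept i (valuesUpTo r.1.2 i) (labelsUpTo r.2 i) := by
    refine measurable_from_prod_countable_left fun τ => ?_
    exact (hA i (labelsUpTo τ i)).comp
      (measurable_fst.prodMk ((measurable_valuesUpTo i).comp measurable_snd))
  have h' := h.comp (MeasurableEquiv.prodAssoc (α := X) (β := Fin n → unitInterval)
    (γ := Equiv.Perm (Fin n))).symm.measurable
  exact h' (measurableSet_singleton true)

theorem MeasurableFamily.measurable_stopIndex {X : Type*} [MeasurableSpace X]
    {A : X → OnlineAlg n} (hA : MeasurableFamily A) :
    Measurable fun q : X × Outcome n => stopIndex (A q.1) q.2 := by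
  refine measurable_to_countable' fun k => ?_
  induction k using Fin.lastCases with
  | last =>
    have : (fun q : X × Outcome n => stopIndex (A q.1) q.2) ⁻¹' {Fin.last n} =
        ⋂ j, {q : X × Outcome n | Accepts (A q.1) q.2 j}ᶜ := by
      ext q; simp [stopIndex_eq_last]
    rw [this]
    exact MeasurableSet.iInter fun j => (hA.measurableSet_accepts j).compl
  | cast i =>
    have : (fun q : X × Outcome n => stopIndex (A q.1) q.2) ⁻¹' {i.castSucc} =
        {q : X × Outcome n | Accepts (A q.1) q.2 i} ∩
        ⋂ j, ⋂ (_ : j < i), {q : X × Outcome n | Accepts (A q.1) q.2 j}ᶜ := by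
      ext q; simp [stopIndex_eq_castSucc]
    rw [this]
    exact (hA.measurableSet_accepts i).inter
      (MeasurableSet.iInter fun j => MeasurableSet.iInter fun _ =>
        (hA.measurableSet_accepts j).compl)

theorem measurable_sup_univ {ι : Type*} [Fintype ι] :
    Measurable fun x : ι → unitInterval => Finset.univ.sup x :=
  measurable_of_Iic fun c => by
    have : (fun x : ι → unitInterval => Finset.univ.sup x) ⁻¹' Set.Iic c =
        ⋂ i, {x | x i ≤ c} := by
      ext x; simp
    rw [this]
    exact MeasurableSet.iInter fun i => measurableSet_le (measurable_pi_apply i) measurable_const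

theorem measurable_bestChoice (k : Fin (n + 1)) : Measurable fun x => bestChoice n x k := by
  unfold bestChoice
  refine Measurable.ite (measurableSet_eq_fun ?_ measurable_sup_univ) measurable_const
    measurable_const
  induction k using Fin.lastCases with
  | last => simp only [Fin.snoc_last, measurable_const]
  | cast i => simpa only [Fin.snoc_castSucc] using measurable_pi_apply i

theorem measurable_bestChoice_uncurry :
    Measurable fun r : (Fin n → unitInterval) × Fin (n + 1) => bestChoice n r.1 r.2 := by
  apply measurable_from_prod_countable_left
  intro k
  exact measurable_bestChoice k

theorem MeasurableFamily.measurable_profit {X : Type*} [MeasurableSpace X]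
    {A : X → OnlineAlg n} (hA : MeasurableFamily A) :
    Measurable fun q : X × Outcome n => profit (bestChoice n) (A q.1) q.2 := by
  have h2 : Measurable fun q : X × Outcome n => (q.2.1, stopIndex (A q.1) q.2) :=
    (measurable_fst.comp measurable_snd).prodMk hA.measurable_stopIndex
  have h3 := measurable_bestChoice_uncurry.comp h2
  exact h3

theorem measurable_profit (a : OnlineAlg n) : Measurable (profit (bestChoice n) a) := by
  have h := (measurableFamily_const (X := Unit) a).measurable_profit
  exact h.of_uncurry_left (f := fun (_ : Unit) ω => profit (bestChoice n) a ω) (x := ())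

theorem bestChoice_mem (x : Fin n → unitInterval) (k : Fin (n + 1)) :
    bestChoice n x k ∈ Set.Icc (0 : ℝ) 1 := by
  unfold bestChoice
  split_ifs <;> simp

theorem profit_mem (a : OnlineAlg n) (ω : Outcome n) :
    profit (bestChoice n) a ω ∈ Set.Icc (0 : ℝ) 1 := bestChoice_mem _ _

theorem bestChoice_castSucc (x : Fin n → unitInterval) (i : Fin n)
    [Decidable (x i = Finset.univ.sup x)] :
    bestChoice n x i.castSucc = if x i = Finset.univ.sup x then 1 else 0 := by
  unfold bestChoice
  simp only [Fin.snoc_castSucc]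

theorem bestChoice_last (x : Fin n → unitInterval)
    [Decidable ((0 : unitInterval) = Finset.univ.sup x)] :
    bestChoice n x (Fin.last n) = if 0 = Finset.univ.sup x then 1 else 0 := by
  unfold bestChoice
  simp only [Fin.snoc_last]

/-! ### Randomized algorithms with finitely many alternatives -/

/-- `randProfit` is a `tsum` over the whole type of algorithms. As `f` need not be injective, the
mass at each algorithm is first split over its preimages, and then the two sums are exchanged. -/
theorem randProfit_map {β : Type*} [Fintype β] (p : ProfitFn n) (q : PMF β)
    (f : β → OnlineAlg n) (ω : Outcome n) :
    randProfit p (q.map f) ω = ∑ b, (q b).toReal * profit p (f b) ω := by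
  classical
  unfold randProfit
  have h : ∀ a, ((q.map f) a).toReal * profit p a ω =
      ∑ b, if a = f b then (q b).toReal * profit p (f b) ω else 0 := by
    intro a
    rw [PMF.map_apply, tsum_fintype, ENNReal.toReal_sum, Finset.sum_mul]
    · refine Finset.sum_congr rfl fun b _ => ?_
      split_ifs with hab
      · rw [hab]
      · simp
    · intro b _
      split_ifs
      · exact q.apply_ne_top b
      · simp
  simp_rw [h]
  rw [Summable.tsum_finsetSum]
  · refine Finset.sum_congr rfl fun b _ => ?_
    rw [tsum_ite_eq]
  · intro b _
    exact (hasSum_ite_eq (f b) _).summable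

theorem randProfit_pure (p : ProfitFn n) (a : OnlineAlg n) (ω : Outcome n) :
    randProfit p (PMF.pure a) ω = profit p a ω := by
  have := randProfit_map p (PMF.pure ()) (fun _ => a) ω
  rw [PMF.pure_map] at this
  rw [this]
  simp

theorem sum_toReal_pmf {β : Type*} [Fintype β] (q : PMF β) : ∑ b, (q b).toReal = 1 := by
  rw [← ENNReal.toReal_sum fun b _ => q.apply_ne_top b, ← tsum_fintype (L := .unconditional _),
    q.tsum_coe]
  simp

theorem randProfit_map_mem {β : Type*} [Fintype β] (q : PMF β)
    (f : β → OnlineAlg n) (ω : Outcome n) :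
    randProfit (bestChoice n) (q.map f) ω ∈ Set.Icc (0 : ℝ) 1 := by
  rw [randProfit_map]
  constructor
  · exact Finset.sum_nonneg fun b _ => mul_nonneg ENNReal.toReal_nonneg (profit_mem _ _).1
  · rw [← sum_toReal_pmf q]
    exact Finset.sum_le_sum fun b _ =>
      mul_le_of_le_one_right ENNReal.toReal_nonneg (profit_mem _ _).2

/-! ### The law of a round -/

/-- The arrival sequence produced by labelled values and a permutation. -/
def arrange (q : (Fin n → unitInterval) × Equiv.Perm (Fin n)) : Outcome n :=
  (fun i => q.1 (q.2 i), q.2)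

theorem measurable_arrange : Measurable (arrange (n := n)) := by
  refine measurable_from_prod_countable_left fun τ => ?_
  have h : Measurable fun (x : Fin n → unitInterval) i => x (τ i) :=
    measurable_pi_iff.2 fun i => measurable_pi_apply (τ i)
  exact h.prodMk measurable_const

/-- The law of the labelled values. -/
def Distributions.values (𝔻 : Distributions n) : Measure (Fin n → unitInterval) :=
  Measure.pi fun i => (𝔻.dist i : Measure unitInterval)

instance (𝔻 : Distributions n) : IsProbabilityMeasure 𝔻.values := by
  unfold Distributions.values; infer_instance

instance (𝔻 : Distributions n) : IsProbabilityMeasure 𝔻.order.toMeasure :=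
  PMF.toMeasure.isProbabilityMeasure _

theorem Distributions.law_eq (𝔻 : Distributions n) :
    𝔻.law = (𝔻.values.prod 𝔻.order.toMeasure).map arrange := rfl

instance (𝔻 : Distributions n) : IsProbabilityMeasure 𝔻.law := by
  rw [Distributions.law_eq]
  exact Measure.isProbabilityMeasure_map measurable_arrange.aemeasurable

theorem integral_mem_Icc {X : Type*} [MeasurableSpace X] {μ : Measure X} [IsProbabilityMeasure μ]
    {f : X → ℝ} (h : ∀ x, f x ∈ Set.Icc (0 : ℝ) 1) : ∫ x, f x ∂μ ∈ Set.Icc (0 : ℝ) 1 := by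
  refine ⟨integral_nonneg fun x => (h x).1, ?_⟩
  by_cases hf : Integrable f μ
  · calc ∫ x, f x ∂μ ≤ ∫ _, (1 : ℝ) ∂μ :=
        integral_mono hf (integrable_const _) fun x => (h x).2
      _ = 1 := by simp
  -- A non-integrable function has Bochner integral `0`, so the bound needs no measurability.
  · rw [integral_undef hf]; exact zero_le_one

theorem integrable_of_mem_Icc {X : Type*} [MeasurableSpace X] {μ : Measure X} [IsFiniteMeasure μ]
    {f : X → ℝ} (hf : Measurable f) {a b : ℝ} (h : ∀ x, f x ∈ Set.Icc a b) : Integrable f μ :=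
  Integrable.of_mem_Icc a b hf.aemeasurable (Filter.Eventually.of_forall h)

theorem optOffline_le_one (𝔻 : Distributions n) : optOffline (bestChoice n) 𝔻 ≤ 1 := by
  unfold optOffline
  refine (integral_mem_Icc fun ω => ⟨?_, ?_⟩).2
  · exact Real.iSup_nonneg fun k => (bestChoice_mem _ _).1
  · exact ciSup_le fun k => (bestChoice_mem _ _).2

theorem integral_profit_mem (𝔻 : Distributions n) (a : OnlineAlg n) :
    ∫ ω, profit (bestChoice n) a ω ∂𝔻.law ∈ Set.Icc (0 : ℝ) 1 :=
  integral_mem_Icc fun _ => profit_mem _ _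

end

end OptStop

namespace OptStop

noncomputable section

open MeasureTheory

/-! ### Product measures -/

section Product

variable {Ω : Type*} [MeasurableSpace Ω] {ι α β : Type*} [Fintype ι] [Fintype α] [Fintype β]

theorem measurePreserving_comp_injective (μ : ι → Measure Ω) [∀ i, IsProbabilityMeasure (μ i)]
    {e : α → ι} (he : Function.Injective e) :
    MeasurePreserving (fun (w : ι → Ω) a => w (e a)) (Measure.pi μ)
      (Measure.pi fun a => μ (e a)) where
  measurable := measurable_pi_iff.2 fun a => measurable_pi_apply _
  map_eq := by
    refine (Measure.pi_eq fun s hs => ?_).symm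
    have hm : Measurable fun (w : ι → Ω) a => w (e a) :=
      measurable_pi_iff.2 fun a => measurable_pi_apply _
    rw [Measure.map_apply hm (MeasurableSet.univ_pi hs)]
    have hpre : (fun (w : ι → Ω) a => w (e a)) ⁻¹' Set.univ.pi s =
        Set.univ.pi (Function.extend e s fun _ => Set.univ) := by
      ext w
      simp only [Set.mem_preimage, Set.mem_univ_pi]
      constructor
      · intro h i
        by_cases hi : ∃ a, e a = i
        · obtain ⟨a, rfl⟩ := hi
          rw [he.extend_apply]
          exact h a
        · rw [Function.extend_apply' _ _ _ hi]
          trivial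
      · intro h a
        have := h (e a)
        rwa [he.extend_apply] at this
    rw [hpre, Measure.pi_pi]
    refine (Fintype.prod_of_injective e he _ _ (fun i hi => ?_) fun a => ?_).symm
    · rw [Function.extend_apply' _ _ _ (by simpa using hi)]
      simp
    · rw [he.extend_apply]

/-- Disjoint blocks of coordinates are independent. This separates the present round from the past,
and the training rounds from the test rounds. -/
theorem measurePreserving_blocks (μ : ι → Measure Ω) [∀ i, IsProbabilityMeasure (μ i)]
    {e₁ : α → ι} {e₂ : β → ι} (h₁ : Function.Injective e₁) (h₂ : Function.Injective e₂)
    (h : ∀ a b, e₁ a ≠ e₂ b) :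
    MeasurePreserving (fun w : ι → Ω => ((fun a => w (e₁ a)), fun b => w (e₂ b))) (Measure.pi μ)
      ((Measure.pi fun a => μ (e₁ a)).prod (Measure.pi fun b => μ (e₂ b))) := by
  have hs : Function.Injective (Sum.elim e₁ e₂) := h₁.sumElim h₂ h
  have := (measurePreserving_sumPiEquivProdPi (fun s => μ (Sum.elim e₁ e₂ s))).comp
    (measurePreserving_comp_injective μ hs)
  exact this

theorem integral_comp_measurePreserving {X Y : Type*} [MeasurableSpace X] [MeasurableSpace Y]
    {μ : Measure X} {ν : Measure Y} {f : X → Y} (hf : MeasurePreserving f μ ν) {g : Y → ℝ}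
    (hg : Measurable g) : ∫ x, g (f x) ∂μ = ∫ y, g y ∂ν := by
  rw [← hf.map_eq, integral_map hf.measurable.aemeasurable hg.aestronglyMeasurable]

/-- Resampling one coordinate does not change the law. The dynamic program uses this to draw the
next value afresh while the earlier ones stay fixed. -/
theorem lintegral_update (μ : ι → Measure Ω) [∀ i, IsProbabilityMeasure (μ i)] [DecidableEq ι]
    {f : (ι → Ω) → ENNReal} (hf : Measurable f) (i : ι) :
    ∫⁻ x, ∫⁻ z, f (Function.update x i z) ∂μ i ∂Measure.pi μ = ∫⁻ x, f x ∂Measure.pi μ := by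
  rcases isEmpty_or_nonempty (ι → Ω) with hE | ⟨⟨x₀⟩⟩
  · simp [lintegral_of_isEmpty]
  have hg : Measurable fun x : ι → Ω => ∫⁻ z, f (Function.update x i z) ∂μ i :=
    Measurable.lintegral_prod_right'
      (f := fun q : (ι → Ω) × Ω => f (Function.update q.1 i q.2))
      (hf.comp (measurable_update' (a := i)))
  rw [lintegral_eq_lmarginal_univ x₀, lintegral_eq_lmarginal_univ x₀,
    lmarginal_erase' f hf (Finset.mem_univ i), lmarginal_erase' _ hg (Finset.mem_univ i)]
  congr 1
  funext x
  simp

variable {ν : Measure Ω} [IsProbabilityMeasure ν]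

/-- Hoeffding's inequality for the mean of i.i.d. `[0,1]`-valued random variables. -/
theorem hoeffding_upper {f : Ω → ℝ} (hf : Measurable f) (hb : ∀ ω, f ω ∈ Set.Icc (0 : ℝ) 1)
    (hk : 0 < Fintype.card ι) {η : ℝ} (hη : 0 ≤ η) :
    (Measure.pi fun _ : ι => ν).real
        {w | ∫ ω, f ω ∂ν + η ≤ (∑ j, f (w j)) / Fintype.card ι} ≤
      Real.exp (-(2 * Fintype.card ι * η ^ 2)) := by
  set k := Fintype.card ι with hkdef
  have hk' : (0 : ℝ) < k := by exact_mod_cast hk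
  set c := ∫ ω, f ω ∂ν
  have hind : ProbabilityTheory.iIndepFun (fun (j : ι) (w : ι → Ω) => f (w j) - c)
      (Measure.pi fun _ : ι => ν) :=
    ProbabilityTheory.iIndepFun_pi (X := fun _ ω => f ω - c)
      (fun _ => (hf.sub_const c).aemeasurable)
  have hsub : ∀ j ∈ (Finset.univ : Finset ι), ProbabilityTheory.HasSubgaussianMGF
      (fun w : ι → Ω => f (w j) - c) ((‖(1 : ℝ) - 0‖₊ / 2) ^ 2) (Measure.pi fun _ : ι => ν) := by
    intro j _
    have hm : Measurable fun w : ι → Ω => f (w j) := hf.comp (measurable_pi_apply j)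
    have := ProbabilityTheory.hasSubgaussianMGF_of_mem_Icc (μ := Measure.pi fun _ : ι => ν)
      (X := fun w : ι → Ω => f (w j)) (a := 0) (b := 1) hm.aemeasurable
      (Filter.Eventually.of_forall fun w => hb _)
    have hc : ∫ w : ι → Ω, f (w j) ∂(Measure.pi fun _ : ι => ν) = c :=
      MeasureTheory.integral_comp_eval (μ := fun _ : ι => ν) (i := j) hf.aestronglyMeasurable
    rwa [hc] at this
  have h := ProbabilityTheory.HasSubgaussianMGF.measure_sum_ge_le_of_iIndepFun hind hsub
    (ε := k * η) (by positivity)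
  have hset : {w : ι → Ω | c + η ≤ (∑ j, f (w j)) / k} =
      {w | k * η ≤ ∑ j, (f (w j) - c)} := by
    ext w
    simp only [Set.mem_ofPred_eq, le_div_iff₀ hk', Finset.sum_sub_distrib, Finset.sum_const,
      Finset.card_univ, nsmul_eq_mul, ← hkdef]
    constructor <;> intro h <;> linarith
  rw [hset]
  refine h.trans (le_of_eq ?_)
  congr 1
  simp only [Finset.sum_const, Finset.card_univ, ← hkdef]
  -- A `[0,1]`-valued variable has variance proxy `1/4`, so the sum has `k/4` and the exponent is
  -- `(kη)² / (2 · k/4) = 2kη²`.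
  have hc : ((k • (‖(1 : ℝ) - 0‖₊ / 2) ^ 2 : NNReal) : ℝ) = k * (1 / 4) := by
    simp; norm_num
  rw [hc]
  field_simp
  norm_num

theorem hoeffding_lower {f : Ω → ℝ} (hf : Measurable f) (hb : ∀ ω, f ω ∈ Set.Icc (0 : ℝ) 1)
    (hk : 0 < Fintype.card ι) {η : ℝ} (hη : 0 ≤ η) :
    (Measure.pi fun _ : ι => ν).real
        {w | (∑ j, f (w j)) / Fintype.card ι ≤ ∫ ω, f ω ∂ν - η} ≤
      Real.exp (-(2 * Fintype.card ι * η ^ 2)) := by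
  have hk' : (0 : ℝ) < Fintype.card ι := by exact_mod_cast hk
  have h := hoeffding_upper (ν := ν) (ι := ι) (f := fun ω => 1 - f ω) (hf.const_sub 1)
    (fun ω => ⟨by linarith [(hb ω).2], by linarith [(hb ω).1]⟩) hk hη
  convert h using 4 with w
  · rw [integral_sub (integrable_const _) (integrable_of_mem_Icc hf hb)]
    simp only [Finset.sum_sub_distrib, Finset.sum_const, Finset.card_univ, nsmul_eq_mul, mul_one,
      integral_const, probReal_univ, smul_eq_mul, sub_div, div_self hk'.ne']
    constructor <;> intro h <;> linarith

end Product

end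

end OptStop

namespace OptStop

noncomputable section

open MeasureTheory

/-! ### Averaging over permutations with a common prefix -/

section Averaging

variable {n : ℕ}

/-- The permutations agree on the first `k` positions. -/
def Agree (k : ℕ) (τ τ' : Equiv.Perm (Fin n)) : Prop := ∀ i : Fin n, i.val < k → τ i = τ' i

theorem Agree.symm {k : ℕ} {τ τ' : Equiv.Perm (Fin n)} (h : Agree k τ τ') : Agree k τ' τ :=
  fun i hi => (h i hi).symm

theorem Agree.trans {k : ℕ} {τ τ' τ'' : Equiv.Perm (Fin n)} (h : Agree k τ τ')
    (h' : Agree k τ' τ'') : Agree k τ τ'' := fun i hi => (h i hi).trans (h' i hi)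

theorem Agree.refl (k : ℕ) (τ : Equiv.Perm (Fin n)) : Agree k τ τ := fun _ _ => rfl

theorem Agree.mono {k l : ℕ} (hkl : k ≤ l) {τ τ' : Equiv.Perm (Fin n)} (h : Agree l τ τ') :
    Agree k τ τ' := fun i hi => h i (hi.trans_le hkl)

theorem Agree.eq {τ τ' : Equiv.Perm (Fin n)} (h : Agree n τ τ') : τ = τ' :=
  Equiv.ext fun i => h i i.isLt

open Classical in
/-- The permutations that agree with `τ` on the first `k` positions. -/
def prefixClass (k : ℕ) (τ : Equiv.Perm (Fin n)) : Finset (Equiv.Perm (Fin n)) :=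
  Finset.univ.filter fun τ' => Agree k τ τ'

theorem mem_prefixClass {k : ℕ} {τ τ' : Equiv.Perm (Fin n)} :
    τ' ∈ prefixClass k τ ↔ Agree k τ τ' := by
  simp [prefixClass]

theorem prefixClass_congr {k : ℕ} {τ τ' : Equiv.Perm (Fin n)} (h : Agree k τ τ') :
    prefixClass k τ = prefixClass k τ' := by
  ext σ
  rw [mem_prefixClass, mem_prefixClass]
  exact ⟨h.symm.trans, h.trans⟩

/-- The average of `f` over the permutations that agree with `τ` on the first `k` positions. -/
def prefixAvg (k : ℕ) (f : Equiv.Perm (Fin n) → ENNReal) (τ : Equiv.Perm (Fin n)) : ENNReal :=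
  (∑ τ' ∈ prefixClass k τ, f τ') * ((prefixClass k τ).card : ENNReal)⁻¹

theorem prefixAvg_congr {k : ℕ} {τ τ' : Equiv.Perm (Fin n)} (h : Agree k τ τ')
    (f : Equiv.Perm (Fin n) → ENNReal) : prefixAvg k f τ = prefixAvg k f τ' := by
  unfold prefixAvg
  rw [prefixClass_congr h]

theorem prefixAvg_mono {k : ℕ} {f g : Equiv.Perm (Fin n) → ENNReal} (h : ∀ τ, f τ ≤ g τ)
    (τ : Equiv.Perm (Fin n)) : prefixAvg k f τ ≤ prefixAvg k g τ := by
  unfold prefixAvg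
  gcongr
  exact h _

theorem prefixAvg_add (k : ℕ) (f g : Equiv.Perm (Fin n) → ENNReal) (τ : Equiv.Perm (Fin n)) :
    prefixAvg k (fun τ' => f τ' + g τ') τ = prefixAvg k f τ + prefixAvg k g τ := by
  unfold prefixAvg
  rw [Finset.sum_add_distrib, add_mul]

theorem prefixAvg_const_mul (k : ℕ) (c : ENNReal) (f : Equiv.Perm (Fin n) → ENNReal)
    (τ : Equiv.Perm (Fin n)) : prefixAvg k (fun τ' => c * f τ') τ = c * prefixAvg k f τ := by
  unfold prefixAvg
  rw [← Finset.mul_sum, mul_assoc]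

/-- Double counting: each diagonal term is spread evenly over its prefix class, and the class size
cancels. Working with unnormalized weights and class averages replaces conditioning on a label
prefix, which could have probability zero. -/
theorem sum_prefixAvg {k : ℕ} {F : Equiv.Perm (Fin n) → Equiv.Perm (Fin n) → ENNReal}
    (hF : ∀ τ τ', Agree k τ τ' → F τ = F τ') :
    ∑ τ, prefixAvg k (F τ) τ = ∑ τ, F τ τ := by
  classical
  unfold prefixAvg
  simp_rw [Finset.sum_mul]
  rw [Finset.sum_comm' (t' := Finset.univ) (s' := fun τ' => prefixClass k τ')]
  · refine Finset.sum_congr rfl fun τ' _ => ?_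
    have hc : ((prefixClass k τ').card : ENNReal) ≠ 0 := by
      simpa using Finset.ne_empty_of_mem (mem_prefixClass.2 (Agree.refl k τ'))
    calc ∑ τ ∈ prefixClass k τ', F τ τ' * ((prefixClass k τ).card : ENNReal)⁻¹
        = ∑ τ ∈ prefixClass k τ', F τ' τ' * ((prefixClass k τ').card : ENNReal)⁻¹ := by
          refine Finset.sum_congr rfl fun τ hτ => ?_
          rw [hF τ τ' (mem_prefixClass.1 hτ).symm, prefixClass_congr (mem_prefixClass.1 hτ).symm]
      _ = F τ' τ' := by
          rw [Finset.sum_const, nsmul_eq_mul, mul_left_comm,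
            ENNReal.mul_inv_cancel hc (ENNReal.natCast_ne_top _), mul_one]
  · intro τ τ'
    simp only [Finset.mem_univ, true_and, and_true, mem_prefixClass]
    exact ⟨Agree.symm, Agree.symm⟩

end Averaging

/-! ### Dynamic programming for best choice -/

section DynamicProgramming

variable {n : ℕ} (𝔻 : Distributions n)

/-- Weight of winning with an already accepted value `z` that is the maximum of the first `k`
values. -/
def winValue : Fin (n + 1) → Equiv.Perm (Fin n) → unitInterval → ENNReal :=
  Fin.reverseInduction (motive := fun _ => Equiv.Perm (Fin n) → unitInterval → ENNReal)
    (fun τ _ => 𝔻.order τ)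
    fun k w τ z => prefixAvg k.val
      (fun τ' => w τ' z * (𝔻.dist (τ' k) : Measure unitInterval) (Set.Iic z)) τ

open Classical in
/-- Payoff at step `k` of accepting or rejecting the value `z`, when the maximum so far is `M`. -/
def stepPayoff (w v : unitInterval → ENNReal) (M z : unitInterval) : ENNReal :=
  max (if M ≤ z then w z else 0) (v (max M z))

open Classical in
/-- Optimal weight of winning if none of the first `k` values has been accepted and their maximum
is `M`. -/
def contValue : Fin (n + 1) → Equiv.Perm (Fin n) → unitInterval → ENNReal :=
  Fin.reverseInduction (motive := fun _ => Equiv.Perm (Fin n) → unitInterval → ENNReal)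
    (fun τ M => if M = 0 then 𝔻.order τ else 0)
    fun k v τ M => prefixAvg k.val (fun τ' => ∫⁻ z, stepPayoff (winValue 𝔻 k.succ τ') (v τ') M z
      ∂(𝔻.dist (τ' k) : Measure unitInterval)) τ

theorem winValue_last (τ : Equiv.Perm (Fin n)) (z : unitInterval) :
    winValue 𝔻 (Fin.last n) τ z = 𝔻.order τ := by
  simp [winValue]

theorem winValue_castSucc (k : Fin n) (τ : Equiv.Perm (Fin n)) (z : unitInterval) :
    winValue 𝔻 k.castSucc τ z = prefixAvg k.val (fun τ' => winValue 𝔻 k.succ τ' z *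
      (𝔻.dist (τ' k) : Measure unitInterval) (Set.Iic z)) τ := by
  simp [winValue]

open Classical in
theorem contValue_last (τ : Equiv.Perm (Fin n)) (z : unitInterval) :
    contValue 𝔻 (Fin.last n) τ z = if z = 0 then 𝔻.order τ else 0 := by
  simp [contValue]

theorem contValue_castSucc (k : Fin n) (τ : Equiv.Perm (Fin n)) (M : unitInterval) :
    contValue 𝔻 k.castSucc τ M = prefixAvg k.val (fun τ' => ∫⁻ z,
      stepPayoff (winValue 𝔻 k.succ τ') (contValue 𝔻 k.succ τ') M z
      ∂(𝔻.dist (τ' k) : Measure unitInterval)) τ := by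
  simp [contValue]

/-- This is the information constraint: after `k` steps only the first `k` labels are known. The
same holds for `contValue`, so comparing the two values is a legitimate online decision. -/
theorem winValue_congr (k : Fin (n + 1)) {τ τ' : Equiv.Perm (Fin n)} (h : Agree k.val τ τ') :
    winValue 𝔻 k τ = winValue 𝔻 k τ' := by
  induction k using Fin.lastCases with
  | last => rw [Agree.eq h]
  | cast k =>
    funext z
    rw [winValue_castSucc, winValue_castSucc]
    exact prefixAvg_congr h _

theorem contValue_congr (k : Fin (n + 1)) {τ τ' : Equiv.Perm (Fin n)} (h : Agree k.val τ τ') :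
    contValue 𝔻 k τ = contValue 𝔻 k τ' := by
  induction k using Fin.lastCases with
  | last => rw [Agree.eq h]
  | cast k =>
    funext z
    rw [contValue_castSucc, contValue_castSucc]
    exact prefixAvg_congr h _

/-- Each remaining step contributes a factor `D(Iic z)`, which grows with `z`. -/
theorem winValue_mono (k : Fin (n + 1)) (τ : Equiv.Perm (Fin n)) : Monotone (winValue 𝔻 k τ) := by
  induction k using Fin.reverseInduction generalizing τ with
  | last => intro a b _; simp [winValue_last]
  | cast k ih =>
    intro a b hab
    rw [winValue_castSucc, winValue_castSucc]
    refine prefixAvg_mono (fun τ' => ?_) τ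
    exact mul_le_mul' (ih τ' hab) (measure_mono (Set.Iic_subset_Iic.2 hab))

theorem stepPayoff_antitone {w v : unitInterval → ENNReal} (hv : Antitone v) (z : unitInterval) :
    Antitone fun M => stepPayoff w v M z := by
  intro a b hab
  refine max_le_max ?_ (hv (max_le_max hab le_rfl))
  by_cases hb : b ≤ z
  · simp [hb, hab.trans hb]
  · simp [hb]

/-- A larger running maximum leaves fewer later values worth accepting, and the terminal reward
needs the maximum to be `0`. -/
theorem contValue_antitone (k : Fin (n + 1)) (τ : Equiv.Perm (Fin n)) :
    Antitone (contValue 𝔻 k τ) := by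
  induction k using Fin.reverseInduction generalizing τ with
  | last =>
    intro a b hab
    rw [contValue_last, contValue_last]
    by_cases hb : b = 0
    · have : a = 0 := le_antisymm (hab.trans_eq hb) bot_le
      simp [this, hb]
    · simp [hb]
  | cast k ih =>
    intro a b hab
    rw [contValue_castSucc, contValue_castSucc]
    exact prefixAvg_mono (fun τ' => lintegral_mono fun z => stepPayoff_antitone (ih τ') z hab) τ

/-! ### States of the stopping process and the potential -/

/-- The maximum of the first `k` arriving values. -/
def runMax (k : ℕ) (τ : Equiv.Perm (Fin n)) (y : Fin n → unitInterval) : unitInterval :=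
  (Finset.univ.filter fun i : Fin n => i.val < k).sup fun i => y (τ i)

theorem runMax_le_iff {k : ℕ} {τ : Equiv.Perm (Fin n)} {y : Fin n → unitInterval}
    {c : unitInterval} : runMax k τ y ≤ c ↔ ∀ i : Fin n, i.val < k → y (τ i) ≤ c := by
  simp [runMax]

theorem le_runMax {k : ℕ} {τ : Equiv.Perm (Fin n)} {y : Fin n → unitInterval} {i : Fin n}
    (hi : i.val < k) : y (τ i) ≤ runMax k τ y := runMax_le_iff.1 le_rfl i hi

theorem runMax_succ (k : Fin n) (τ : Equiv.Perm (Fin n)) (y : Fin n → unitInterval) :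
    runMax (k.val + 1) τ y = max (runMax k.val τ y) (y (τ k)) := by
  refine le_antisymm (runMax_le_iff.2 fun i hi => ?_) (max_le (runMax_le_iff.2 fun i hi => ?_) ?_)
  · rcases Nat.lt_succ_iff_lt_or_eq.1 hi with h | h
    · exact le_max_of_le_left (le_runMax h)
    · rw [Fin.ext h]; exact le_max_right _ _
  · exact le_runMax (hi.trans (Nat.lt_succ_self _))
  · exact le_runMax (Nat.lt_succ_self _)

theorem runMax_zero (τ : Equiv.Perm (Fin n)) (y : Fin n → unitInterval) : runMax 0 τ y = 0 :=
  le_antisymm (runMax_le_iff.2 fun _ hi => absurd hi (Nat.not_lt_zero _)) bot_le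

theorem runMax_full (τ : Equiv.Perm (Fin n)) (y : Fin n → unitInterval) :
    runMax n τ y = Finset.univ.sup fun i => y (τ i) := by
  simp [runMax]

theorem runMax_congr {k : ℕ} {τ τ' : Equiv.Perm (Fin n)} {y y' : Fin n → unitInterval}
    (h : ∀ i : Fin n, i.val < k → y (τ i) = y' (τ' i)) : runMax k τ y = runMax k τ' y' :=
  Finset.sup_congr rfl fun i hi => h i (Finset.mem_filter.1 hi).2

theorem measurable_runMax (k : ℕ) (τ : Equiv.Perm (Fin n)) : Measurable (runMax k τ) :=
  measurable_of_Iic fun c => by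
    have : runMax k τ ⁻¹' Set.Iic c = ⋂ i : Fin n, ⋂ (_ : i.val < k), {y | y (τ i) ≤ c} := by
      ext y; simp [runMax_le_iff]
    rw [this]
    exact MeasurableSet.iInter fun i => MeasurableSet.iInter fun _ =>
      measurableSet_le (measurable_pi_apply _) measurable_const

/-- None of the first `k` values is accepted. -/
def Waiting (a : OnlineAlg n) (k : ℕ) (τ : Equiv.Perm (Fin n)) (y : Fin n → unitInterval) : Prop :=
  ∀ i : Fin n, i.val < k → ¬ Accepts a (arrange (y, τ)) i

/-- One of the first `k` values is accepted, and it is their maximum. -/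
def Leading (a : OnlineAlg n) (k : ℕ) (τ : Equiv.Perm (Fin n)) (y : Fin n → unitInterval) : Prop :=
  ∃ i : Fin n, i.val < k ∧ Accepts a (arrange (y, τ)) i ∧ Waiting a i.val τ y ∧
    y (τ i) = runMax k τ y

/-- The algorithm is online: its decisions before step `k` ignore all later values and labels. -/
theorem accepts_congr (a : OnlineAlg n) {k : ℕ} {τ τ' : Equiv.Perm (Fin n)} (hτ : Agree k τ τ')
    {y y' : Fin n → unitInterval} (h : ∀ i : Fin n, i.val < k → y (τ i) = y' (τ' i)) {i : Fin n}
    (hi : i.val < k) : Accepts a (arrange (y, τ)) i ↔ Accepts a (arrange (y', τ')) i := by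
  have h1 : valuesUpTo (arrange (y, τ)).1 i = valuesUpTo (arrange (y', τ')).1 i := by
    funext j
    exact h _ (lt_of_le_of_lt (Nat.lt_succ_iff.1 j.isLt) hi)
  have h2 : labelsUpTo (arrange (y, τ)).2 i = labelsUpTo (arrange (y', τ')).2 i := by
    ext j
    exact congrArg Fin.val (hτ _ (lt_of_le_of_lt (Nat.lt_succ_iff.1 j.isLt) hi))
  unfold Accepts
  rw [h1, h2]

theorem waiting_congr (a : OnlineAlg n) {k : ℕ} {τ τ' : Equiv.Perm (Fin n)} (hτ : Agree k τ τ')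
    {y y' : Fin n → unitInterval} (h : ∀ i : Fin n, i.val < k → y (τ i) = y' (τ' i)) :
    Waiting a k τ y ↔ Waiting a k τ' y' :=
  forall₂_congr fun _ hi => not_congr (accepts_congr a hτ h hi)

theorem leading_congr (a : OnlineAlg n) {k : ℕ} {τ τ' : Equiv.Perm (Fin n)} (hτ : Agree k τ τ')
    {y y' : Fin n → unitInterval} (h : ∀ i : Fin n, i.val < k → y (τ i) = y' (τ' i)) :
    Leading a k τ y ↔ Leading a k τ' y' := by
  refine exists_congr fun i => and_congr_right fun hi => and_congr (accepts_congr a hτ h hi) ?_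
  rw [waiting_congr a (hτ.mono hi.le) fun j hj => h j (hj.trans hi), h i hi, runMax_congr h]

theorem waiting_succ (a : OnlineAlg n) (k : Fin n) (τ : Equiv.Perm (Fin n))
    (y : Fin n → unitInterval) :
    Waiting a (k.val + 1) τ y ↔ Waiting a k.val τ y ∧ ¬ Accepts a (arrange (y, τ)) k := by
  constructor
  · exact fun h => ⟨fun i hi => h i (hi.trans (Nat.lt_succ_self _)), h k (Nat.lt_succ_self _)⟩
  · rintro ⟨h1, h2⟩ i hi
    rcases Nat.lt_succ_iff_lt_or_eq.1 hi with h | h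
    · exact h1 i h
    · rwa [Fin.ext h]

theorem leading_succ (a : OnlineAlg n) (k : Fin n) (τ : Equiv.Perm (Fin n))
    (y : Fin n → unitInterval) :
    Leading a (k.val + 1) τ y ↔ (Leading a k.val τ y ∧ y (τ k) ≤ runMax k.val τ y) ∨
      (Waiting a k.val τ y ∧ Accepts a (arrange (y, τ)) k ∧ runMax k.val τ y ≤ y (τ k)) := by
  constructor
  · rintro ⟨i, hi, hacc, hw, hy⟩
    rw [runMax_succ] at hy
    rcases Nat.lt_succ_iff_lt_or_eq.1 hi with h | h
    · have h1 : y (τ k) ≤ runMax k.val τ y :=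
        (le_max_right _ _).trans (hy.symm.le.trans (le_runMax h))
      rw [max_eq_left h1] at hy
      exact Or.inl ⟨⟨i, h, hacc, hw, hy⟩, h1⟩
    · obtain rfl : i = k := Fin.ext h
      exact Or.inr ⟨hw, hacc, by rw [hy]; exact le_max_left _ _⟩
  · rintro (⟨⟨i, hi, hacc, hw, hy⟩, h1⟩ | ⟨hw, hacc, h1⟩)
    · exact ⟨i, hi.trans (Nat.lt_succ_self _), hacc, hw, by rw [runMax_succ, max_eq_left h1, hy]⟩
    · exact ⟨k, Nat.lt_succ_self _, hacc, hw, by rw [runMax_succ, max_eq_right h1]⟩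

theorem not_leading_of_waiting {a : OnlineAlg n} {k : ℕ} {τ : Equiv.Perm (Fin n)}
    {y : Fin n → unitInterval} (h : Waiting a k τ y) : ¬ Leading a k τ y :=
  fun ⟨i, hi, hacc, _⟩ => h i hi hacc

theorem measurableSet_accepts (a : OnlineAlg n) (τ : Equiv.Perm (Fin n)) (i : Fin n) :
    MeasurableSet {y | Accepts a (arrange (y, τ)) i} := by
  have h := (measurableFamily_const (X := Unit) a).measurableSet_accepts i
  have hm : Measurable fun y : Fin n → unitInterval => ((), arrange (y, τ)) :=
    measurable_const.prodMk (measurable_arrange.comp measurable_prodMk_right)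
  exact hm h

theorem measurableSet_waiting (a : OnlineAlg n) (k : ℕ) (τ : Equiv.Perm (Fin n)) :
    MeasurableSet {y | Waiting a k τ y} := by
  have : {y | Waiting a k τ y} =
      ⋂ i : Fin n, ⋂ (_ : i.val < k), {y | Accepts a (arrange (y, τ)) i}ᶜ := by
    ext y; simp [Waiting]
  rw [this]
  exact MeasurableSet.iInter fun i => MeasurableSet.iInter fun _ =>
    (measurableSet_accepts a τ i).compl

theorem measurableSet_leading (a : OnlineAlg n) (k : ℕ) (τ : Equiv.Perm (Fin n)) :
    MeasurableSet {y | Leading a k τ y} := by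
  have : {y | Leading a k τ y} = ⋃ i : Fin n, ⋃ (_ : i.val < k),
      ({y | Accepts a (arrange (y, τ)) i} ∩ ({y | Waiting a i.val τ y} ∩
        {y | y (τ i) = runMax k τ y})) := by
    ext y
    simp only [Leading, Set.mem_ofPred_eq, Set.mem_iUnion, Set.mem_inter_iff, exists_prop]
  rw [this]
  exact MeasurableSet.iUnion fun i => MeasurableSet.iUnion fun _ =>
    (measurableSet_accepts a τ i).inter ((measurableSet_waiting a _ τ).inter
      (measurableSet_eq_fun (measurable_pi_apply _) (measurable_runMax k τ)))

open Classical in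
/-- The integrand of the potential: value of the state reached after `k` values. -/
def stateValue (a : OnlineAlg n) (k : Fin (n + 1)) (τ : Equiv.Perm (Fin n))
    (y : Fin n → unitInterval) : ENNReal :=
  (if Leading a k.val τ y then 1 else 0) * winValue 𝔻 k τ (runMax k.val τ y) +
    (if Waiting a k.val τ y then 1 else 0) * contValue 𝔻 k τ (runMax k.val τ y)

open Classical in
/-- The value of the state after `k` values if the next one is handled optimally. -/
def lookahead (a : OnlineAlg n) (k : Fin n) (τ : Equiv.Perm (Fin n))
    (y : Fin n → unitInterval) : ENNReal :=
  (if Leading a k.val τ y then 1 else 0) * (winValue 𝔻 k.succ τ (runMax k.val τ y) *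
      (Set.Iic (runMax k.val τ y)).indicator 1 (y (τ k))) +
    (if Waiting a k.val τ y then 1 else 0) *
      stepPayoff (winValue 𝔻 k.succ τ) (contValue 𝔻 k.succ τ) (runMax k.val τ y) (y (τ k))

theorem measurable_winValue (k : Fin (n + 1)) (τ : Equiv.Perm (Fin n)) :
    Measurable (winValue 𝔻 k τ) := (winValue_mono 𝔻 k τ).measurable

theorem measurable_contValue (k : Fin (n + 1)) (τ : Equiv.Perm (Fin n)) :
    Measurable (contValue 𝔻 k τ) := (contValue_antitone 𝔻 k τ).measurable

theorem measurable_stateValue (a : OnlineAlg n) (k : Fin (n + 1)) (τ : Equiv.Perm (Fin n)) :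
    Measurable (stateValue 𝔻 a k τ) := by
  unfold stateValue
  exact ((Measurable.ite (measurableSet_leading a _ τ) measurable_const measurable_const).mul
    ((measurable_winValue 𝔻 k τ).comp (measurable_runMax _ τ))).add
    ((Measurable.ite (measurableSet_waiting a _ τ) measurable_const measurable_const).mul
    ((measurable_contValue 𝔻 k τ).comp (measurable_runMax _ τ)))

theorem measurable_lookahead (a : OnlineAlg n) (k : Fin n) (τ : Equiv.Perm (Fin n)) :
    Measurable (lookahead 𝔻 a k τ) := by
  classical
  have hM := measurable_runMax (n := n) k.val τ
  have hy : Measurable fun y : Fin n → unitInterval => y (τ k) := measurable_pi_apply _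
  unfold lookahead stepPayoff
  refine ((Measurable.ite (measurableSet_leading a _ τ) measurable_const measurable_const).mul
    (((measurable_winValue 𝔻 _ τ).comp hM).mul ?_)).add
    ((Measurable.ite (measurableSet_waiting a _ τ) measurable_const measurable_const).mul
    (Measurable.max (Measurable.ite (measurableSet_le hM hy)
      ((measurable_winValue 𝔻 _ τ).comp hy) measurable_const)
      ((measurable_contValue 𝔻 _ τ).comp (hM.max hy))))
  simp only [Set.indicator_apply, Set.mem_Iic]
  exact Measurable.ite (measurableSet_le hy hM) measurable_const measurable_const

/-- The potential: total value of the states reached after `k` values. -/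
def potential (a : OnlineAlg n) (k : Fin (n + 1)) : ENNReal :=
  ∑ τ, ∫⁻ y, stateValue 𝔻 a k τ y ∂𝔻.values

/-- One step of the Bellman recursion at the level of totals. The prefix average in `winValue` and
`contValue` disappears after summing over all permutations, and the integral over the next value is
absorbed into the integral over all values. -/
theorem potential_castSucc (a : OnlineAlg n) (k : Fin n) :
    potential 𝔻 a k.castSucc = ∑ τ, ∫⁻ y, lookahead 𝔻 a k τ y ∂𝔻.values := by
  classical
  -- The first permutation matters only through its prefix of length `k`; the second one supplies
  -- the label of the next value and the future.
  set Fn : (Fin n → unitInterval) → Equiv.Perm (Fin n) → Equiv.Perm (Fin n) → ENNReal :=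
    fun y τ τ' => (if Leading a k.val τ y then 1 else 0) *
        (winValue 𝔻 k.succ τ' (runMax k.val τ y) *
          (𝔻.dist (τ' k) : Measure unitInterval) (Set.Iic (runMax k.val τ y))) +
      (if Waiting a k.val τ y then 1 else 0) *
        ∫⁻ z, stepPayoff (winValue 𝔻 k.succ τ') (contValue 𝔻 k.succ τ') (runMax k.val τ y) z
          ∂(𝔻.dist (τ' k) : Measure unitInterval) with hFn
  have h1 : ∀ y τ, stateValue 𝔻 a k.castSucc τ y = prefixAvg k.val (Fn y τ) τ := by
    intro y τ
    simp only [hFn, stateValue, prefixAvg_add, prefixAvg_const_mul, winValue_castSucc,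
      contValue_castSucc, Fin.val_castSucc]
  have h2 : ∀ y τ τ', Agree k.val τ τ' → Fn y τ = Fn y τ' := by
    intro y τ τ' h
    have hy : ∀ i : Fin n, i.val < k.val → y (τ i) = y (τ' i) := fun i hi => by rw [h i hi]
    simp only [hFn, leading_congr a h hy, waiting_congr a h hy, runMax_congr hy]
  -- As `τ` is injective, changing the value labelled `τ k` does not touch the first `k` arrivals,
  -- so the state is unaffected and only the payoff of the next step sees `z`.
  have h3 : ∀ τ y, Fn y τ τ = ∫⁻ z, lookahead 𝔻 a k τ (Function.update y (τ k) z)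
      ∂(𝔻.dist (τ k) : Measure unitInterval) := by
    intro τ y
    have hy : ∀ z, ∀ i : Fin n, i.val < k.val → Function.update y (τ k) z (τ i) = y (τ i) := by
      intro z i hi
      refine Function.update_of_ne (fun h => ?_) _ _
      rw [τ.injective h] at hi
      exact lt_irrefl _ hi
    simp only [lookahead, leading_congr a (Agree.refl _ τ) (hy _),
      waiting_congr a (Agree.refl _ τ) (hy _), runMax_congr (hy _), Function.update_self]
    have hI : Measurable fun z : unitInterval =>
        (Set.Iic (runMax k.val τ y)).indicator (1 : unitInterval → ENNReal) z :=
      measurable_one.indicator measurableSet_Iic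
    have hS : Measurable fun z => stepPayoff (winValue 𝔻 k.succ τ) (contValue 𝔻 k.succ τ)
        (runMax k.val τ y) z :=
      Measurable.max (Measurable.ite measurableSet_Ici (measurable_winValue 𝔻 _ τ)
        measurable_const) ((measurable_contValue 𝔻 _ τ).comp (measurable_const.max measurable_id))
    have hI' : Measurable fun z : unitInterval => winValue 𝔻 k.succ τ (runMax k.val τ y) *
        (Set.Iic (runMax k.val τ y)).indicator (1 : unitInterval → ENNReal) z :=
      measurable_const.mul hI
    rw [lintegral_add_left (hI'.const_mul _),
      lintegral_const_mul _ hI', lintegral_const_mul _ hI,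
      lintegral_const_mul _ hS, lintegral_indicator_one measurableSet_Iic]
  unfold potential
  rw [← lintegral_finsetSum _ fun τ _ => measurable_stateValue 𝔻 a _ τ]
  simp_rw [h1, fun y => sum_prefixAvg (h2 y), h3]
  rw [lintegral_finsetSum]
  · refine Finset.sum_congr rfl fun τ _ => ?_
    exact lintegral_update (fun i => (𝔻.dist i : Measure unitInterval))
      (measurable_lookahead 𝔻 a k τ) (τ k)
  · intro τ _
    exact Measurable.lintegral_prod_right'
      (f := fun q : (Fin n → unitInterval) × unitInterval =>
        lookahead 𝔻 a k τ (Function.update q.1 (τ k) q.2))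
      ((measurable_lookahead 𝔻 a k τ).comp (measurable_update' (a := τ k)))

/-- Any decision realizes one of the two options whose maximum is `stepPayoff`, and a past
acceptance survives only if the next value is not larger. -/
theorem stateValue_succ_le (a : OnlineAlg n) (k : Fin n) (τ : Equiv.Perm (Fin n))
    (y : Fin n → unitInterval) : stateValue 𝔻 a k.succ τ y ≤ lookahead 𝔻 a k τ y := by
  classical
  simp only [stateValue, lookahead, Fin.val_succ, leading_succ, waiting_succ, runMax_succ,
    stepPayoff, Set.indicator_apply, Set.mem_Iic, Pi.one_apply]
  by_cases hW : Waiting a k.val τ y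
  · have hL := not_leading_of_waiting hW
    by_cases hA : Accepts a (arrange (y, τ)) k
    · by_cases hM : runMax k.val τ y ≤ y (τ k) <;> simp [hW, hL, hA, hM]
    · simp [hW, hL, hA]
  · by_cases hL : Leading a k.val τ y
    · by_cases hM : y (τ k) ≤ runMax k.val τ y <;> simp [hW, hL, hM]
    · simp [hW, hL]

/-- If the new value is below the running maximum, accepting is worthless. Otherwise the new running
maximum is the value itself, so the better option is decided by comparing `contValue` and `winValue`
at that single point. -/
theorem lookahead_eq_of_optimal {a : OnlineAlg n} {k : Fin n} {τ : Equiv.Perm (Fin n)}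
    {y : Fin n → unitInterval} (h : Accepts a (arrange (y, τ)) k ↔
      runMax k.val τ y ≤ y (τ k) ∧ contValue 𝔻 k.succ τ (y (τ k)) ≤ winValue 𝔻 k.succ τ (y (τ k))) :
    stateValue 𝔻 a k.succ τ y = lookahead 𝔻 a k τ y := by
  classical
  simp only [stateValue, lookahead, Fin.val_succ, leading_succ, waiting_succ, runMax_succ,
    stepPayoff, Set.indicator_apply, Set.mem_Iic, Pi.one_apply]
  by_cases hW : Waiting a k.val τ y
  · have hL := not_leading_of_waiting hW
    by_cases hM : runMax k.val τ y ≤ y (τ k)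
    · by_cases hV : contValue 𝔻 k.succ τ (y (τ k)) ≤ winValue 𝔻 k.succ τ (y (τ k))
      · simp [hW, hL, hM, h, hV]
      · simp [hW, hL, hM, h, hV, (not_le.1 hV).le]
    · simp [hW, hL, h, hM]
  · by_cases hL : Leading a k.val τ y
    · by_cases hM : y (τ k) ≤ runMax k.val τ y <;> simp [hW, hL, hM]
    · simp [hW, hL]

theorem potential_succ_le (a : OnlineAlg n) (k : Fin n) :
    potential 𝔻 a k.succ ≤ potential 𝔻 a k.castSucc := by
  rw [potential_castSucc]
  exact Finset.sum_le_sum fun τ _ => lintegral_mono fun y => stateValue_succ_le 𝔻 a k τ y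

theorem potential_last_le (a : OnlineAlg n) : potential 𝔻 a (Fin.last n) ≤ potential 𝔻 a 0 := by
  have : ∀ k : Fin (n + 1), potential 𝔻 a k ≤ potential 𝔻 a 0 := fun k => by
    induction k using Fin.induction with
    | zero => exact le_rfl
    | succ k ih => exact (potential_succ_le 𝔻 a k).trans ih
  exact this _

/-- Before the first arrival nothing has been accepted and the running maximum is `0`, so the
algorithm has had no influence yet. -/
theorem potential_zero_eq (a b : OnlineAlg n) : potential 𝔻 a 0 = potential 𝔻 b 0 := by
  have h : ∀ a : OnlineAlg n, ∀ τ y, stateValue 𝔻 a 0 τ y = contValue 𝔻 0 τ 0 := by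
    intro a τ y
    have hW : Waiting a 0 τ y := fun i hi => absurd hi (Nat.not_lt_zero _)
    simp [stateValue, hW, not_leading_of_waiting hW, runMax_zero]
  simp only [potential, h]

/-- Links the end of the recursion to the profit. Rejecting everything wins exactly when the maximum
is `0`, because `x_{n+1} = 0`; this is the terminal condition of `contValue`. -/
theorem ofReal_profit_arrange (a : OnlineAlg n) (τ : Equiv.Perm (Fin n))
    (y : Fin n → unitInterval) :
    𝔻.order τ * ENNReal.ofReal (profit (bestChoice n) a (arrange (y, τ))) =
      stateValue 𝔻 a (Fin.last n) τ y := by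
  classical
  have hsup : Finset.univ.sup (arrange (y, τ)).1 = runMax n τ y := (runMax_full τ y).symm
  simp only [stateValue, Fin.val_last, winValue_last, contValue_last]
  by_cases hW : Waiting a n τ y
  · have hs : stopIndex a (arrange (y, τ)) = Fin.last n :=
      stopIndex_eq_last.2 fun j => hW j j.isLt
    simp only [profit, hs, bestChoice_last, hsup, hW, not_leading_of_waiting hW]
    by_cases h0 : runMax n τ y = 0
    · simp [h0]
    · simp [h0, Ne.symm h0]
  · obtain ⟨i, hi⟩ : ∃ i : Fin n, stopIndex a (arrange (y, τ)) = i.castSucc := by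
      rcases Fin.eq_castSucc_or_eq_last (stopIndex a (arrange (y, τ))) with ⟨i, h⟩ | h
      · exact ⟨i, h⟩
      · exact absurd (fun i _ => stopIndex_eq_last.1 h i) hW
    have hi' := stopIndex_eq_castSucc.1 hi
    have hL : Leading a n τ y ↔ y (τ i) = runMax n τ y := by
      constructor
      · rintro ⟨j, -, hacc, hw, hj⟩
        have hij : i = j := by
          rcases lt_trichotomy i j with h | h | h
          · exact absurd hi'.1 (hw i h)
          · exact h
          · exact absurd hacc (hi'.2 j h)
        rw [hij, hj]
      · exact fun h => ⟨i, i.isLt, hi'.1, fun j hj => hi'.2 j hj, h⟩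
    simp only [profit, hi, bestChoice_castSucc, hsup, hW, hL]
    by_cases h0 : y (τ i) = runMax n τ y
    · have h0' : (arrange (y, τ)).1 i = runMax n τ y := h0
      simp [h0, h0']
    · have h0' : ¬ (arrange (y, τ)).1 i = runMax n τ y := h0
      simp [h0, h0']

theorem lintegral_law {f : Outcome n → ENNReal} (hf : Measurable f) :
    ∫⁻ ω, f ω ∂𝔻.law = ∑ τ, 𝔻.order τ * ∫⁻ y, f (arrange (y, τ)) ∂𝔻.values := by
  have hm : Measurable fun q => f (arrange q) := hf.comp measurable_arrange
  rw [Distributions.law_eq, lintegral_map hf measurable_arrange,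
    lintegral_prod_symm' _ hm, lintegral_fintype]
  refine Finset.sum_congr rfl fun τ _ => ?_
  rw [PMF.toMeasure_apply_singleton _ _ (measurableSet_singleton _), mul_comm]

theorem ofReal_integral_profit (a : OnlineAlg n) :
    ENNReal.ofReal (∫ ω, profit (bestChoice n) a ω ∂𝔻.law) = potential 𝔻 a (Fin.last n) := by
  rw [ofReal_integral_eq_lintegral_ofReal
    (integrable_of_mem_Icc (measurable_profit a) (profit_mem a))
    (Filter.Eventually.of_forall fun ω => (profit_mem a ω).1),
    lintegral_law 𝔻 (measurable_profit a).ennreal_ofReal]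
  refine Finset.sum_congr rfl fun τ _ => ?_
  have hm : Measurable fun y => ENNReal.ofReal (profit (bestChoice n) a (arrange (y, τ))) :=
    (measurable_profit a).ennreal_ofReal.comp (measurable_arrange.comp measurable_prodMk_right)
  rw [← lintegral_const_mul _ hm]
  exact lintegral_congr fun y => ofReal_profit_arrange 𝔻 a τ y

/-! ### The optimal algorithm is essentially a threshold algorithm -/

/-- An up-set of `[0,1]` is empty (threshold `∞`), contains its infimum (comparison `≥`) or does not
(comparison `>`). This is why thresholds come with a choice of comparison. -/
theorem exists_passes_iff_of_isUpperSet {U : Set unitInterval} (hU : IsUpperSet U) :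
    ∃ (θ : WithTop unitInterval) (strict : Bool), ∀ v, v ∈ U ↔ Passes strict θ v := by
  rcases U.eq_empty_or_nonempty with rfl | hne
  · exact ⟨⊤, false, fun v => by simp [Passes]⟩
  · by_cases h : sInf U ∈ U
    · refine ⟨(sInf U : unitInterval), false, fun v => ?_⟩
      simp only [Passes, Bool.false_eq_true, if_false, WithTop.coe_le_coe]
      exact ⟨fun hv => sInf_le hv, fun hv => hU hv h⟩
    · refine ⟨(sInf U : unitInterval), true, fun v => ?_⟩
      simp only [Passes, if_true, WithTop.coe_lt_coe]
      refine ⟨fun hv => lt_of_le_of_ne (sInf_le hv) fun he => h (he ▸ hv), fun hv => ?_⟩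
      obtain ⟨u, hu, huv⟩ := sInf_lt_iff.1 hv
      exact hU huv.le hu

open Classical in
/-- A permutation with the given initial labels. -/
def extendLabels (i : Fin n) (σ : Fin (i.val + 1) ↪ Fin n) : Equiv.Perm (Fin n) :=
  if h : ∃ τ : Equiv.Perm (Fin n), labelsUpTo τ i = σ then h.choose else Equiv.refl _

theorem agree_of_labelsUpTo_eq {i : Fin n} {τ τ' : Equiv.Perm (Fin n)}
    (h : labelsUpTo τ i = labelsUpTo τ' i) : Agree (i.val + 1) τ τ' := fun j hj =>
  DFunLike.congr_fun h (⟨j.val, hj⟩ : Fin (i.val + 1))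

theorem agree_extendLabels (i : Fin n) (τ : Equiv.Perm (Fin n)) :
    Agree (i.val + 1) (extendLabels i (labelsUpTo τ i)) τ := by
  have h : ∃ τ' : Equiv.Perm (Fin n), labelsUpTo τ' i = labelsUpTo τ i := ⟨τ, rfl⟩
  refine agree_of_labelsUpTo_eq ?_
  rw [extendLabels, dif_pos h]
  exact h.choose_spec

open Classical in
/-- Accept a maximal value if winning with it is at least as likely as winning later. -/
def optimalAlg : OnlineAlg n where
  accept i x σ := decide ((∀ j, x j ≤ x (Fin.last i.val)) ∧
    contValue 𝔻 i.succ (extendLabels i σ) (x (Fin.last i.val)) ≤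
      winValue 𝔻 i.succ (extendLabels i σ) (x (Fin.last i.val)))
  measurable_accept i σ := by
    refine measurable_to_bool ?_
    have hx : ∀ j, Measurable fun x : Fin (i.val + 1) → unitInterval => x j :=
      fun j => measurable_pi_apply j
    have : (fun x : Fin (i.val + 1) → unitInterval => decide ((∀ j, x j ≤ x (Fin.last i.val)) ∧
        contValue 𝔻 i.succ (extendLabels i σ) (x (Fin.last i.val)) ≤
        winValue 𝔻 i.succ (extendLabels i σ) (x (Fin.last i.val)))) ⁻¹' {true} =
        (⋂ j, {x | x j ≤ x (Fin.last i.val)}) ∩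
        {x | contValue 𝔻 i.succ (extendLabels i σ) (x (Fin.last i.val)) ≤
          winValue 𝔻 i.succ (extendLabels i σ) (x (Fin.last i.val))} := by
      ext x; simp
    rw [this]
    exact (MeasurableSet.iInter fun j => measurableSet_le (hx j) (hx _)).inter
      (measurableSet_le ((measurable_contValue 𝔻 _ _).comp (hx _))
        ((measurable_winValue 𝔻 _ _).comp (hx _)))

/-- A decreasing function lies below an increasing one on an up-set. -/
theorem isEssThreshold_optimalAlg : IsEssThreshold (optimalAlg 𝔻) := by
  have hU : ∀ (i : Fin n) (σ : Fin (i.val + 1) ↪ Fin n), IsUpperSet {v |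
      contValue 𝔻 i.succ (extendLabels i σ) v ≤ winValue 𝔻 i.succ (extendLabels i σ) v} :=
    fun i σ a b hab ha =>
      (contValue_antitone 𝔻 _ _ hab).trans (le_trans ha (winValue_mono 𝔻 _ _ hab))
  choose θ strict h using fun i σ => exists_passes_iff_of_isUpperSet (hU i σ)
  refine ⟨θ, strict, fun i x σ => ?_⟩
  simp only [optimalAlg, decide_eq_true_eq]
  exact and_congr_right fun _ => h i σ _

theorem accepts_optimalAlg (k : Fin n) (τ : Equiv.Perm (Fin n)) (y : Fin n → unitInterval) :
    Accepts (optimalAlg 𝔻) (arrange (y, τ)) k ↔ runMax k.val τ y ≤ y (τ k) ∧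
      contValue 𝔻 k.succ τ (y (τ k)) ≤ winValue 𝔻 k.succ τ (y (τ k)) := by
  have hag : Agree k.succ.val (extendLabels k (labelsUpTo τ k)) τ := agree_extendLabels k τ
  have hl : valuesUpTo (arrange (y, τ)).1 k (Fin.last k.val) = y (τ k) := rfl
  simp only [Accepts, optimalAlg, decide_eq_true_eq]
  change (∀ j, valuesUpTo (arrange (y, τ)).1 k j ≤ y (τ k)) ∧
    contValue 𝔻 k.succ (extendLabels k (labelsUpTo τ k)) (y (τ k)) ≤
    winValue 𝔻 k.succ (extendLabels k (labelsUpTo τ k)) (y (τ k)) ↔ _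
  rw [contValue_congr 𝔻 _ hag, winValue_congr 𝔻 _ hag, runMax_le_iff]
  refine and_congr_left fun _ => ⟨fun h i hi => ?_, fun h j => ?_⟩
  · exact h ⟨i.val, hi.trans (Nat.lt_succ_self _)⟩
  · rcases Nat.lt_succ_iff_lt_or_eq.1 j.isLt with hj | hj
    · exact h ⟨j.val, hj.trans k.isLt⟩ hj
    · obtain rfl : j = Fin.last k.val := Fin.ext hj
      exact le_rfl

/-- All algorithms start with the same potential and end with their expected profit. The potential
never increases, and for `optimalAlg` it stays constant. -/
theorem integral_profit_le_optimalAlg (a : OnlineAlg n) :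
    ∫ ω, profit (bestChoice n) a ω ∂𝔻.law ≤
      ∫ ω, profit (bestChoice n) (optimalAlg 𝔻) ω ∂𝔻.law := by
  have hopt : ∀ k, potential 𝔻 (optimalAlg 𝔻) k = potential 𝔻 (optimalAlg 𝔻) 0 := fun k => by
    induction k using Fin.induction with
    | zero => rfl
    | succ k ih =>
      rw [← ih, potential_castSucc]
      exact Finset.sum_congr rfl fun τ _ => lintegral_congr fun y =>
        lookahead_eq_of_optimal 𝔻 (accepts_optimalAlg 𝔻 k τ y)
  rw [← ENNReal.ofReal_le_ofReal_iff (integral_profit_mem 𝔻 _).1, ofReal_integral_profit,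
    ofReal_integral_profit, hopt, potential_zero_eq 𝔻 (optimalAlg 𝔻) a]
  exact potential_last_le 𝔻 a

theorem optOnline_le :
    optOnline (bestChoice n) 𝔻 ≤ ∫ ω, profit (bestChoice n) (optimalAlg 𝔻) ω ∂𝔻.law :=
  haveI : Nonempty (OnlineAlg n) := ⟨optimalAlg 𝔻⟩
  ciSup_le fun a => integral_profit_le_optimalAlg 𝔻 a

end DynamicProgramming

end

end OptStop

namespace OptStop

noncomputable section

open MeasureTheory

/-! ### Threshold algorithms with thresholds taken from a sample -/

section Sample

variable {n : ℕ}

/-- The pairs of a step and the labels seen up to this step. -/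
abbrev LabelPrefix (n : ℕ) : Type := Σ i : Fin n, (Fin (i.val + 1) ↪ Fin n)

open Classical in
/-- Accept a maximal value that is at least the threshold. -/
def thresholdAlg (θ : LabelPrefix n → WithTop unitInterval) : OnlineAlg n where
  accept i x σ := decide ((∀ j, x j ≤ x (Fin.last i.val)) ∧
    θ ⟨i, σ⟩ ≤ (x (Fin.last i.val) : WithTop unitInterval))
  measurable_accept i σ := by
    refine measurable_to_bool ?_
    have hx : ∀ j, Measurable fun x : Fin (i.val + 1) → unitInterval => x j :=
      fun j => measurable_pi_apply j
    have : (fun x : Fin (i.val + 1) → unitInterval => decide ((∀ j, x j ≤ x (Fin.last i.val)) ∧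
        θ ⟨i, σ⟩ ≤ (x (Fin.last i.val) : WithTop unitInterval))) ⁻¹' {true} =
        (⋂ j, {x | x j ≤ x (Fin.last i.val)}) ∩
        (fun x => x (Fin.last i.val)) ⁻¹'
          {v : unitInterval | θ ⟨i, σ⟩ ≤ (v : WithTop unitInterval)} := by
      ext x; simp
    rw [this]
    refine (MeasurableSet.iInter fun j => measurableSet_le (hx j) (hx _)).inter (hx _ ?_)
    cases θ ⟨i, σ⟩ with
    | top => simp
    | coe c =>
      simp only [WithTop.coe_le_coe]
      exact measurableSet_Ici

theorem accept_thresholdAlg (θ : LabelPrefix n → WithTop unitInterval) (i : Fin n)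
    (x : Fin (i.val + 1) → unitInterval) (σ : Fin (i.val + 1) ↪ Fin n) :
    (thresholdAlg θ).accept i x σ = true ↔ (∀ j, x j ≤ x (Fin.last i.val)) ∧
      θ ⟨i, σ⟩ ≤ (x (Fin.last i.val) : WithTop unitInterval) := by
  simp [thresholdAlg]

theorem isEssThreshold_thresholdAlg (θ : LabelPrefix n → WithTop unitInterval) :
    IsEssThreshold (thresholdAlg θ) := by
  refine ⟨fun i σ => θ ⟨i, σ⟩, fun _ _ => false, fun i x σ => ?_⟩
  rw [accept_thresholdAlg]
  simp [Passes]

variable {J : Type*} {K : Finset (LabelPrefix n)}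

open Classical in
/-- Thresholds read off from the sample `s` at positions given by `c`. -/
def sampleThreshold (s : J → Outcome n) (c : K → Option J) (p : LabelPrefix n) :
    WithTop unitInterval :=
  if h : p ∈ K then (c ⟨p, h⟩).elim ⊤ fun j => ((s j).1 p.1 : WithTop unitInterval) else ⊤

theorem measurableFamily_sampleThreshold (c : K → Option J) :
    MeasurableFamily fun s : J → Outcome n => thresholdAlg (sampleThreshold s c) := by
  intro i σ
  refine measurable_to_bool ?_
  have hx : ∀ j, Measurable fun q : (J → Outcome n) × (Fin (i.val + 1) → unitInterval) => q.2 j :=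
    fun j => (measurable_pi_apply j).comp measurable_snd
  have : (fun q : (J → Outcome n) × (Fin (i.val + 1) → unitInterval) =>
      (thresholdAlg (sampleThreshold q.1 c)).accept i q.2 σ) ⁻¹' {true} =
      (⋂ j, {q | q.2 j ≤ q.2 (Fin.last i.val)}) ∩ {q | sampleThreshold q.1 c ⟨i, σ⟩ ≤
        (q.2 (Fin.last i.val) : WithTop unitInterval)} := by
    ext q
    simp only [Set.mem_preimage, Set.mem_singleton_iff, accept_thresholdAlg, Set.mem_inter_iff,
      Set.mem_iInter, Set.mem_ofPred_eq]
  rw [this]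
  refine (MeasurableSet.iInter fun j => measurableSet_le (hx j) (hx _)).inter ?_
  unfold sampleThreshold
  by_cases h : (⟨i, σ⟩ : LabelPrefix n) ∈ K
  · simp only [h, dif_pos]
    cases c ⟨⟨i, σ⟩, h⟩ with
    | none => simp
    | some j =>
      simp only [Option.elim_some, WithTop.coe_le_coe]
      have : Measurable fun q : (J → Outcome n) × (Fin (i.val + 1) → unitInterval) =>
          (q.1 j).1 i :=
        (measurable_pi_apply i).comp (measurable_fst.comp ((measurable_pi_apply j).comp
          measurable_fst))
      exact measurableSet_le this (hx _)
  · simp [h]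

theorem Passes.mono {strict : Bool} {θ : WithTop unitInterval} {u v : unitInterval} (huv : u ≤ v)
    (h : Passes strict θ u) : Passes strict θ v := by
  have huv' : (u : WithTop unitInterval) ≤ v := WithTop.coe_le_coe.2 huv
  unfold Passes at *
  split_ifs at * with hs
  · exact h.trans_le huv'
  · exact h.trans huv'

/-- On a finite sample, every essentially threshold algorithm behaves like one with thresholds from
the sample. -/
theorem exists_sampleThreshold [Finite J] (s : J → Outcome n) {a : OnlineAlg n}
    (ha : IsEssThreshold a) : ∃ c : K → Option J, ∀ j,
      (∀ i, (⟨i, labelsUpTo (s j).2 i⟩ : LabelPrefix n) ∈ K) →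
      profit (bestChoice n) (thresholdAlg (sampleThreshold s c)) (s j) =
        profit (bestChoice n) a (s j) := by
  obtain ⟨θ, strict, h⟩ := ha
  -- A threshold matters only through the sample values that pass it. The least such value, used
  -- with `≥`, selects the same ones; if none passes, the threshold is `∞`.
  have hex : ∀ p : LabelPrefix n, ∃ o : Option J, ∀ j,
      o.elim ⊤ (fun j => ((s j).1 p.1 : WithTop unitInterval)) ≤
        ((s j).1 p.1 : WithTop unitInterval) ↔ Passes (strict p.1 p.2) (θ p.1 p.2) ((s j).1 p.1) := by
    intro p
    rcases Set.eq_empty_or_nonempty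
      {j | Passes (strict p.1 p.2) (θ p.1 p.2) ((s j).1 p.1)} with he | hne
    · refine ⟨none, fun j => ?_⟩
      have : ¬ Passes (strict p.1 p.2) (θ p.1 p.2) ((s j).1 p.1) := fun hj =>
        (he ▸ (show j ∈ {j | Passes (strict p.1 p.2) (θ p.1 p.2) ((s j).1 p.1)} from hj) :
          j ∈ (∅ : Set J))
      simp [this]
    · obtain ⟨j₀, hj₀, hmin⟩ := Set.exists_min_image _ (fun j => (s j).1 p.1)
        (Set.toFinite _) hne
      refine ⟨some j₀, fun j => ?_⟩
      simp only [Option.elim_some, WithTop.coe_le_coe]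
      exact ⟨fun hj => Passes.mono hj hj₀, fun hj => hmin j hj⟩
  choose o ho using hex
  refine ⟨fun p => o p.1, fun j hj => ?_⟩
  have : stopIndex (thresholdAlg (sampleThreshold s fun p : K => o p.1)) (s j) =
      stopIndex a (s j) := by
    refine stopIndex_congr fun i => ?_
    unfold Accepts
    rw [accept_thresholdAlg, h]
    refine and_congr_right fun _ => ?_
    have := ho ⟨i, labelsUpTo (s j).2 i⟩ j
    rw [sampleThreshold, dif_pos (hj i)]
    exact this
  unfold profit
  rw [this]

end Sample

/-! ### Existence of measurable empirical optimizers -/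

/-- Induction on the index set, comparing the current winner with one new candidate at a time. -/
theorem exists_measurable_argmax {X ι : Type*} [MeasurableSpace X] [Fintype ι] [Nonempty ι]
    {f : ι → X → ℝ} (hf : ∀ i, Measurable (f i)) :
    ∃ g : X → ι, (∀ x i, f i x ≤ f (g x) x) ∧ ∀ i, MeasurableSet {x | g x = i} := by
  classical
  let _ : MeasurableSpace ι := ⊤
  have key : ∀ s : Finset ι, s.Nonempty →
      ∃ g : X → ι, (∀ x, ∀ i ∈ s, f i x ≤ f (g x) x) ∧ Measurable g := by
    intro s hs
    induction hs using Finset.Nonempty.cons_induction with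
    | singleton a => exact ⟨fun _ => a, by simp, measurable_const⟩
    | cons a s ha hs ih =>
      obtain ⟨g, hg, hgm⟩ := ih
      have hm : Measurable fun x => f (g x) x :=
        (measurable_from_prod_countable_left (f := fun q : X × ι => f q.2 q.1) hf).comp
          (measurable_id.prodMk hgm)
      refine ⟨fun x => if f (g x) x ≤ f a x then a else g x, fun x i hi => ?_,
        Measurable.ite (measurableSet_le hm (hf a)) measurable_const hgm⟩
      beta_reduce
      rcases Finset.mem_cons.1 hi with rfl | hi
      · split_ifs with h
        · exact le_rfl
        · exact (not_le.1 h).le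
      · split_ifs with h
        · exact (hg x i hi).trans h
        · exact hg x i hi
  obtain ⟨g, hg, hgm⟩ := key Finset.univ Finset.univ_nonempty
  exact ⟨g, fun x i => hg x i (Finset.mem_univ i), fun i => hgm (by trivial : MeasurableSet {i})⟩

/-- Thresholds read from the sample suffice, so for each `m` the optimum is over a finite index set
that does not depend on the sample, and a measurable choice exists. -/
theorem exists_isEmpiricalOptimizer (n : ℕ) : ∃ h, IsEmpiricalOptimizer (bestChoice n) h := by
  classical
  let Idx : ℕ → Type := fun m => ↥(Finset.univ : Finset (LabelPrefix n)) → Option (Fin m)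
  have hmeas : ∀ m (c : Idx m), Measurable fun s : Fin m → Outcome n =>
      empProfit (bestChoice n) s (thresholdAlg (sampleThreshold s c)) := by
    intro m c
    refine (Finset.measurable_sum _ fun j _ => ?_).div_const _
    have h1 := (measurableFamily_sampleThreshold (n := n) c).measurable_profit
    have h2 : Measurable fun s : Fin m → Outcome n => (s, s j) :=
      measurable_id.prodMk (measurable_pi_apply j)
    have h3 := h1.comp h2
    exact h3
  choose g hg hgm using fun m => exists_measurable_argmax (hmeas m)
  refine ⟨fun m s => thresholdAlg (sampleThreshold s (g m s)),
    fun m s => isEssThreshold_thresholdAlg _, fun m s a ha => ?_, fun m i σ => ?_⟩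
  · obtain ⟨c, hc⟩ := exists_sampleThreshold (K := Finset.univ) s ha
    refine le_trans (le_of_eq ?_) (hg m s c)
    unfold empProfit
    congr 1
    exact Finset.sum_congr rfl fun j _ => (hc j fun i => Finset.mem_univ _).symm
  · refine measurable_to_bool ?_
    have : (fun q : (Fin m → Outcome n) × (Fin (i.val + 1) → unitInterval) =>
        (thresholdAlg (sampleThreshold q.1 (g m q.1))).accept i q.2 σ) ⁻¹' {true} =
        ⋃ c : Idx m, (Prod.fst ⁻¹' {s | g m s = c}) ∩
          (fun q : (Fin m → Outcome n) × (Fin (i.val + 1) → unitInterval) =>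
            (thresholdAlg (sampleThreshold q.1 c)).accept i q.2 σ) ⁻¹' {true} := by
      ext q
      simp
    rw [this]
    exact MeasurableSet.iUnion fun c => (measurable_fst (hgm m c)).inter
      (measurableFamily_sampleThreshold c i σ (measurableSet_singleton true))

end

end OptStop

namespace OptStop

noncomputable section

open MeasureTheory

/-! ### Generalization bound for empirical optimization -/

section Generalization

variable {n : ℕ}

/-- Hoeffding's bound for random signs: the sum factorizes, and each factor is `2 cosh(l d_j) ≤ 2
exp(l²/2)`. -/
theorem sum_exp_signs_le {m : ℕ} (l : ℝ) {d : Fin m → ℝ} (hd : ∀ j, |d j| ≤ 1) :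
    ∑ e : Fin m → Bool, Real.exp (l * ∑ j, (if e j then -d j else d j)) ≤
      2 ^ m * Real.exp (l ^ 2 / 2 * m) := by
  have h1 : ∀ e : Fin m → Bool, Real.exp (l * ∑ j, (if e j then -d j else d j)) =
      ∏ j, Real.exp (l * (if e j then -d j else d j)) := by
    intro e
    rw [Finset.mul_sum, Real.exp_sum]
  simp_rw [h1]
  have h2 := Finset.prod_univ_sum (fun _ : Fin m => (Finset.univ : Finset Bool))
    (fun j b => Real.exp (l * (if b then -d j else d j)))
  rw [Fintype.piFinset_univ] at h2
  rw [← h2]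
  calc ∏ j, ∑ b, Real.exp (l * (if b = true then -d j else d j))
      ≤ ∏ _j : Fin m, (2 * Real.exp (l ^ 2 / 2)) := by
        refine Finset.prod_le_prod (fun j _ => Finset.sum_nonneg fun b _ => (Real.exp_pos _).le)
          fun j _ => ?_
        have hcosh := Real.cosh_le_exp_half_sq (l * d j)
        rw [Real.cosh_eq] at hcosh
        have hmono : Real.exp ((l * d j) ^ 2 / 2) ≤ Real.exp (l ^ 2 / 2) := by
          refine Real.exp_le_exp.2 ?_
          have : d j ^ 2 ≤ 1 := by
            rw [← sq_abs]
            exact pow_le_one₀ (abs_nonneg _) (hd j)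
          rw [mul_pow]
          nlinarith [sq_nonneg l]
        simp only [Fintype.sum_bool, if_true, Bool.false_eq_true, if_false, mul_neg]
        linarith
    _ = 2 ^ m * Real.exp (l ^ 2 / 2 * m) := by
        rw [Finset.prod_const, Finset.card_univ, Fintype.card_fin, mul_pow, ← Real.exp_nat_mul]
        ring_nf

/-- Exchange the two entries of each pair marked by `e`. -/
def signSwap {Ω : Type*} {m : ℕ} (e : Fin m → Bool) (Z : Fin m → Ω × Ω) : Fin m → Ω × Ω :=
  fun j => if e j then (Z j).swap else Z j

theorem measurePreserving_signSwap {Ω : Type*} [MeasurableSpace Ω] {m : ℕ} (μ : Fin m → Measure Ω)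
    [∀ j, IsProbabilityMeasure (μ j)] (e : Fin m → Bool) :
    MeasurePreserving (signSwap (Ω := Ω) e) (Measure.pi fun j => (μ j).prod (μ j))
      (Measure.pi fun j => (μ j).prod (μ j)) := by
  refine measurePreserving_pi (fun j => (μ j).prod (μ j)) (fun j => (μ j).prod (μ j))
    (f := fun j z => if e j then z.swap else z) fun j => ?_
  cases e j
  · exact MeasurePreserving.id _
  · exact Measure.measurePreserving_swap

/-- The excess of the profit of the trained algorithm on the training sample over its profit on an
independent sample. -/
def overfit {m : ℕ} (h : (Fin m → Outcome n) → OnlineAlg n) (Z : Fin m → Outcome n × Outcome n) :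
    ℝ :=
  ∑ j, (profit (bestChoice n) (h fun j => (Z j).1) (Z j).1 -
    profit (bestChoice n) (h fun j => (Z j).1) (Z j).2)

variable {m : ℕ} {h : (Fin m → Outcome n) → OnlineAlg n}

theorem measurable_profit_apply (hh : MeasurableFamily h) {X : Type*} [MeasurableSpace X]
    {f : X → Fin m → Outcome n} {g : X → Outcome n} (hf : Measurable f) (hg : Measurable g) :
    Measurable fun x => profit (bestChoice n) (h (f x)) (g x) := by
  have h3 := hh.measurable_profit.comp (hf.prodMk hg)
  exact h3

theorem measurable_overfit (hh : MeasurableFamily h) : Measurable (overfit h) := by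
  have hf : Measurable fun (Z : Fin m → Outcome n × Outcome n) j => (Z j).1 :=
    measurable_pi_iff.2 fun j => measurable_fst.comp (measurable_pi_apply j)
  exact Finset.measurable_sum _ fun j _ =>
    (measurable_profit_apply hh hf (measurable_fst.comp (measurable_pi_apply j))).sub
    (measurable_profit_apply hh hf (measurable_snd.comp (measurable_pi_apply j)))

theorem profit_sub_abs_le (a : OnlineAlg n) (ω ω' : Outcome n) :
    |profit (bestChoice n) a ω - profit (bestChoice n) a ω'| ≤ 1 := by
  have h1 := profit_mem a ω
  have h2 := profit_mem a ω'
  rw [abs_le]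
  constructor <;> linarith [h1.1, h1.2, h2.1, h2.2]

theorem overfit_mem (Z : Fin m → Outcome n × Outcome n) :
    overfit h Z ∈ Set.Icc (-(m : ℝ)) m := by
  have : |overfit h Z| ≤ m := by
    refine (Finset.abs_sum_le_sum_abs _ _).trans ?_
    refine (Finset.sum_le_sum fun j _ => profit_sub_abs_le _ _ _).trans ?_
    simp
  exact abs_le.1 this

/-- The algorithm trained on the swapped sample varies with the swap `e`, but on these `2m` rounds
it always acts like one of `(2m+1)^|K|` algorithms whose description is independent of `e`. Bounding
by the sum over all of them leaves random signs for a fixed algorithm. -/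
theorem sum_exp_overfit_le (hess : ∀ s, IsEssThreshold (h s)) (K : Finset (LabelPrefix n))
    {Z : Fin m → Outcome n × Outcome n}
    (h1 : ∀ j i, (⟨i, labelsUpTo (Z j).1.2 i⟩ : LabelPrefix n) ∈ K)
    (h2 : ∀ j i, (⟨i, labelsUpTo (Z j).2.2 i⟩ : LabelPrefix n) ∈ K) (l : ℝ) :
    ∑ e : Fin m → Bool, Real.exp (l * overfit h (signSwap e Z)) ≤
      (2 * m + 1) ^ K.card * (2 ^ m * Real.exp (l ^ 2 / 2 * m)) := by
  classical
  let s : Fin m ⊕ Fin m → Outcome n := Sum.elim (fun j => (Z j).1) fun j => (Z j).2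
  let d : (K → Option (Fin m ⊕ Fin m)) → Fin m → ℝ := fun c j =>
    profit (bestChoice n) (thresholdAlg (sampleThreshold s c)) (Z j).1 -
      profit (bestChoice n) (thresholdAlg (sampleThreshold s c)) (Z j).2
  have hle : ∀ e : Fin m → Bool, Real.exp (l * overfit h (signSwap e Z)) ≤
      ∑ c, Real.exp (l * ∑ j, (if e j then -d c j else d c j)) := by
    intro e
    -- Thresholds are taken from the unswapped double sample, so the swap shows up only in the signs
    -- of `d c j`.
    obtain ⟨c, hc⟩ := exists_sampleThreshold (K := K) s (hess fun j => (signSwap e Z j).1)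
    have : overfit h (signSwap e Z) = ∑ j, (if e j then -d c j else d c j) := by
      refine Finset.sum_congr rfl fun j _ => ?_
      have e1 := hc (Sum.inl j) (h1 j)
      have e2 := hc (Sum.inr j) (h2 j)
      simp only [s, Sum.elim_inl, Sum.elim_inr] at e1 e2
      simp only [d]
      rw [e1, e2]
      by_cases he : e j <;> simp [signSwap, he]
    rw [this]
    exact Finset.single_le_sum (f := fun c => Real.exp (l * ∑ j, (if e j then -d c j else d c j)))
      (fun c _ => (Real.exp_pos _).le) (Finset.mem_univ c)
  calc ∑ e : Fin m → Bool, Real.exp (l * overfit h (signSwap e Z))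
      ≤ ∑ e : Fin m → Bool, ∑ c, Real.exp (l * ∑ j, (if e j then -d c j else d c j)) :=
        Finset.sum_le_sum fun e _ => hle e
    _ = ∑ c, ∑ e : Fin m → Bool, Real.exp (l * ∑ j, (if e j then -d c j else d c j)) :=
        Finset.sum_comm
    _ ≤ ∑ _c : K → Option (Fin m ⊕ Fin m), (2 ^ m * Real.exp (l ^ 2 / 2 * m)) :=
        Finset.sum_le_sum fun c _ => sum_exp_signs_le l fun j => profit_sub_abs_le _ _ _
    _ = (2 * m + 1) ^ K.card * (2 ^ m * Real.exp (l ^ 2 / 2 * m)) := by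
        rw [Finset.sum_const, nsmul_eq_mul, Finset.card_univ]
        simp only [Fintype.card_fun, Fintype.card_option, Fintype.card_sum, Fintype.card_fin,
          Fintype.card_coe]
        push_cast
        ring_nf

variable (μ : Measure (Outcome n)) [IsProbabilityMeasure μ]

/-- The law of the pairs is invariant under every swap, so the expectation equals its average over
the `2^m` swaps. -/
theorem integral_exp_overfit_le (hh : MeasurableFamily h) (hess : ∀ s, IsEssThreshold (h s))
    {K : Finset (LabelPrefix n)}
    (hK : ∀ᵐ ω ∂μ, ∀ i, (⟨i, labelsUpTo ω.2 i⟩ : LabelPrefix n) ∈ K) (l : ℝ) :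
    ∫ Z, Real.exp (l * overfit h Z) ∂(Measure.pi fun _ : Fin m => μ.prod μ) ≤
      (2 * m + 1) ^ K.card * Real.exp (l ^ 2 / 2 * m) := by
  set P := Measure.pi fun _ : Fin m => μ.prod μ with hP
  have hb : ∀ Z, Real.exp (l * overfit h Z) ∈ Set.Icc 0 (Real.exp (|l| * m)) := fun Z => by
    refine ⟨(Real.exp_pos _).le, Real.exp_le_exp.2 ?_⟩
    refine (le_abs_self _).trans ?_
    rw [abs_mul]
    exact mul_le_mul_of_nonneg_left (abs_le.2 (overfit_mem Z)) (abs_nonneg l)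
  have hm : Measurable fun Z => Real.exp (l * overfit h Z) :=
    ((measurable_overfit hh).const_mul l).exp
  have hswap : ∀ e : Fin m → Bool, ∫ Z, Real.exp (l * overfit h (signSwap e Z)) ∂P =
      ∫ Z, Real.exp (l * overfit h Z) ∂P := fun e =>
    integral_comp_measurePreserving (measurePreserving_signSwap (fun _ => μ) e) hm
  have hmem : ∀ᵐ Z ∂P, ∀ j, (∀ i, (⟨i, labelsUpTo (Z j).1.2 i⟩ : LabelPrefix n) ∈ K) ∧
      ∀ i, (⟨i, labelsUpTo (Z j).2.2 i⟩ : LabelPrefix n) ∈ K := by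
    rw [ae_all_iff]
    intro j
    have h1 := (measurePreserving_eval (fun _ : Fin m => μ.prod μ) j).quasiMeasurePreserving
    have h2 : ∀ᵐ z ∂(μ.prod μ), (∀ i, (⟨i, labelsUpTo z.1.2 i⟩ : LabelPrefix n) ∈ K) ∧
        ∀ i, (⟨i, labelsUpTo z.2.2 i⟩ : LabelPrefix n) ∈ K :=
      (Measure.quasiMeasurePreserving_fst.ae hK).and (Measure.quasiMeasurePreserving_snd.ae hK)
    exact h1.ae h2
  have hsum : ∑ e : Fin m → Bool, ∫ Z, Real.exp (l * overfit h (signSwap e Z)) ∂P ≤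
      (2 * m + 1) ^ K.card * (2 ^ m * Real.exp (l ^ 2 / 2 * m)) := by
    have hint : ∀ e : Fin m → Bool,
        Integrable (fun Z => Real.exp (l * overfit h (signSwap e Z))) P := fun e =>
      integrable_of_mem_Icc (hm.comp (measurePreserving_signSwap (fun _ => μ) e).measurable) fun Z => hb _
    rw [← integral_finsetSum _ fun e _ => hint e]
    calc ∫ Z, ∑ e : Fin m → Bool, Real.exp (l * overfit h (signSwap e Z)) ∂P
        ≤ ∫ _, ((2 * m + 1) ^ K.card * (2 ^ m * Real.exp (l ^ 2 / 2 * m)) : ℝ) ∂P := by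
          refine integral_mono_ae (integrable_finsetSum _ fun e _ => hint e)
            (integrable_const _) ?_
          filter_upwards [hmem] with Z hZ
          exact sum_exp_overfit_le hess K (fun j => (hZ j).1) (fun j => (hZ j).2) l
      _ = _ := by simp
  simp_rw [hswap] at hsum
  rw [Finset.sum_const, nsmul_eq_mul, Finset.card_univ, Fintype.card_fun, Fintype.card_bool,
    Fintype.card_fin, Nat.cast_pow, Nat.cast_ofNat, mul_left_comm] at hsum
  exact le_of_mul_le_mul_left hsum (by positivity)

/-- Jensen's inequality in elementary form: with `X = overfit h Z`, apply `x + 1 ≤ exp x` to `lX -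
A`, where `A` is the logarithm of the bound on `E exp(lX)`. -/
theorem mul_integral_overfit_le (hh : MeasurableFamily h) (hess : ∀ s, IsEssThreshold (h s))
    {K : Finset (LabelPrefix n)}
    (hK : ∀ᵐ ω ∂μ, ∀ i, (⟨i, labelsUpTo ω.2 i⟩ : LabelPrefix n) ∈ K) (l : ℝ) :
    l * ∫ Z, overfit h Z ∂(Measure.pi fun _ : Fin m => μ.prod μ) ≤
      K.card * Real.log (2 * m + 1) + l ^ 2 / 2 * m := by
  set P := Measure.pi fun _ : Fin m => μ.prod μ with hP
  set A := K.card * Real.log (2 * m + 1) + l ^ 2 / 2 * m with hA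
  have hexpA : Real.exp A = (2 * m + 1) ^ K.card * Real.exp (l ^ 2 / 2 * m) := by
    rw [hA, Real.exp_add, Real.exp_nat_mul, Real.exp_log (by positivity)]
  have hint : Integrable (overfit h) P := integrable_of_mem_Icc (measurable_overfit hh) overfit_mem
  have hint2 : Integrable (fun Z => Real.exp (l * overfit h Z)) P := by
    refine integrable_of_mem_Icc ((measurable_overfit hh).const_mul l).exp
      (a := 0) (b := Real.exp (|l| * m)) fun Z => ⟨(Real.exp_pos _).le, Real.exp_le_exp.2 ?_⟩
    refine (le_abs_self _).trans ?_
    rw [abs_mul]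
    exact mul_le_mul_of_nonneg_left (abs_le.2 (overfit_mem Z)) (abs_nonneg l)
  have h1 : ∫ Z, (l * overfit h Z - A + 1) ∂P ≤ ∫ Z, Real.exp (l * overfit h Z) * Real.exp (-A) ∂P := by
    refine integral_mono (((hint.const_mul l).sub (integrable_const _)).add (integrable_const _))
      (hint2.mul_const _) fun Z => ?_
    have := Real.add_one_le_exp (l * overfit h Z - A)
    rwa [sub_eq_add_neg, Real.exp_add] at this
  have hl : Integrable (fun Z => l * overfit h Z) P := hint.const_mul l
  have hlA : Integrable (fun Z => l * overfit h Z - A) P := hl.sub (integrable_const _)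
  rw [integral_mul_const, integral_add hlA (integrable_const _),
    integral_sub hl (integrable_const _), integral_const_mul] at h1
  simp only [integral_const, probReal_univ, smul_eq_mul, one_mul] at h1
  have h2 := mul_le_mul_of_nonneg_right (integral_exp_overfit_le μ hh hess hK l)
    (Real.exp_pos (-A)).le
  rw [← hexpA, ← Real.exp_add, add_neg_cancel, Real.exp_zero] at h2
  linarith

/-- Expected profit of the trained algorithm on a fresh round. -/
def freshProfit (h : (Fin m → Outcome n) → OnlineAlg n) (s : Fin m → Outcome n) : ℝ :=
  ∫ ω, profit (bestChoice n) (h s) ω ∂μ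

theorem freshProfit_mem (s : Fin m → Outcome n) : freshProfit μ h s ∈ Set.Icc (0 : ℝ) 1 :=
  integral_mem_Icc fun _ => profit_mem _ _

theorem measurable_freshProfit (hh : MeasurableFamily h) : Measurable (freshProfit μ h) :=
  (hh.measurable_profit.stronglyMeasurable.integral_prod_right' (ν := μ)).measurable

/-- The trained algorithm depends only on the first entries of the pairs, so integrating out each
second entry yields the expected profit on a fresh round. -/
theorem integral_overfit (hh : MeasurableFamily h) :
    ∫ Z, overfit h Z ∂(Measure.pi fun _ : Fin m => μ.prod μ) =
      ∫ s, (∑ j, profit (bestChoice n) (h s) (s j) - m * freshProfit μ h s)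
        ∂(Measure.pi fun _ => μ) := by
  have hmp := measurePreserving_arrowProdEquivProdArrow (Outcome n) (Outcome n) (Fin m)
    (fun _ => μ) (fun _ => μ)
  let F : (Fin m → Outcome n) × (Fin m → Outcome n) → ℝ := fun q =>
    ∑ j, (profit (bestChoice n) (h q.1) (q.1 j) - profit (bestChoice n) (h q.1) (q.2 j))
  have hp2 : ∀ j, Measurable fun q : (Fin m → Outcome n) × (Fin m → Outcome n) =>
      profit (bestChoice n) (h q.1) (q.2 j) := fun j =>
    measurable_profit_apply hh measurable_fst ((measurable_pi_apply j).comp measurable_snd)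
  have hp1 : ∀ j, Measurable fun q : (Fin m → Outcome n) × (Fin m → Outcome n) =>
      profit (bestChoice n) (h q.1) (q.1 j) := fun j =>
    measurable_profit_apply hh measurable_fst ((measurable_pi_apply j).comp measurable_fst)
  have hF : Measurable F := Finset.measurable_sum _ fun j _ => (hp1 j).sub (hp2 j)
  have hFi : Integrable F ((Measure.pi fun _ => μ).prod (Measure.pi fun _ => μ)) := by
    refine integrable_finsetSum _ fun j _ => ?_
    exact (integrable_of_mem_Icc (hp1 j) fun q => profit_mem _ _).sub
      (integrable_of_mem_Icc (hp2 j) fun q => profit_mem _ _)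
  have h1 : ∫ Z, overfit h Z ∂(Measure.pi fun _ : Fin m => μ.prod μ) =
      ∫ q, F q ∂((Measure.pi fun _ => μ).prod (Measure.pi fun _ => μ)) :=
    hmp.integral_comp' (g := F)
  rw [h1, integral_prod F hFi]
  refine integral_congr_ae (Filter.Eventually.of_forall fun s => ?_)
  have hs : ∀ j : Fin m, ∫ s' : Fin m → Outcome n, profit (bestChoice n) (h s) (s' j)
      ∂(Measure.pi fun _ => μ) = freshProfit μ h s := fun j =>
    integral_comp_eval (μ := fun _ : Fin m => μ) (i := j)
      (measurable_profit (h s)).aestronglyMeasurable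
  have hi : ∀ j : Fin m, Integrable (fun s' : Fin m → Outcome n =>
      profit (bestChoice n) (h s) (s' j)) (Measure.pi fun _ => μ) := fun j =>
    integrable_of_mem_Icc ((measurable_profit (h s)).comp (measurable_pi_apply j))
      fun q => profit_mem _ _
  simp only [F]
  have hi' : ∀ j : Fin m, Integrable (fun s' : Fin m → Outcome n =>
      profit (bestChoice n) (h s) (s j) - profit (bestChoice n) (h s) (s' j))
      (Measure.pi fun _ => μ) := fun j => (integrable_const _).sub (hi j)
  rw [integral_finsetSum _ fun j _ => hi' j]
  simp_rw [integral_sub (integrable_const _) (hi _), hs]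
  simp

/-- Expected suboptimality of the empirical optimizer. -/
theorem integral_gap_le {H : (m : ℕ) → (Fin m → Outcome n) → OnlineAlg n}
    (hH : IsEmpiricalOptimizer (bestChoice n) H) (hm : 0 < m) {K : Finset (LabelPrefix n)}
    (hKpos : 0 < K.card)
    (hK : ∀ᵐ ω ∂μ, ∀ i, (⟨i, labelsUpTo ω.2 i⟩ : LabelPrefix n) ∈ K) {a : OnlineAlg n}
    (ha : IsEssThreshold a) :
    ∫ ω, profit (bestChoice n) a ω ∂μ - ∫ s, freshProfit μ (H m) s ∂(Measure.pi fun _ => μ) ≤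
      Real.sqrt (2 * K.card * Real.log (2 * m + 1) / m) := by
  have hh : MeasurableFamily (H m) := hH.measurable m
  have hm' : (0 : ℝ) < m := by exact_mod_cast hm
  have hlog : 0 < Real.log (2 * m + 1) := Real.log_pos (by linarith)
  have hk' : (0 : ℝ) < K.card := by exact_mod_cast hKpos
  set La := ∫ ω, profit (bestChoice n) a ω ∂μ with hLa
  set P := Measure.pi fun _ : Fin m => μ with hP
  have hq : ∀ j, Measurable fun s : Fin m → Outcome n => profit (bestChoice n) (H m s) (s j) :=
    fun j => measurable_profit_apply hh measurable_id (measurable_pi_apply j)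
  have hqi : ∀ j, Integrable (fun s : Fin m → Outcome n => profit (bestChoice n) (H m s) (s j)) P :=
    fun j => integrable_of_mem_Icc (hq j) fun s => profit_mem _ _
  have hai : ∀ j : Fin m, Integrable (fun s : Fin m → Outcome n => profit (bestChoice n) a (s j)) P :=
    fun j => integrable_of_mem_Icc ((measurable_profit a).comp (measurable_pi_apply j))
      fun s => profit_mem _ _
  have hfi : Integrable (freshProfit μ (H m)) P :=
    integrable_of_mem_Icc (measurable_freshProfit μ hh) (freshProfit_mem μ)
  have h1 : m * La = ∫ s, ∑ j, profit (bestChoice n) a (s j) ∂P := by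
    rw [integral_finsetSum _ fun j _ => hai j]
    have : ∀ j : Fin m, ∫ s : Fin m → Outcome n, profit (bestChoice n) a (s j) ∂P = La := fun j =>
      integral_comp_eval (μ := fun _ : Fin m => μ) (i := j)
        (measurable_profit a).aestronglyMeasurable
    simp [this]
  have h2 : ∫ s, ∑ j, profit (bestChoice n) a (s j) ∂P ≤
      ∫ s, ∑ j, profit (bestChoice n) (H m s) (s j) ∂P := by
    refine integral_mono (integrable_finsetSum _ fun j _ => hai j)
      (integrable_finsetSum _ fun j _ => hqi j) fun s => ?_
    have := hH.optimal m s a ha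
    unfold empProfit at this
    exact (div_le_div_iff_of_pos_right hm').1 this
  have h3 := integral_overfit μ hh
  rw [integral_sub (integrable_finsetSum _ fun j _ => hqi j) (hfi.const_mul _),
    integral_const_mul] at h3
  set g := La - ∫ s, freshProfit μ (H m) s ∂P with hg
  have h4 : m * g ≤ ∫ Z, overfit (H m) Z ∂(Measure.pi fun _ : Fin m => μ.prod μ) := by
    rw [h3, hg]
    linarith
  set B := K.card * Real.log (2 * m + 1) with hB
  have hBpos : 0 < B := mul_pos hk' hlog
  -- This `l` balances `B` against `l²m/2`; their sum is then `m l²`, and dividing by `m l` gives a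
  -- gap of at most `l`.
  set l := Real.sqrt (2 * B / m) with hl
  have hlpos : 0 < l := Real.sqrt_pos.2 (by positivity)
  have hl2 : l ^ 2 = 2 * B / m := Real.sq_sqrt (by positivity)
  have h5 := mul_integral_overfit_le μ hh (hH.essThreshold m) hK l
  have h6 : l * (m * g) ≤ l * (m * l) := by
    calc l * (m * g) ≤ B + l ^ 2 / 2 * m := (mul_le_mul_of_nonneg_left h4 hlpos.le).trans h5
      _ = l * (m * l) := by
        have : l * (m * l) = m * l ^ 2 := by ring
        rw [this, hl2]
        field_simp
        ring
  have h7 := le_of_mul_le_mul_left (le_of_mul_le_mul_left h6 hlpos) hm'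
  refine h7.trans (le_of_eq ?_)
  rw [hl, hB]
  ring_nf

end Generalization

/-! ### Counting label prefixes -/

/-- There are `n!/(n-i)!` label prefixes of length `i`, and `∑ 1/j! ≤ e < 3`. -/
theorem card_labelPrefix_le (n : ℕ) : Fintype.card (LabelPrefix n) ≤ 3 * n.factorial := by
  have h1 : (Fintype.card (LabelPrefix n) : ℝ) ≤ n.factorial * Real.exp 1 := by
    rw [Fintype.card_sigma]
    simp only [Fintype.card_embedding_eq, Fintype.card_fin, Nat.cast_sum]
    rw [Fin.sum_univ_eq_sum_range (fun i => ((n.descFactorial (i + 1) : ℕ) : ℝ)) n,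
      ← Finset.sum_range_reflect]
    refine le_trans ?_ (mul_le_mul_of_nonneg_left
      (Real.sum_le_exp_of_nonneg (x := 1) zero_le_one n) (Nat.cast_nonneg _))
    rw [Finset.mul_sum]
    refine Finset.sum_le_sum fun i hi => ?_
    -- After the reflection, index `i` stands for prefixes of length `n - i`, whose number is
    -- `n!/i!`.
    have hi' := Finset.mem_range.1 hi
    have h2 : (n - 1 - i) + 1 ≤ n := by omega
    have h3 := Nat.factorial_mul_descFactorial h2
    rw [show n - (n - 1 - i + 1) = i by omega] at h3
    have hpos : (0 : ℝ) < i.factorial := by exact_mod_cast i.factorial_pos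
    rw [one_pow, mul_one_div, le_div_iff₀ hpos, mul_comm]
    exact_mod_cast h3.le
  have h4 : (Fintype.card (LabelPrefix n) : ℝ) ≤ (3 * n.factorial : ℕ) := by
    push_cast
    refine h1.trans ?_
    have := Real.exp_one_lt_d9
    have hf : (0 : ℝ) ≤ n.factorial := Nat.cast_nonneg _
    nlinarith
  exact_mod_cast h4

/-- Almost surely only the `n` prefixes of the identity occur, which turns `n!` into `n` in the
adversarial regret bound. -/
theorem labelPrefix_mem_of_adversarial {n : ℕ} {𝔻 : Distributions n} (h : 𝔻.IsAdversarialOrder) :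
    ∀ᵐ ω ∂𝔻.law, ∀ i, (⟨i, labelsUpTo ω.2 i⟩ : LabelPrefix n) ∈
      (Finset.univ : Finset (Fin n)).map
        ⟨fun i => (⟨i, labelsUpTo (Equiv.refl _) i⟩ : LabelPrefix n),
          fun _ _ hij => congrArg Sigma.fst hij⟩ := by
  have h1 : ∀ᵐ ω ∂𝔻.law, ω.2 = Equiv.refl (Fin n) := by
    have hms : MeasurableSet {ω : Outcome n | ¬ ω.2 = Equiv.refl (Fin n)} :=
      measurable_snd (t := {Equiv.refl (Fin n)}ᶜ) (measurableSet_singleton _).compl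
    rw [ae_iff, Distributions.law_eq, Measure.map_apply measurable_arrange hms]
    have : arrange ⁻¹' {ω : Outcome n | ¬ ω.2 = Equiv.refl (Fin n)} =
        Set.univ ×ˢ {Equiv.refl (Fin n)}ᶜ := by
      ext q; simp [arrange]
    rw [this, Measure.prod_prod, prob_compl_eq_zero_iff (measurableSet_singleton _) |>.2, mul_zero]
    rw [PMF.toMeasure_apply_singleton _ _ (measurableSet_singleton _), h]
    simp
  filter_upwards [h1] with ω hω i
  rw [hω]
  exact Finset.mem_map_of_mem _ (Finset.mem_univ i)

end

end OptStop

namespace OptStop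

noncomputable section

open MeasureTheory

/-! ### The single-sample baseline -/

theorem exists_median (κ : Measure unitInterval) [IsProbabilityMeasure κ] :
    ∃ v, κ (Set.Iio v) ≤ 1 / 2 ∧ κ (Set.Ioi v) ≤ 1 / 2 := by
  set S := {u | κ (Set.Ioi u) ≤ 1 / 2} with hS
  have hup : ∀ a b : unitInterval, a ≤ b → a ∈ S → b ∈ S := fun a b hab ha =>
    (measure_mono (Set.Ioi_subset_Ioi hab)).trans ha
  refine ⟨sInf S, ?_, ?_⟩
  · rcases eq_or_ne (sInf S) ⊥ with h | h
    · rw [h]; simp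
    · obtain ⟨u, hu, hlt, hlim⟩ := exists_seq_strictMono_tendsto' (bot_lt_iff_ne_bot.2 h)
      rw [← iUnion_Iic_eq_Iio_of_lt_of_tendsto (fun k => (hlt k).2) hlim,
        Monotone.measure_iUnion fun i j hij => Set.Iic_subset_Iic.2 (hu.monotone hij)]
      refine iSup_le fun k => ?_
      have hk : ¬ κ (Set.Ioi (u k)) ≤ 1 / 2 := fun hk =>
        absurd (sInf_le (show u k ∈ S from hk)) (not_le.2 (hlt k).2)
      have := prob_compl_eq_one_sub (μ := κ) (s := Set.Ioi (u k)) measurableSet_Ioi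
      rw [Set.compl_Ioi] at this
      rw [this]
      refine tsub_le_iff_left.2 ?_
      calc (1 : ENNReal) = 1 / 2 + 1 / 2 := (ENNReal.add_halves 1).symm
        _ ≤ _ := add_le_add_left (not_le.1 hk).le _
  · rcases eq_or_ne (sInf S) ⊤ with h | h
    · rw [h]; simp
    · obtain ⟨u, hu, hlt, hlim⟩ := exists_seq_strictAnti_tendsto' (lt_top_iff_ne_top.2 h)
      rw [← iUnion_Ici_eq_Ioi_of_lt_of_tendsto (fun k => (hlt k).1) hlim]
      -- Passing from `Ici` to `Ioi` is possible because `u` decreases strictly; `u k` itself lies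
      -- above `u (k + 1)`.
      have hsub : (⋃ k, Set.Ici (u k)) ⊆ ⋃ k, Set.Ioi (u k) := by
        refine Set.iUnion_subset fun k x hx => Set.mem_iUnion.2 ⟨k + 1, ?_⟩
        exact (hu (Nat.lt_succ_self k)).trans_le hx
      refine (measure_mono hsub).trans ?_
      rw [Monotone.measure_iUnion fun i j hij => Set.Ioi_subset_Ioi (hu.antitone hij)]
      refine iSup_le fun k => ?_
      obtain ⟨w, hw, hwu⟩ := sInf_lt_iff.1 (hlt k).1
      exact hup w _ hwu.le hw

section Baseline

variable {n : ℕ}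

theorem accepts_constThreshold {strict : Bool} {θ : unitInterval} {ω : Outcome n} {i : Fin n} :
    Accepts (constThreshold n strict θ) ω i ↔
      if strict = true then θ < ω.1 i else θ ≤ ω.1 i := by
  have h : valuesUpTo ω.1 i (Fin.last i.val) = ω.1 i := rfl
  unfold Accepts constThreshold
  cases strict <;> simp [h]

/-- If every acceptable value is maximal, it does not matter which one comes first. This makes the
bounds for the baseline independent of the arrival order. -/
theorem profit_eq_one {a : OnlineAlg n} {ω : Outcome n} (h₁ : ∃ i, Accepts a ω i)
    (h₂ : ∀ i, Accepts a ω i → ω.1 i = Finset.univ.sup ω.1) : profit (bestChoice n) a ω = 1 := by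
  classical
  rcases Fin.eq_castSucc_or_eq_last (stopIndex a ω) with ⟨i, hi⟩ | h
  · rw [profit, hi, bestChoice_castSucc, if_pos (h₂ i (stopIndex_eq_castSucc.1 hi).1)]
  · obtain ⟨i, hi⟩ := h₁
    exact absurd hi (stopIndex_eq_last.1 h i)

/-- Exactly one value exceeds `θ`. -/
def StrictWin (x : Fin n → unitInterval) (θ : unitInterval) : Prop :=
  ∃ i, θ < x i ∧ ∀ j, j ≠ i → x j ≤ θ

/-- The maximum is `θ`, or exactly one value is at least `θ`, and it is larger. -/
def WeakWin (x : Fin n → unitInterval) (θ : unitInterval) : Prop :=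
  Finset.univ.sup x = θ ∨ ∃ i, θ < x i ∧ ∀ j, j ≠ i → x j < θ

theorem eq_sup_of_forall_le {ι : Type*} [Fintype ι] {x : ι → unitInterval} {i : ι}
    (h : ∀ j, x j ≤ x i) : x i = Finset.univ.sup x :=
  le_antisymm (Finset.le_sup (Finset.mem_univ i)) (Finset.sup_le fun j _ => h j)

theorem profit_of_strictWin {y : Fin n → unitInterval} {θ : unitInterval} (h : StrictWin y θ)
    (τ : Equiv.Perm (Fin n)) :
    profit (bestChoice n) (constThreshold n true θ) (arrange (y, τ)) = 1 := by
  obtain ⟨i, hi, hj⟩ := h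
  have hx : ∀ k, (arrange (y, τ)).1 k = y (τ k) := fun _ => rfl
  refine profit_eq_one ⟨τ.symm i, ?_⟩ fun k hk => ?_
  · rw [accepts_constThreshold, if_pos rfl, hx, τ.apply_symm_apply]
    exact hi
  · rw [accepts_constThreshold, if_pos rfl, hx] at hk
    refine eq_sup_of_forall_le fun l => ?_
    rw [hx, hx]
    have hki : τ k = i := by
      by_contra hne
      exact absurd (hj _ hne) (not_le.2 hk)
    rw [hki]
    by_cases hl : τ l = i
    · rw [hl]
    · exact (hj _ hl).trans hi.le

theorem sup_comp_perm (y : Fin n → unitInterval) (τ : Equiv.Perm (Fin n)) :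
    (Finset.univ.sup fun i => y (τ i)) = Finset.univ.sup y := by
  refine le_antisymm (Finset.sup_le fun i _ => Finset.le_sup (Finset.mem_univ _))
    (Finset.sup_le fun i _ => ?_)
  have := Finset.le_sup (f := fun i => y (τ i)) (Finset.mem_univ (τ.symm i))
  simpa using this

theorem profit_of_weakWin [NeZero n] {y : Fin n → unitInterval} {θ : unitInterval}
    (h : WeakWin y θ) (τ : Equiv.Perm (Fin n)) :
    profit (bestChoice n) (constThreshold n false θ) (arrange (y, τ)) = 1 := by
  have hx : ∀ k, (arrange (y, τ)).1 k = y (τ k) := fun _ => rfl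
  have hacc : ∀ k, Accepts (constThreshold n false θ) (arrange (y, τ)) k ↔ θ ≤ y (τ k) := by
    intro k
    rw [accepts_constThreshold, if_neg (by simp), hx]
  rcases h with h | ⟨i, hi, hj⟩
  · refine profit_eq_one ?_ fun k hk => ?_
    · obtain ⟨i, -, hi⟩ := Finset.exists_max_image (Finset.univ : Finset (Fin n)) y
        Finset.univ_nonempty
      refine ⟨τ.symm i, (hacc _).2 ?_⟩
      rw [τ.apply_symm_apply, ← h]
      exact Finset.sup_le fun j _ => hi j (Finset.mem_univ j)
    · rw [hacc] at hk
      refine eq_sup_of_forall_le fun l => ?_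
      rw [hx, hx]
      refine le_trans ?_ hk
      rw [← h]
      exact Finset.le_sup (Finset.mem_univ _)
  · refine profit_eq_one ⟨τ.symm i, ?_⟩ fun k hk => ?_
    · rw [hacc, τ.apply_symm_apply]
      exact hi.le
    · rw [hacc] at hk
      refine eq_sup_of_forall_le fun l => ?_
      rw [hx, hx]
      have hki : τ k = i := by
        by_contra hne
        exact absurd (hj _ hne) (not_lt.2 hk)
      rw [hki]
      by_cases hl : τ l = i
      · rw [hl]
      · exact ((hj _ hl).trans hi).le

open Classical in
/-- Number of winning comparison rules, among `>` and `≥`, for values `x` and sample `x'`. -/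
def winCount (x x' : Fin n → unitInterval) : ℝ :=
  (if StrictWin x (Finset.univ.sup x') then 1 else 0) +
    if WeakWin x (Finset.univ.sup x') then 1 else 0

open Classical in
/-- Lower bound for `winCount` in terms of the value `u` at one position and the maximum `B` of the
other values (`u'` and `B'` in the sample). -/
def winCountAt (u u' B B' : unitInterval) : ℝ :=
  (if max u' B' < u ∧ B ≤ max u' B' then 1 else 0) +
    if max u B = max u' B' ∨ max u' B' < u ∧ B < max u' B' then 1 else 0

theorem winCountAt_nonneg (u u' B B' : unitInterval) : 0 ≤ winCountAt u u' B B' := by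
  unfold winCountAt
  split_ifs <;> norm_num

open Classical in
-- Here `a ≥ b` are the two values at the top position and `A ≤ A'` the maxima of the rest; the four
-- terms are the four ways to place them. If `a = b`, both rounds have the same maximum and `≥` wins
-- in all four. If `a = A' > b`, it wins in the two placements with `a` and `A'` in different
-- rounds. If `A' < b < a`, both rules win whenever `a` is in the round and `b` in the sample. If `b
-- ≤ A' < a`, put `a` in the round and `A'` in the sample: both rules win if `A < A'`; if `A = A'`,
-- the rule `>` wins in two identical placements.
theorem two_le_sum_winCountAt_of_le {a b A A' : unitInterval} (hba : b ≤ a) (hA : A ≤ A')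
    (hle : A' ≤ a) :
    2 + 2 * (if a = b ∨ max A A' < min a b then 1 else 0) ≤
      winCountAt a b A A' + winCountAt b a A A' + winCountAt a b A' A + winCountAt b a A' A := by
  have n1 := winCountAt_nonneg b a A A'
  have n2 := winCountAt_nonneg b a A' A
  have n3 := winCountAt_nonneg a b A' A
  have hs : ∀ {u u' B B' : unitInterval}, max u' B' < u → B ≤ max u' B' →
      1 ≤ winCountAt u u' B B' := by
    intro u u' B B' h1 h2
    unfold winCountAt
    rw [if_pos ⟨h1, h2⟩]
    split_ifs <;> norm_num
  have ht : ∀ {u u' B B' : unitInterval}, max u B = max u' B' → 1 ≤ winCountAt u u' B B' := by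
    intro u u' B B' h1
    unfold winCountAt
    rw [if_pos (Or.inl h1 : max u B = max u' B' ∨ _)]
    split_ifs <;> norm_num
  have hst : ∀ {u u' B B' : unitInterval}, max u' B' < u → B < max u' B' →
      2 ≤ winCountAt u u' B B' := by
    intro u u' B B' h1 h2
    unfold winCountAt
    rw [if_pos ⟨h1, h2.le⟩, if_pos (Or.inr ⟨h1, h2⟩)]
    norm_num
  rcases hba.eq_or_lt with rfl | hlt
  · have e1 := ht (u := b) (u' := b) (B := A) (B' := A')
      (by rw [max_eq_left (hA.trans hle), max_eq_left hle])
    have e2 := ht (u := b) (u' := b) (B := A') (B' := A)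
      (by rw [max_eq_left (hA.trans hle), max_eq_left hle])
    simp only [true_or, if_true]
    linarith
  · have hne : ¬ a = b := hlt.ne'
    rw [max_eq_right hA, min_eq_right hba]
    rcases hle.eq_or_lt with rfl | hlt'
    · have hK : ¬ (A' = b ∨ A' < b) := by
        rintro (h | h)
        · exact hne h
        · exact absurd h (not_lt.2 hba)
      rw [if_neg hK]
      have e1 := ht (u := A') (u' := b) (B := A) (B' := A')
        (by rw [max_eq_left hA, max_eq_right hba])
      have e2 := ht (u := b) (u' := A') (B := A') (B' := A)
        (by rw [max_eq_left hA, max_eq_right hba])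
      linarith
    · by_cases hK : A' < b
      · rw [if_pos (Or.inr hK)]
        have e1 := hst (u := a) (u' := b) (B := A) (B' := A') (max_lt hlt hlt')
          (lt_max_of_lt_left (hA.trans_lt hK))
        have e2 := hst (u := a) (u' := b) (B := A') (B' := A) (max_lt hlt (hA.trans_lt hlt'))
          (lt_max_of_lt_left hK)
        linarith
      · rw [if_neg (by tauto)]
        rcases hA.eq_or_lt with rfl | hA'
        · have e1 := hs (u := a) (u' := b) (B := A) (B' := A) (max_lt hlt hlt') (le_max_right _ _)
          linarith
        · have e1 := hst (u := a) (u' := b) (B := A) (B' := A') (max_lt hlt hlt')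
            (lt_max_of_lt_right hA')
          linarith

open Classical in
theorem two_le_sum_winCountAt {a b A A' : unitInterval} (h : max A A' ≤ max a b) :
    2 + 2 * (if a = b ∨ max A A' < min a b then 1 else 0) ≤
      winCountAt a b A A' + winCountAt b a A A' + winCountAt a b A' A + winCountAt b a A' A := by
  rcases le_total b a with hba | hba <;> rcases le_total A A' with hA | hA
  · rw [max_eq_right hA, max_eq_left hba] at h
    exact two_le_sum_winCountAt_of_le hba hA h
  · rw [max_eq_left hA, max_eq_left hba] at h
    have := two_le_sum_winCountAt_of_le hba hA h
    rw [max_comm A' A] at this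
    linarith
  · rw [max_eq_right hA, max_eq_right hba] at h
    have := two_le_sum_winCountAt_of_le hba hA h
    have e : (b = a ∨ max A A' < min b a) ↔ (a = b ∨ max A A' < min a b) := by
      rw [min_comm, eq_comm]
    simp only [e] at this
    linarith
  · rw [max_eq_left hA, max_eq_right hba] at h
    have := two_le_sum_winCountAt_of_le hba hA h
    have e : (b = a ∨ max A' A < min b a) ↔ (a = b ∨ max A A' < min a b) := by
      rw [min_comm, max_comm, eq_comm]
    simp only [e] at this
    linarith

/-- The maximum of the values other than the one at `i`. -/
def supExcept (i : Fin n) (x : Fin n → unitInterval) : unitInterval :=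
  (Finset.univ.erase i).sup x

theorem sup_eq_max_supExcept (i : Fin n) (x : Fin n → unitInterval) :
    Finset.univ.sup x = max (x i) (supExcept i x) := by
  rw [← Finset.insert_erase (Finset.mem_univ i), Finset.sup_insert]
  rfl

theorem le_supExcept {i j : Fin n} (h : j ≠ i) (x : Fin n → unitInterval) :
    x j ≤ supExcept i x := Finset.le_sup (Finset.mem_erase.2 ⟨h, Finset.mem_univ j⟩)

theorem winCountAt_le_winCount (i : Fin n) (x x' : Fin n → unitInterval) :
    winCountAt (x i) (x' i) (supExcept i x) (supExcept i x') ≤ winCount x x' := by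
  classical
  unfold winCountAt winCount
  rw [← sup_eq_max_supExcept, ← sup_eq_max_supExcept]
  refine add_le_add ?_ ?_
  · split_ifs with h1 h2
    · exact le_rfl
    · exact absurd ⟨i, h1.1, fun j hj => (le_supExcept hj x).trans h1.2⟩ h2
    · exact zero_le_one
    · exact le_rfl
  · split_ifs with h1 h2
    · exact le_rfl
    · refine absurd ?_ h2
      rcases h1 with h1 | h1
      · exact Or.inl h1
      · exact Or.inr ⟨i, h1.1, fun j hj => (le_supExcept hj x).trans_lt h1.2⟩
    · exact zero_le_one
    · exact le_rfl

/-- `winCount` for values and sample given as a sequence of pairs. -/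
def pairCount (Z : Fin n → unitInterval × unitInterval) : ℝ :=
  winCount (fun j => (Z j).1) fun j => (Z j).2

/-- The pair at `i` consists of the two largest values in a robust sense, separated by `v`. -/
def Dominant (i : Fin n) (v : unitInterval) (Z : Fin n → unitInterval × unitInterval) : Prop :=
  ((v < (Z i).1 ∧ v < (Z i).2) ∨ ((Z i).1 = v ∧ (Z i).2 = v)) ∧
    ∀ j, j ≠ i → (Z j).1 ≤ v ∧ (Z j).2 ≤ v

theorem dominant_signSwap (i : Fin n) (v : unitInterval) (e : Fin n → Bool)
    (Z : Fin n → unitInterval × unitInterval) : Dominant i v (signSwap e Z) ↔ Dominant i v Z := by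
  unfold Dominant signSwap
  refine and_congr ?_ (forall₂_congr fun j _ => ?_)
  · cases e i <;> simp [and_comm]
  · cases e j <;> simp [and_comm]

theorem supExcept_congr {i : Fin n} {x y : Fin n → unitInterval} (h : ∀ j, j ≠ i → x j = y j) :
    supExcept i x = supExcept i y :=
  Finset.sup_congr rfl fun j hj => h j (Finset.ne_of_mem_erase hj)

open Classical in
-- For a position `i` holding the overall maximum, the swaps of nothing, of `i`, of everything else
-- and of everything produce the four placements of `two_le_sum_winCountAt`. The index `i` must not
-- depend on `e`, so that averaging over `e` remains possible.
theorem two_le_sum_pairCount [NeZero n] (i₀ : Fin n) (v : unitInterval) :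
    ∀ Z : Fin n → unitInterval × unitInterval, ∃ i : Fin n, ∀ e : Fin n → Bool,
    2 + 2 * (if Dominant i₀ v Z then 1 else 0) ≤
      pairCount (signSwap e Z) + pairCount (signSwap (fun j => xor (e j) (decide (j = i))) Z) +
      pairCount (signSwap (fun j => xor (e j) (decide (j ≠ i))) Z) +
      pairCount (signSwap (fun j => xor (e j) true) Z) := by
  intro Z
  -- On the dominant event `i₀` itself holds the maximum and is chosen even under ties, since the
  -- surplus is tied to this position.
  have hex : ∃ i, (∀ j, max (Z j).1 (Z j).2 ≤ max (Z i).1 (Z i).2) ∧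
      (Dominant i₀ v Z → i = i₀) := by
    by_cases hD : Dominant i₀ v Z
    · refine ⟨i₀, fun j => ?_, fun _ => rfl⟩
      by_cases hj : j = i₀
      · rw [hj]
      · refine (max_le (hD.2 j hj).1 (hD.2 j hj).2).trans ?_
        rcases hD.1 with h | h
        · exact le_max_of_le_left h.1.le
        · exact le_max_of_le_left h.1.ge
    · obtain ⟨i, -, hi⟩ := Finset.exists_max_image (Finset.univ : Finset (Fin n))
        (fun j => max (Z j).1 (Z j).2) Finset.univ_nonempty
      exact ⟨i, fun j => hi j (Finset.mem_univ j), fun h => absurd h hD⟩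
  obtain ⟨i, htop, hi₀⟩ := hex
  refine ⟨i, fun e => ?_⟩
  set Y := signSwap e Z with hY
  have hmax : ∀ j, max (Y j).1 (Y j).2 = max (Z j).1 (Z j).2 := by
    intro j
    simp only [hY, signSwap]
    cases e j <;> simp [max_comm]
  have hle : max (supExcept i fun j => (Y j).1) (supExcept i fun j => (Y j).2) ≤
      max (Y i).1 (Y i).2 := by
    refine max_le (Finset.sup_le fun j _ => ?_) (Finset.sup_le fun j _ => ?_)
    · exact (le_max_left _ _).trans ((hmax j).trans_le ((htop j).trans_eq (hmax i).symm))
    · exact (le_max_right _ _).trans ((hmax j).trans_le ((htop j).trans_eq (hmax i).symm))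
  have key := two_le_sum_winCountAt hle
  have hK : (if Dominant i₀ v Z then (1 : ℝ) else 0) ≤
      if (Y i).1 = (Y i).2 ∨ max (supExcept i fun j => (Y j).1) (supExcept i fun j => (Y j).2) <
        min (Y i).1 (Y i).2 then 1 else 0 := by
    by_cases hD : Dominant i₀ v Z
    · obtain rfl := hi₀ hD
      have hD' := (dominant_signSwap i v e Z).2 hD
      rw [← hY] at hD'
      rw [if_pos hD, if_pos]
      rcases hD'.1 with h | h
      · right
        have hv : ∀ f : unitInterval × unitInterval → unitInterval, (∀ j, j ≠ i → f (Y j) ≤ v) →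
            supExcept i (fun j => f (Y j)) ≤ v := fun f hf =>
          Finset.sup_le fun j hj => hf j (Finset.ne_of_mem_erase hj)
        exact (max_le (hv Prod.fst fun j hj => (hD'.2 j hj).1)
          (hv Prod.snd fun j hj => (hD'.2 j hj).2)).trans_lt (lt_min h.1 h.2)
      · exact Or.inl (h.1.trans h.2.symm)
    · rw [if_neg hD]
      split_ifs <;> norm_num
  have b0 : winCountAt (Y i).1 (Y i).2 (supExcept i fun j => (Y j).1)
      (supExcept i fun j => (Y j).2) ≤ pairCount Y :=
    winCountAt_le_winCount i (fun j => (Y j).1) fun j => (Y j).2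
  have hx : ∀ (g : Fin n → Bool) j, signSwap (fun j => xor (e j) (g j)) Z j =
      if g j then (Y j).swap else Y j := by
    intro g j
    simp only [hY, signSwap]
    rcases Bool.eq_false_or_eq_true (e j) with he | he <;>
      rcases Bool.eq_false_or_eq_true (g j) with hg | hg <;> simp [he, hg]
  have hbound : ∀ (g : Fin n → Bool),
      winCountAt (if g i then (Y i).swap else Y i).1 (if g i then (Y i).swap else Y i).2
        (supExcept i fun j => (if g j then (Y j).swap else Y j).1)
        (supExcept i fun j => (if g j then (Y j).swap else Y j).2) ≤
      pairCount (signSwap (fun j => xor (e j) (g j)) Z) := by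
    intro g
    simp_rw [← hx g]
    exact winCountAt_le_winCount i (fun j => (signSwap (fun j => xor (e j) (g j)) Z j).1)
      fun j => (signSwap (fun j => xor (e j) (g j)) Z j).2
  have b1 : winCountAt (Y i).2 (Y i).1 (supExcept i fun j => (Y j).1)
      (supExcept i fun j => (Y j).2) ≤
      pairCount (signSwap (fun j => xor (e j) (decide (j = i))) Z) := by
    refine le_trans (le_of_eq ?_) (hbound fun j => decide (j = i))
    congr 1
    · simp
    · simp
    · exact supExcept_congr fun j hj => by simp [hj]
    · exact supExcept_congr fun j hj => by simp [hj]
  have b2 : winCountAt (Y i).1 (Y i).2 (supExcept i fun j => (Y j).2)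
      (supExcept i fun j => (Y j).1) ≤
      pairCount (signSwap (fun j => xor (e j) (decide (j ≠ i))) Z) := by
    refine le_trans (le_of_eq ?_) (hbound fun j => decide (j ≠ i))
    congr 1
    · simp
    · simp
    · exact supExcept_congr fun j hj => by simp [hj]
    · exact supExcept_congr fun j hj => by simp [hj]
  have b3 := hbound fun _ => true
  simp only [if_true, Prod.fst_swap, Prod.snd_swap] at b3
  linarith

open Classical in
/-- Averaging over all exchanges between values and sample. -/
theorem sum_pairCount_ge [NeZero n] (i₀ : Fin n) (v : unitInterval)
    (Z : Fin n → unitInterval × unitInterval) :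
    2 ^ n * (1 / 2 + 1 / 2 * (if Dominant i₀ v Z then 1 else 0)) ≤
      ∑ e : Fin n → Bool, pairCount (signSwap e Z) := by
  obtain ⟨i, hi⟩ := two_le_sum_pairCount i₀ v Z
  -- For fixed `g`, taking `xor` with `g` permutes the swap patterns, so all four sums over `e`
  -- coincide and the bound `2 + 2·𝟙` is divided by four.
  have hshift : ∀ g : Fin n → Bool,
      ∑ e : Fin n → Bool, pairCount (signSwap (fun j => xor (e j) (g j)) Z) =
      ∑ e : Fin n → Bool, pairCount (signSwap e Z) := by
    intro g
    have hinv : Function.Involutive fun (e : Fin n → Bool) j => xor (e j) (g j) := fun e => by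
      funext j
      simp
    exact Fintype.sum_bijective _ hinv.bijective
      (fun e => pairCount (signSwap (fun j => xor (e j) (g j)) Z))
      (fun e => pairCount (signSwap e Z)) fun e => rfl
  have hsum := Finset.sum_le_sum fun (e : Fin n → Bool) (_ : e ∈ Finset.univ) => hi e
  rw [Finset.sum_const, Finset.card_univ, Fintype.card_fun, Fintype.card_bool, Fintype.card_fin,
    nsmul_eq_mul, Finset.sum_add_distrib, Finset.sum_add_distrib, Finset.sum_add_distrib,
    hshift fun j => decide (j = i), hshift fun j => decide (j ≠ i), hshift fun _ => true] at hsum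
  push_cast at hsum
  linarith

end Baseline

end

end OptStop

namespace OptStop

noncomputable section

open MeasureTheory

/-! ### Winning probability of the single-sample rule -/

section BaselineValue

variable {n : ℕ}

theorem measurableSet_strictWin :
    MeasurableSet {q : (Fin n → unitInterval) × unitInterval | StrictWin q.1 q.2} := by
  have hx : ∀ j, Measurable fun q : (Fin n → unitInterval) × unitInterval => q.1 j :=
    fun j => (measurable_pi_apply j).comp measurable_fst
  have : {q : (Fin n → unitInterval) × unitInterval | StrictWin q.1 q.2} =
      ⋃ i, ({q | q.2 < q.1 i} ∩ ⋂ j, ⋂ (_ : j ≠ i), {q | q.1 j ≤ q.2}) := by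
    ext q
    simp only [StrictWin, Set.mem_ofPred_eq, Set.mem_iUnion, Set.mem_inter_iff, Set.mem_iInter]
  rw [this]
  exact MeasurableSet.iUnion fun i => (measurableSet_lt measurable_snd (hx i)).inter
    (MeasurableSet.iInter fun j => MeasurableSet.iInter fun _ =>
      measurableSet_le (hx j) measurable_snd)

theorem measurableSet_weakWin :
    MeasurableSet {q : (Fin n → unitInterval) × unitInterval | WeakWin q.1 q.2} := by
  have hx : ∀ j, Measurable fun q : (Fin n → unitInterval) × unitInterval => q.1 j :=
    fun j => (measurable_pi_apply j).comp measurable_fst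
  have : {q : (Fin n → unitInterval) × unitInterval | WeakWin q.1 q.2} =
      {q | Finset.univ.sup q.1 = q.2} ∪
      ⋃ i, ({q | q.2 < q.1 i} ∩ ⋂ j, ⋂ (_ : j ≠ i), {q | q.1 j < q.2}) := by
    ext q
    simp only [WeakWin, Set.mem_ofPred_eq, Set.mem_iUnion, Set.mem_inter_iff, Set.mem_iInter,
      Set.mem_union]
  rw [this]
  exact (measurableSet_eq_fun (measurable_sup_univ.comp measurable_fst) measurable_snd).union
    (MeasurableSet.iUnion fun i => (measurableSet_lt measurable_snd (hx i)).inter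
    (MeasurableSet.iInter fun j => MeasurableSet.iInter fun _ =>
      measurableSet_lt (hx j) measurable_snd))

theorem measurable_winCount : Measurable fun q : (Fin n → unitInterval) × (Fin n → unitInterval) =>
    winCount q.1 q.2 := by
  have hs : Measurable fun q : (Fin n → unitInterval) × (Fin n → unitInterval) =>
      (q.1, Finset.univ.sup q.2) :=
    measurable_fst.prodMk (measurable_sup_univ.comp measurable_snd)
  exact (Measurable.ite (hs measurableSet_strictWin) measurable_const measurable_const).add
    (Measurable.ite (hs measurableSet_weakWin) measurable_const measurable_const)

theorem winCount_mem (x x' : Fin n → unitInterval) : winCount x x' ∈ Set.Icc (0 : ℝ) 2 := by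
  unfold winCount
  constructor <;> split_ifs <;> norm_num

variable (𝔻 : Distributions n)

/-- The law of the pairs formed by the values of two independent rounds. -/
def Distributions.pairs : Measure (Fin n → unitInterval × unitInterval) :=
  Measure.pi fun i => (𝔻.dist i : Measure unitInterval).prod (𝔻.dist i : Measure unitInterval)

instance : IsProbabilityMeasure 𝔻.pairs := by
  unfold Distributions.pairs; infer_instance

theorem measurableSet_dominant (i : Fin n) (v : unitInterval) :
    MeasurableSet {Z | Dominant i v Z} := by
  have h1 : ∀ j, Measurable fun Z : Fin n → unitInterval × unitInterval => (Z j).1 :=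
    fun j => measurable_fst.comp (measurable_pi_apply j)
  have h2 : ∀ j, Measurable fun Z : Fin n → unitInterval × unitInterval => (Z j).2 :=
    fun j => measurable_snd.comp (measurable_pi_apply j)
  have : {Z | Dominant i v Z} = (({Z | v < (Z i).1} ∩ {Z | v < (Z i).2}) ∪
      ({Z | (Z i).1 = v} ∩ {Z | (Z i).2 = v})) ∩
      ⋂ j, ⋂ (_ : j ≠ i), ({Z | (Z j).1 ≤ v} ∩ {Z | (Z j).2 ≤ v}) := by
    ext Z
    simp only [Dominant, Set.mem_ofPred_eq, Set.mem_inter_iff, Set.mem_iInter, Set.mem_union]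
  rw [this]
  exact (((measurableSet_lt measurable_const (h1 i)).inter
    (measurableSet_lt measurable_const (h2 i))).union
    ((measurableSet_eq_fun (h1 i) measurable_const).inter
    (measurableSet_eq_fun (h2 i) measurable_const))).inter
    (MeasurableSet.iInter fun j => MeasurableSet.iInter fun _ =>
      (measurableSet_le (h1 j) measurable_const).inter (measurableSet_le (h2 j) measurable_const))

/-- Swapping the two rounds at any set of labels preserves the law of the pairs, so the pointwise
average over swaps transfers to the expectation. -/
theorem integral_winCount_ge [NeZero n] (i₀ : Fin n) (v : unitInterval) :
    1 / 2 + 1 / 2 * 𝔻.pairs.real {Z | Dominant i₀ v Z} ≤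
      ∫ q, winCount q.1 q.2 ∂(𝔻.values.prod 𝔻.values) := by
  classical
  have hmp := measurePreserving_arrowProdEquivProdArrow unitInterval unitInterval (Fin n)
    (fun i => (𝔻.dist i : Measure unitInterval)) (fun i => (𝔻.dist i : Measure unitInterval))
  have h1 : ∫ Z, pairCount Z ∂𝔻.pairs = ∫ q, winCount q.1 q.2 ∂(𝔻.values.prod 𝔻.values) :=
    integral_comp_measurePreserving hmp measurable_winCount
  have hm : Measurable (pairCount (n := n)) :=
    measurable_winCount.comp hmp.measurable
  have hsw : ∀ e, ∫ Z, pairCount (signSwap e Z) ∂𝔻.pairs = ∫ Z, pairCount Z ∂𝔻.pairs := fun e =>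
    integral_comp_measurePreserving
      (measurePreserving_signSwap (fun i => (𝔻.dist i : Measure unitInterval)) e) hm
  have hint : ∀ e, Integrable (fun Z => pairCount (signSwap e Z)) 𝔻.pairs := fun e =>
    integrable_of_mem_Icc (hm.comp
      (measurePreserving_signSwap (fun i => (𝔻.dist i : Measure unitInterval)) e).measurable)
      fun Z => winCount_mem _ _
  have hD : Integrable ({Z | Dominant i₀ v Z}.indicator (1 : (Fin n → unitInterval × unitInterval) → ℝ)) 𝔻.pairs :=
    (integrable_const (1 : ℝ)).indicator (measurableSet_dominant i₀ v)
  have hsum : ∫ Z, 2 ^ n * (1 / 2 + 1 / 2 * {Z | Dominant i₀ v Z}.indicator (1 : (Fin n → unitInterval × unitInterval) → ℝ) Z) ∂𝔻.pairs ≤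
      ∫ Z, ∑ e : Fin n → Bool, pairCount (signSwap e Z) ∂𝔻.pairs := by
    refine integral_mono (((integrable_const _).add (hD.const_mul _)).const_mul _)
      (integrable_finsetSum _ fun e _ => hint e) fun Z => ?_
    refine le_trans (le_of_eq ?_) (sum_pairCount_ge i₀ v Z)
    simp only [Set.indicator_apply, Set.mem_ofPred_eq, Pi.one_apply]
  rw [integral_finsetSum _ fun e _ => hint e] at hsum
  simp_rw [hsw] at hsum
  rw [integral_const_mul, integral_add (integrable_const _) (hD.const_mul _), integral_const_mul,
    integral_indicator_one (measurableSet_dominant i₀ v), Finset.sum_const, nsmul_eq_mul,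
    Finset.card_univ, Fintype.card_fun, Fintype.card_bool, Fintype.card_fin, Nat.cast_pow,
    Nat.cast_ofNat] at hsum
  have := le_of_mul_le_mul_left hsum (by positivity)
  rw [h1] at this
  simpa using this

theorem pairs_real_box (i₀ : Fin n) (v : unitInterval) (S : Set unitInterval) :
    𝔻.pairs.real {Z | ((Z i₀).1 ∈ S ∧ (Z i₀).2 ∈ S) ∧ ∀ j, j ≠ i₀ → (Z j).1 ≤ v ∧ (Z j).2 ≤ v} =
      (𝔻.dist i₀ : Measure unitInterval).real S ^ 2 *
        (∏ j ∈ Finset.univ.erase i₀, (𝔻.dist j : Measure unitInterval).real (Set.Iic v)) ^ 2 := by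
  classical
  have hset : {Z : Fin n → unitInterval × unitInterval | ((Z i₀).1 ∈ S ∧ (Z i₀).2 ∈ S) ∧
      ∀ j, j ≠ i₀ → (Z j).1 ≤ v ∧ (Z j).2 ≤ v} =
      Set.univ.pi fun j => if j = i₀ then S ×ˢ S else Set.Iic v ×ˢ Set.Iic v := by
    ext Z
    simp only [Set.mem_ofPred_eq, Set.mem_univ_pi]
    constructor
    · rintro ⟨h1, h2⟩ j
      by_cases hj : j = i₀
      · rw [if_pos hj, hj]; exact h1
      · rw [if_neg hj]; exact h2 j hj
    · intro h
      refine ⟨Set.mem_prod.1 (by simpa only [if_true] using h i₀), fun j hj => ?_⟩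
      have := h j
      rw [if_neg hj] at this
      exact this
  rw [hset, measureReal_def, Distributions.pairs, Measure.pi_pi, ENNReal.toReal_prod,
    ← Finset.mul_prod_erase _ _ (Finset.mem_univ i₀), if_pos rfl, Measure.prod_prod,
    ENNReal.toReal_mul, ← pow_two, ← Finset.prod_pow]
  congr 1
  refine Finset.prod_congr rfl fun j hj => ?_
  rw [if_neg (Finset.ne_of_mem_erase hj), Measure.prod_prod, ENNReal.toReal_mul, ← pow_two]
  rfl

/-- Let `v` be a median of the maximum. All values are at most `v` with probability at least `1/2`,
and by a union bound some label reaches `v` with probability at least `1/(2n)`. Either half of that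
mass lies strictly above `v`, or half of it sits on `v`; these are the two alternatives in
`Dominant`. -/
theorem exists_dominant [NeZero n] : ∃ (i₀ : Fin n) (v : unitInterval),
    1 / (64 * (n : ℝ) ^ 2) ≤ 𝔻.pairs.real {Z | Dominant i₀ v Z} := by
  have hn : (0 : ℝ) < n := by exact_mod_cast Nat.pos_of_ne_zero (NeZero.ne n)
  have : IsProbabilityMeasure (𝔻.values.map fun x => Finset.univ.sup x) :=
    Measure.isProbabilityMeasure_map measurable_sup_univ.aemeasurable
  obtain ⟨v, hv1, hv2⟩ := exists_median (𝔻.values.map fun x => Finset.univ.sup x)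
  rw [Measure.map_apply measurable_sup_univ measurableSet_Iio] at hv1
  rw [Measure.map_apply measurable_sup_univ measurableSet_Ioi] at hv2
  have half : (1 / 2 : ENNReal).toReal = 1 / 2 := by simp
  have hprod : 1 / 2 ≤ ∏ j, (𝔻.dist j : Measure unitInterval).real (Set.Iic v) := by
    have h1 : ((fun x : Fin n → unitInterval => Finset.univ.sup x) ⁻¹' Set.Ioi v)ᶜ =
        Set.univ.pi fun _ => Set.Iic v := by
      ext x
      simp only [Set.mem_compl_iff, Set.mem_preimage, Set.mem_Ioi, not_lt, Finset.sup_le_iff,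
        Finset.mem_univ, true_imp_iff, Set.mem_univ_pi, Set.mem_Iic]
    have h2 := probReal_compl_eq_one_sub (μ := 𝔻.values)
      (measurable_sup_univ (measurableSet_Ioi (a := v)))
    rw [h1] at h2
    have h3 : 𝔻.values.real ((fun x : Fin n → unitInterval => Finset.univ.sup x) ⁻¹' Set.Ioi v) ≤
        1 / 2 := by
      rw [← half]
      exact ENNReal.toReal_mono (by simp) hv2
    have h4 : 𝔻.values.real (Set.univ.pi fun _ => Set.Iic v) =
        ∏ j, (𝔻.dist j : Measure unitInterval).real (Set.Iic v) := by
      rw [measureReal_def, Distributions.values, Measure.pi_pi, ENNReal.toReal_prod]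
      rfl
    rw [← h4, h2]
    linarith
  obtain ⟨i₀, hi₀⟩ : ∃ i, 1 / (2 * (n : ℝ)) ≤ (𝔻.dist i : Measure unitInterval).real (Set.Ici v) := by
    by_contra hcon
    push Not at hcon
    have h1 : ((fun x : Fin n → unitInterval => Finset.univ.sup x) ⁻¹' Set.Iio v)ᶜ ⊆
        ⋃ i, Function.eval i ⁻¹' Set.Ici v := by
      intro x hx
      obtain ⟨i, -, hi⟩ := Finset.exists_max_image (Finset.univ : Finset (Fin n)) x
        Finset.univ_nonempty
      refine Set.mem_iUnion.2 ⟨i, ?_⟩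
      have : v ≤ Finset.univ.sup x := not_lt.1 hx
      exact this.trans (Finset.sup_le fun j _ => hi j (Finset.mem_univ j))
    have h2 := probReal_compl_eq_one_sub (μ := 𝔻.values)
      (measurable_sup_univ (measurableSet_Iio (a := v)))
    have h3 : 𝔻.values.real ((fun x : Fin n → unitInterval => Finset.univ.sup x) ⁻¹' Set.Iio v) ≤
        1 / 2 := by
      rw [← half]
      exact ENNReal.toReal_mono (by simp) hv1
    have h4 : ∀ i, 𝔻.values.real (Function.eval i ⁻¹' Set.Ici v) =
        (𝔻.dist i : Measure unitInterval).real (Set.Ici v) := fun i =>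
      (measurePreserving_eval (fun i => (𝔻.dist i : Measure unitInterval)) i).measureReal_preimage
        measurableSet_Ici.nullMeasurableSet
    have h5 : 𝔻.values.real ((fun x : Fin n → unitInterval => Finset.univ.sup x) ⁻¹' Set.Iio v)ᶜ ≤
        ∑ i, (𝔻.dist i : Measure unitInterval).real (Set.Ici v) := by
      refine (measureReal_mono h1).trans ?_
      simp_rw [← h4]
      exact measureReal_iUnion_fintype_le _
    have h6 : ∑ i, (𝔻.dist i : Measure unitInterval).real (Set.Ici v) < ∑ _i : Fin n, 1 / (2 * (n : ℝ)) :=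
      Finset.sum_lt_sum_of_nonempty Finset.univ_nonempty fun i _ => hcon i
    have h7 : ∑ _i : Fin n, 1 / (2 * (n : ℝ)) = 1 / 2 := by
      rw [Finset.sum_const, Finset.card_univ, Fintype.card_fin, nsmul_eq_mul]
      field_simp
    linarith
  have herase : 1 / 2 ≤
      ∏ j ∈ Finset.univ.erase i₀, (𝔻.dist j : Measure unitInterval).real (Set.Iic v) := by
    rw [← Finset.mul_prod_erase _ _ (Finset.mem_univ i₀)] at hprod
    refine hprod.trans (mul_le_of_le_one_left ?_ measureReal_le_one)
    exact Finset.prod_nonneg fun j _ => measureReal_nonneg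
  have hbox : ∀ S : Set unitInterval, 1 / (4 * (n : ℝ)) ≤ (𝔻.dist i₀ : Measure unitInterval).real S →
      1 / (64 * (n : ℝ) ^ 2) ≤ 𝔻.pairs.real {Z | ((Z i₀).1 ∈ S ∧ (Z i₀).2 ∈ S) ∧
        ∀ j, j ≠ i₀ → (Z j).1 ≤ v ∧ (Z j).2 ≤ v} := by
    intro S hS
    rw [pairs_real_box]
    -- Both squares arise because the event must hold in two independent rounds.
    calc 1 / (64 * (n : ℝ) ^ 2) = (1 / (4 * (n : ℝ))) ^ 2 * (1 / 2) ^ 2 := by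
          field_simp; norm_num
      _ ≤ _ := by gcongr
  refine ⟨i₀, v, ?_⟩
  have hsplit : (𝔻.dist i₀ : Measure unitInterval).real (Set.Ici v) ≤
      (𝔻.dist i₀ : Measure unitInterval).real (Set.Ioi v) +
      (𝔻.dist i₀ : Measure unitInterval).real {v} := by
    rw [← Set.Ioi_union_left]
    exact measureReal_union_le _ _
  have h2n : 1 / (2 * (n : ℝ)) = 1 / (4 * n) + 1 / (4 * n) := by field_simp; norm_num
  rcases le_total (1 / (4 * (n : ℝ))) ((𝔻.dist i₀ : Measure unitInterval).real (Set.Ioi v)) with h | h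
  · refine (hbox _ h).trans (measureReal_mono fun Z hZ => ⟨Or.inl hZ.1, hZ.2⟩)
  · refine (hbox {v} (by linarith)).trans (measureReal_mono fun Z hZ => ⟨Or.inr hZ.1, hZ.2⟩)

/-- Expected profit of accepting the first value beyond `θ`. -/
def thresholdValue (strict : Bool) (θ : unitInterval) : ℝ :=
  ∫ ω, profit (bestChoice n) (constThreshold n strict θ) ω ∂𝔻.law

theorem measurableFamily_constThreshold (strict : Bool) :
    MeasurableFamily fun θ : unitInterval => constThreshold n strict θ := by
  intro i σ
  refine measurable_to_bool ?_
  have hx : Measurable fun q : unitInterval × (Fin (i.val + 1) → unitInterval) =>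
      q.2 (Fin.last i.val) := (measurable_pi_apply _).comp measurable_snd
  cases strict
  · have : (fun q : unitInterval × (Fin (i.val + 1) → unitInterval) =>
        (constThreshold n false q.1).accept i q.2 σ) ⁻¹' {true} =
        {q | q.1 ≤ q.2 (Fin.last i.val)} := by
      ext q; simp [constThreshold]
    rw [this]
    exact measurableSet_le measurable_fst hx
  · have : (fun q : unitInterval × (Fin (i.val + 1) → unitInterval) =>
        (constThreshold n true q.1).accept i q.2 σ) ⁻¹' {true} =
        {q | q.1 < q.2 (Fin.last i.val)} := by
      ext q; simp [constThreshold]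
    rw [this]
    exact measurableSet_lt measurable_fst hx

theorem thresholdValue_mem (strict : Bool) (θ : unitInterval) :
    thresholdValue 𝔻 strict θ ∈ Set.Icc (0 : ℝ) 1 := integral_profit_mem _ _

theorem measurable_thresholdValue (strict : Bool) : Measurable (thresholdValue 𝔻 strict) :=
  ((measurableFamily_constThreshold strict).measurable_profit.stronglyMeasurable.integral_prod_right'
    (ν := 𝔻.law)).measurable

theorem measurable_profit_arrange (a : OnlineAlg n) :
    Measurable fun q => profit (bestChoice n) a (arrange q) :=
  (measurable_profit a).comp measurable_arrange

/-- A win for every `τ` bounds the profit under any order law, which is how the general order model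
gets the same constant `1/4`. -/
theorem real_le_thresholdValue {strict : Bool} {θ : unitInterval} {S : Set (Fin n → unitInterval)}
    (hS : MeasurableSet S) (h : ∀ y ∈ S, ∀ τ, 
      profit (bestChoice n) (constThreshold n strict θ) (arrange (y, τ)) = 1) :
    𝔻.values.real S ≤ thresholdValue 𝔻 strict θ := by
  have hm := measurable_profit_arrange (constThreshold n strict θ)
  have h1 : thresholdValue 𝔻 strict θ = ∫ q, profit (bestChoice n) (constThreshold n strict θ)
      (arrange q) ∂(𝔻.values.prod 𝔻.order.toMeasure) := by
    unfold thresholdValue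
    rw [Distributions.law_eq, integral_map measurable_arrange.aemeasurable
      (measurable_profit _).aestronglyMeasurable]
  have h2 : 𝔻.values.real S = ∫ q, (S ×ˢ Set.univ).indicator (1 : (Fin n → unitInterval) × Equiv.Perm (Fin n) → ℝ) q
      ∂(𝔻.values.prod 𝔻.order.toMeasure) := by
    rw [integral_indicator_one (hS.prod MeasurableSet.univ), measureReal_prod_prod]
    simp
  rw [h1, h2]
  refine integral_mono ((integrable_const (1 : ℝ)).indicator (hS.prod MeasurableSet.univ))
    (integrable_of_mem_Icc hm fun q => profit_mem _ _) fun q => ?_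
  by_cases hq : q.1 ∈ S
  · have := h q.1 hq q.2
    rw [Prod.mk.eta] at this
    simp [hq, this]
  · simp [hq, (profit_mem (constThreshold n strict θ) (arrange q)).1]

theorem integral_thresholdValue_add_ge [NeZero n] :
    1 / 2 + 1 / (128 * (n : ℝ) ^ 2) ≤
      ∫ ω, (thresholdValue 𝔻 true (Finset.univ.sup ω.1) +
        thresholdValue 𝔻 false (Finset.univ.sup ω.1)) ∂𝔻.law := by
  classical
  obtain ⟨i₀, v, hD⟩ := exists_dominant 𝔻
  have h1 := integral_winCount_ge 𝔻 i₀ v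
  have hV : Measurable fun θ => thresholdValue 𝔻 true θ + thresholdValue 𝔻 false θ :=
    (measurable_thresholdValue 𝔻 true).add (measurable_thresholdValue 𝔻 false)
  have h2 : ∫ ω, (thresholdValue 𝔻 true (Finset.univ.sup ω.1) +
        thresholdValue 𝔻 false (Finset.univ.sup ω.1)) ∂𝔻.law =
      ∫ y, (thresholdValue 𝔻 true (Finset.univ.sup y) +
        thresholdValue 𝔻 false (Finset.univ.sup y)) ∂𝔻.values := by
    have hm : Measurable fun ω : Outcome n => thresholdValue 𝔻 true (Finset.univ.sup ω.1) +
        thresholdValue 𝔻 false (Finset.univ.sup ω.1) :=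
      hV.comp (measurable_sup_univ.comp measurable_fst)
    have hm' : Measurable fun y : Fin n → unitInterval =>
        thresholdValue 𝔻 true (Finset.univ.sup y) + thresholdValue 𝔻 false (Finset.univ.sup y) :=
      hV.comp measurable_sup_univ
    rw [Distributions.law_eq, integral_map measurable_arrange.aemeasurable hm.aestronglyMeasurable,
      ← integral_comp_measurePreserving (measurePreserving_fst (μ := 𝔻.values)
        (ν := 𝔻.order.toMeasure)) hm']
    refine integral_congr_ae (Filter.Eventually.of_forall fun q => ?_)
    -- The sample enters only through its maximum, so the order of the sample round is irrelevant.
    have : Finset.univ.sup (arrange q).1 = Finset.univ.sup q.1 := sup_comp_perm q.1 q.2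
    simp only [this]
  have hle : ∀ x' : Fin n → unitInterval, ∫ x, winCount x x' ∂𝔻.values ≤
      thresholdValue 𝔻 true (Finset.univ.sup x') + thresholdValue 𝔻 false (Finset.univ.sup x') := by
    intro x'
    set θ := Finset.univ.sup x'
    have m1 : MeasurableSet {x : Fin n → unitInterval | StrictWin x θ} :=
      measurable_prodMk_right (y := θ) measurableSet_strictWin
    have m2 : MeasurableSet {x : Fin n → unitInterval | WeakWin x θ} :=
      measurable_prodMk_right (y := θ) measurableSet_weakWin
    have e1 := real_le_thresholdValue 𝔻 (strict := true) m1 fun y hy τ => profit_of_strictWin hy τ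
    have e2 := real_le_thresholdValue 𝔻 (strict := false) m2 fun y hy τ => profit_of_weakWin hy τ
    have e3 : ∀ x, winCount x x' = {x | StrictWin x θ}.indicator (1 : (Fin n → unitInterval) → ℝ) x +
        {x | WeakWin x θ}.indicator (1 : (Fin n → unitInterval) → ℝ) x := by
      intro x
      simp only [winCount, Set.indicator_apply, Set.mem_ofPred_eq, Pi.one_apply, θ]
    simp_rw [e3]
    have i1 : Integrable ({x | StrictWin x θ}.indicator (1 : (Fin n → unitInterval) → ℝ))
        𝔻.values := (integrable_const (1 : ℝ)).indicator m1
    have i2 : Integrable ({x | WeakWin x θ}.indicator (1 : (Fin n → unitInterval) → ℝ))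
        𝔻.values := (integrable_const (1 : ℝ)).indicator m2
    rw [integral_add i1 i2, integral_indicator_one m1,
      integral_indicator_one m2]
    exact add_le_add e1 e2
  have hint : Integrable (fun q : (Fin n → unitInterval) × (Fin n → unitInterval) =>
      winCount q.1 q.2) (𝔻.values.prod 𝔻.values) :=
    integrable_of_mem_Icc measurable_winCount fun q => winCount_mem _ _
  rw [integral_prod_symm _ hint] at h1
  rw [h2]
  have h3 : ∫ x', ∫ x, winCount x x' ∂𝔻.values ∂𝔻.values ≤
      ∫ y, (thresholdValue 𝔻 true (Finset.univ.sup y) +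
        thresholdValue 𝔻 false (Finset.univ.sup y)) ∂𝔻.values := by
    refine integral_mono hint.integral_prod_right (integrable_of_mem_Icc (a := 0) (b := 2)
      (hV.comp measurable_sup_univ) fun y => ?_) hle
    have a1 := thresholdValue_mem 𝔻 true (Finset.univ.sup y)
    have a2 := thresholdValue_mem 𝔻 false (Finset.univ.sup y)
    exact ⟨by linarith [a1.1, a2.1], by linarith [a1.2, a2.2]⟩
  have h4 : 1 / (128 * (n : ℝ) ^ 2) = 1 / 2 * (1 / (64 * (n : ℝ) ^ 2)) := by
    rw [div_mul_div_comm]; ring_nf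
  rw [h4]
  linarith

/-- Without atoms no value equals `θ` almost surely, so both comparisons stop at the same step and
every tie rule acts like a fair coin. -/
theorem thresholdValue_eq_of_atomless (h : 𝔻.Atomless) (θ : unitInterval) :
    thresholdValue 𝔻 true θ = thresholdValue 𝔻 false θ := by
  have hae : ∀ᵐ ω ∂𝔻.law, ∀ i, ω.1 i ≠ θ := by
    have h1 : ∀ᵐ y ∂𝔻.values, ∀ i, y i ≠ θ := by
      rw [ae_all_iff]
      intro i
      have h2 : ∀ᵐ z ∂(𝔻.dist i : Measure unitInterval), z ≠ θ := by
        rw [ae_iff]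
        simpa using h i θ
      exact (measurePreserving_eval (fun i => (𝔻.dist i : Measure unitInterval))
        i).quasiMeasurePreserving.ae h2
    have h3 : ∀ᵐ q ∂(𝔻.values.prod 𝔻.order.toMeasure), ∀ i, q.1 i ≠ θ :=
      Measure.quasiMeasurePreserving_fst.ae h1
    have hms : MeasurableSet {ω : Outcome n | ∀ i, ω.1 i ≠ θ} := by
      have : {ω : Outcome n | ∀ i, ω.1 i ≠ θ} = ⋂ i, {ω | ω.1 i = θ}ᶜ := by
        ext ω; simp
      rw [this]
      exact MeasurableSet.iInter fun i => (measurableSet_eq_fun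
        ((measurable_pi_apply i).comp measurable_fst) measurable_const).compl
    rw [Distributions.law_eq, ae_map_iff measurable_arrange.aemeasurable hms]
    filter_upwards [h3] with q hq i
    exact hq _
  refine integral_congr_ae ?_
  filter_upwards [hae] with ω hω
  have : stopIndex (constThreshold n true θ) ω = stopIndex (constThreshold n false θ) ω := by
    refine stopIndex_congr fun i => ?_
    rw [accepts_constThreshold, accepts_constThreshold, if_pos rfl, if_neg (by simp)]
    exact ⟨le_of_lt, fun hle => lt_of_le_of_ne hle (hω i).symm⟩
  unfold profit
  rw [this]

/-- The single-sample rule wins with probability slightly more than `1 / 4`. -/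
theorem integral_baseline_ge [NeZero n] {tie : PMF Bool}
    (h : tie = PMF.uniformOfFintype Bool ∨ 𝔻.Atomless) :
    1 / 4 + 1 / (256 * (n : ℝ) ^ 2) ≤
      ∫ ω, ∑ b, (tie b).toReal * thresholdValue 𝔻 b (Finset.univ.sup ω.1) ∂𝔻.law := by
  have h1 := integral_thresholdValue_add_ge 𝔻
  have h2 : ∀ θ, ∑ b, (tie b).toReal * thresholdValue 𝔻 b θ =
      1 / 2 * (thresholdValue 𝔻 true θ + thresholdValue 𝔻 false θ) := by
    intro θ
    rcases h with rfl | h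
    · simp [PMF.uniformOfFintype_apply]
      ring
    · have hs := sum_toReal_pmf tie
      rw [Fintype.sum_bool] at hs ⊢
      rw [thresholdValue_eq_of_atomless 𝔻 h θ, ← add_mul, hs]
      ring
  simp_rw [h2]
  rw [integral_const_mul]
  have h3 : 1 / (256 * (n : ℝ) ^ 2) = 1 / 2 * (1 / (128 * (n : ℝ) ^ 2)) := by
    rw [div_mul_div_comm]; ring_nf
  rw [h3]
  linarith

end BaselineValue

end

end OptStop

namespace OptStop

noncomputable section

open MeasureTheory

/-! ### Analysis of the switching rule -/

section SwitchingAnalysis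

variable {Ω J : Type*} [Fintype J]

/-- Mean of `f` over a test sample. -/
def sampleMean (f : Ω → ℝ) (t : J → Ω) : ℝ := (∑ j, f (t j)) / Fintype.card J

theorem sampleMean_le_one {f : Ω → ℝ} (hf : ∀ ω, f ω ∈ Set.Icc (0 : ℝ) 1) (t : J → Ω) :
    sampleMean f t ≤ 1 := by
  refine div_le_one_of_le₀ ?_ (Nat.cast_nonneg _)
  calc ∑ j, f (t j) ≤ ∑ _j : J, (1 : ℝ) := Finset.sum_le_sum fun j _ => (hf _).2
    _ = Fintype.card J := by simp

variable [MeasurableSpace Ω] (ν : Measure Ω) [IsProbabilityMeasure ν]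

theorem measurable_sampleMean {f : Ω → ℝ} (hf : Measurable f) :
    Measurable (sampleMean (J := J) f) :=
  (Finset.measurable_sum _ fun j _ => hf.comp (measurable_pi_apply j)).div_const _

variable {u w : Ω → ℝ} {ε δ : ℝ}

theorem integral_ite_eq (C : Set (J → Ω)) [DecidablePred (· ∈ C)] (hC : MeasurableSet C)
    (a b : ℝ) : ∫ t, (if t ∈ C then a else b) ∂(Measure.pi fun _ : J => ν) =
      b + (Measure.pi fun _ : J => ν).real C * (a - b) := by
  have h : ∀ t, (if t ∈ C then a else b) = b + C.indicator (1 : (J → Ω) → ℝ) t * (a - b) := by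
    intro t
    by_cases ht : t ∈ C <;> simp [ht]
  simp_rw [h]
  have hi : Integrable (fun t => C.indicator (1 : (J → Ω) → ℝ) t * (a - b))
      (Measure.pi fun _ : J => ν) := ((integrable_const (1 : ℝ)).indicator hC).mul_const _
  rw [integral_add (integrable_const _) hi, integral_mul_const, integral_indicator_one hC]
  simp

/-- The event that the test sample certifies `w` to be better than `u`. -/
def certified (u w : Ω → ℝ) (ε δ : ℝ) : Set (J → Ω) :=
  {t | sampleMean u t + ε + δ ≤ (1 - δ) * (sampleMean w t - ε)}

theorem measurableSet_certified (hu : Measurable u) (hw : Measurable w) :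
    MeasurableSet (certified (J := J) u w ε δ) :=
  measurableSet_le (((measurable_sampleMean hu).add_const _).add_const _)
    (((measurable_sampleMean hw).sub_const _).const_mul _)

theorem real_union_deviation_le {f g : Ω → ℝ} (hf : Measurable f) (hg : Measurable g)
    (hfb : ∀ ω, f ω ∈ Set.Icc (0 : ℝ) 1) (hgb : ∀ ω, g ω ∈ Set.Icc (0 : ℝ) 1)
    (hJ : 0 < Fintype.card J) (hε : 0 ≤ ε) {A : Set (J → Ω)}
    (hA : A ⊆ {t | sampleMean f t ≤ ∫ ω, f ω ∂ν - ε} ∪ {t | ∫ ω, g ω ∂ν + ε ≤ sampleMean g t}) :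
    (Measure.pi fun _ : J => ν).real A ≤ 2 * Real.exp (-(2 * Fintype.card J * ε ^ 2)) := by
  refine (measureReal_mono hA).trans ((measureReal_union_le _ _).trans ?_)
  have h1 := hoeffding_lower (ν := ν) hf hfb hJ hε
  have h2 := hoeffding_upper (ν := ν) hg hgb hJ hε
  unfold sampleMean
  linarith

open Classical in
-- Switching can hurt only if `w` is worse than `u`. If both test means were within `ε`,
-- certification would give `U + δ < (1 - δ)W ≤ W`, a contradiction. So a harmful switch needs a
-- Hoeffding deviation, and it costs at most one.
theorem le_integral_switch_of_baseline (hu : Measurable u) (hw : Measurable w)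
    (hub : ∀ ω, u ω ∈ Set.Icc (0 : ℝ) 1) (hwb : ∀ ω, w ω ∈ Set.Icc (0 : ℝ) 1)
    (hJ : 0 < Fintype.card J) (hε : 0 ≤ ε) (hδ : 0 ≤ δ) (hδ1 : δ ≤ 1) :
    ∫ ω, u ω ∂ν - 2 * Real.exp (-(2 * Fintype.card J * ε ^ 2)) ≤
      ∫ t, (if t ∈ certified u w ε δ then ∫ ω, w ω ∂ν else ∫ ω, u ω ∂ν)
        ∂(Measure.pi fun _ : J => ν) := by
  rw [integral_ite_eq ν _ (measurableSet_certified hu hw)]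
  have hU : ∫ ω, u ω ∂ν ∈ Set.Icc (0 : ℝ) 1 := integral_mem_Icc hub
  have hW : ∫ ω, w ω ∂ν ∈ Set.Icc (0 : ℝ) 1 := integral_mem_Icc hwb
  set U := ∫ ω, u ω ∂ν
  set W := ∫ ω, w ω ∂ν
  have hP0 : 0 ≤ (Measure.pi fun _ : J => ν).real (certified u w ε δ) := measureReal_nonneg
  have he := Real.exp_pos (-(2 * Fintype.card J * ε ^ 2))
  rcases le_or_gt U W with h | h
  · have := mul_nonneg hP0 (sub_nonneg.2 h)
    linarith
  · have hP := real_union_deviation_le ν hu hw hub hwb hJ hε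
      (A := certified (J := J) u w ε δ) (by
        intro t ht
        have ht' : sampleMean u t + ε + δ ≤ (1 - δ) * (sampleMean w t - ε) := ht
        by_contra hcon
        simp only [Set.mem_union, Set.mem_ofPred_eq, not_or, not_le] at hcon
        have h1 : (1 - δ) * (sampleMean w t - ε) ≤ (1 - δ) * W :=
          mul_le_mul_of_nonneg_left (by linarith [hcon.2]) (by linarith)
        have h2 : δ * W ≥ 0 := mul_nonneg hδ hW.1
        nlinarith [hcon.1])
    have h3 : (Measure.pi fun _ : J => ν).real (certified u w ε δ) * (U - W) ≤
        (Measure.pi fun _ : J => ν).real (certified u w ε δ) * 1 :=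
      mul_le_mul_of_nonneg_left (by linarith [hU.2, hW.1]) hP0
    linarith

open Classical in
-- If `U` is within `4ε + 2δ` of `W`, either choice is good enough. Otherwise the gap exceeds the
-- margin of the test, so failing to certify needs a Hoeffding deviation.
theorem le_integral_switch_of_optimizer (hu : Measurable u) (hw : Measurable w)
    (hub : ∀ ω, u ω ∈ Set.Icc (0 : ℝ) 1) (hwb : ∀ ω, w ω ∈ Set.Icc (0 : ℝ) 1)
    (hJ : 0 < Fintype.card J) (hε : 0 ≤ ε) (hδ : 0 ≤ δ) :
    ∫ ω, w ω ∂ν - 4 * ε - 2 * δ - 2 * Real.exp (-(2 * Fintype.card J * ε ^ 2)) ≤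
      ∫ t, (if t ∈ certified u w ε δ then ∫ ω, w ω ∂ν else ∫ ω, u ω ∂ν)
        ∂(Measure.pi fun _ : J => ν) := by
  rw [integral_ite_eq ν _ (measurableSet_certified hu hw)]
  have hU : ∫ ω, u ω ∂ν ∈ Set.Icc (0 : ℝ) 1 := integral_mem_Icc hub
  have hW : ∫ ω, w ω ∂ν ∈ Set.Icc (0 : ℝ) 1 := integral_mem_Icc hwb
  set U := ∫ ω, u ω ∂ν
  set W := ∫ ω, w ω ∂ν
  have hP0 : 0 ≤ (Measure.pi fun _ : J => ν).real (certified u w ε δ) := measureReal_nonneg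
  have hP1 : (Measure.pi fun _ : J => ν).real (certified u w ε δ) ≤ 1 := measureReal_le_one
  have he := Real.exp_pos (-(2 * Fintype.card J * ε ^ 2))
  rcases le_or_gt (W - 4 * ε - 2 * δ) U with h | h
  · set p := (Measure.pi fun _ : J => ν).real (certified u w ε δ)
    have h1 : U + p * (W - U) = W - (1 - p) * (W - U) := by ring
    have h2 : (1 - p) * (W - U) ≤ (1 - p) * (4 * ε + 2 * δ) :=
      mul_le_mul_of_nonneg_left (by linarith) (by linarith)
    have h3 : 0 ≤ p * (4 * ε + 2 * δ) := mul_nonneg hP0 (by linarith)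
    rw [h1]
    linarith
  · have hP := real_union_deviation_le ν hw hu hwb hub hJ hε
      (A := (certified (J := J) u w ε δ)ᶜ) (by
        intro t ht
        have ht' : ¬ sampleMean u t + ε + δ ≤ (1 - δ) * (sampleMean w t - ε) := ht
        by_contra hcon
        simp only [Set.mem_union, Set.mem_ofPred_eq, not_or, not_le] at hcon
        have h1 : δ * (sampleMean w t - ε) ≤ δ * 1 :=
          mul_le_mul_of_nonneg_left (by linarith [sampleMean_le_one hwb t]) hδ
        refine ht' ?_
        linarith [hcon.1, hcon.2])
    rw [probReal_compl_eq_one_sub (measurableSet_certified hu hw)] at hP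
    set p := (Measure.pi fun _ : J => ν).real (certified u w ε δ)
    have h1 : U + p * (W - U) = W - (1 - p) * (W - U) := by ring
    have h2 : (1 - p) * (W - U) ≤ (1 - p) * 1 :=
      mul_le_mul_of_nonneg_left (by linarith [hU.1, hW.2]) (by linarith)
    rw [h1]
    linarith

end SwitchingAnalysis

/-! ### Repeated rounds -/

section Rounds

variable {n : ℕ}

/-- The profit of the policy depends measurably on the past and the present round. -/
def MeasurablePolicy (P : Policy n) : Prop :=
  ∀ m, Measurable (fun q : (Fin m → Outcome n) × Outcome n =>
    randProfit (bestChoice n) (P m q.1) q.2) ∧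
    ∀ s ω, randProfit (bestChoice n) (P m s) ω ∈ Set.Icc (0 : ℝ) 1

variable {P : Policy n}

theorem measurable_init (m : ℕ) :
    Measurable fun w : Fin (m + 1) → Outcome n => (Fin.init w : Fin m → Outcome n) :=
  measurable_pi_iff.2 fun j => measurable_pi_apply (Fin.castSucc j)

theorem MeasurablePolicy.measurable_round (hP : MeasurablePolicy P) (m : ℕ) :
    Measurable fun w : Fin (m + 1) → Outcome n =>
      randProfit (bestChoice n) (P m (Fin.init w)) (w (Fin.last m)) := by
  have h := (hP m).1.comp ((measurable_init m).prodMk (measurable_pi_apply (Fin.last m)))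
  exact h

theorem expectedProfit_eq (hP : MeasurablePolicy P) (𝔻 : Distributions n) (m : ℕ) :
    expectedProfit (bestChoice n) 𝔻 P m =
      ∫ s, ∫ ω, randProfit (bestChoice n) (P m s) ω ∂𝔻.law ∂(Measure.pi fun _ : Fin m => 𝔻.law) := by
  have hmp := measurePreserving_blocks (fun _ : Fin (m + 1) => 𝔻.law)
    (e₁ := (Fin.castSucc : Fin m → Fin (m + 1))) (e₂ := fun _ : Unit => Fin.last m)
    (Fin.castSucc_injective m) (fun _ _ _ => rfl) (fun a _ => (Fin.castSucc_lt_last a).ne)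
  have hm : Measurable fun q : (Fin m → Outcome n) × (Unit → Outcome n) =>
      randProfit (bestChoice n) (P m q.1) (q.2 ()) := by
    have h2 : Measurable fun q : (Fin m → Outcome n) × (Unit → Outcome n) => (q.1, q.2 ()) :=
      measurable_fst.prodMk ((measurable_pi_apply ()).comp measurable_snd)
    have h := (hP m).1.comp h2
    exact h
  have h1 : expectedProfit (bestChoice n) 𝔻 P m =
      ∫ q : (Fin m → Outcome n) × (Unit → Outcome n),
        randProfit (bestChoice n) (P m q.1) (q.2 ())
        ∂((Measure.pi fun _ => 𝔻.law).prod (Measure.pi fun _ => 𝔻.law)) :=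
    integral_comp_measurePreserving hmp hm
  rw [h1, integral_prod _ (integrable_of_mem_Icc hm fun q => (hP m).2 _ _)]
  refine integral_congr_ae (Filter.Eventually.of_forall fun s => ?_)
  have hs : Measurable fun ω => randProfit (bestChoice n) (P m s) ω := by
    have h := (hP m).1.comp (measurable_prodMk_left (x := s))
    exact h
  exact integral_comp_eval (μ := fun _ : Unit => 𝔻.law) (i := ()) hs.aestronglyMeasurable

theorem regret_eq (hP : MeasurablePolicy P) (𝔻 : Distributions n) (T : ℕ) :
    regret (bestChoice n) 𝔻 P T =
      ∑ t : Fin T, (optOnline (bestChoice n) 𝔻 - expectedProfit (bestChoice n) 𝔻 P t.val) := by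
  have hmp : ∀ t : Fin T, MeasurePreserving
      (fun (w : Fin T → Outcome n) (j : Fin (t.val + 1)) => w (Fin.castLE t.isLt j))
      (Measure.pi fun _ => 𝔻.law) (Measure.pi fun _ => 𝔻.law) := fun t =>
    measurePreserving_comp_injective (fun _ => 𝔻.law) (Fin.castLE_injective t.isLt)
  have hm : ∀ t : Fin T, Measurable fun w : Fin T → Outcome n =>
      randProfit (bestChoice n) (P t.val fun j => w (Fin.castLE t.isLt.le j)) (w t) := by
    intro t
    have h := (hP.measurable_round t.val).comp (hmp t).measurable
    exact h
  have hint : ∀ t : Fin T, Integrable (fun w : Fin T → Outcome n =>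
      randProfit (bestChoice n) (P t.val fun j => w (Fin.castLE t.isLt.le j)) (w t))
      (Measure.pi fun _ => 𝔻.law) := fun t =>
    integrable_of_mem_Icc (hm t) fun w => (hP _).2 _ _
  have hint' : ∀ t : Fin T, Integrable (fun w : Fin T → Outcome n => optOnline (bestChoice n) 𝔻 -
      randProfit (bestChoice n) (P t.val fun j => w (Fin.castLE t.isLt.le j)) (w t))
      (Measure.pi fun _ => 𝔻.law) := fun t => (integrable_const _).sub (hint t)
  unfold regret
  rw [integral_finsetSum _ fun t _ => hint' t]
  refine Finset.sum_congr rfl fun t _ => ?_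
  rw [integral_sub (integrable_const _) (hint t)]
  have h2 : ∫ w : Fin T → Outcome n,
      randProfit (bestChoice n) (P t.val fun j => w (Fin.castLE t.isLt.le j)) (w t)
      ∂(Measure.pi fun _ => 𝔻.law) = expectedProfit (bestChoice n) 𝔻 P t.val :=
    integral_comp_measurePreserving (hmp t) (hP.measurable_round t.val)
  rw [h2]
  simp

end Rounds

/-! ### The policy for best choice -/

section Secretary

variable {n : ℕ} {h : (m : ℕ) → (Fin m → Outcome n) → OnlineAlg n}

theorem measurablePolicy_optimizer (hh : IsEmpiricalOptimizer (bestChoice n) h) :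
    MeasurablePolicy fun m s => PMF.pure (h m s) := by
  intro m
  simp_rw [randProfit_pure]
  exact ⟨MeasurableFamily.measurable_profit (hh.measurable m), fun s ω => profit_mem _ _⟩

/-- The indices of the test rounds. -/
abbrev TestRound (m : ℕ) : Type := {j : Fin m // zeta 1 (m + 1) ≤ j.val + 1}

theorem one_le_zeta (m : ℕ) : 1 ≤ zeta 1 (m + 1) := by unfold zeta; omega

theorem card_testRound (m : ℕ) : Fintype.card (TestRound m) = m + 1 - zeta 1 (m + 1) := by
  have h1 := one_le_zeta m
  have h2 := zeta_pred_le 1 m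
  let e : TestRound m ≃ Fin (m + 1 - zeta 1 (m + 1)) :=
    { toFun := fun j => ⟨j.1.val - (zeta 1 (m + 1) - 1), by
        have := j.2
        have := j.1.isLt
        omega⟩
      invFun := fun i => ⟨⟨i.val + (zeta 1 (m + 1) - 1), by have := i.isLt; omega⟩, by
        simp only; omega⟩
      left_inv := fun j => by
        have := j.2
        refine Subtype.ext (Fin.ext ?_)
        simp only
        omega
      right_inv := fun i => by
        refine Fin.ext ?_
        simp only
        omega }
  rw [Fintype.card_congr e, Fintype.card_fin]

theorem testMean_eq {m : ℕ} (s : Fin m → Outcome n) (r : PMF (OnlineAlg n)) :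
    testMean (bestChoice n) 1 s r =
      sampleMean (randProfit (bestChoice n) r) fun j : TestRound m => s j.1 := by
  unfold testMean sampleMean
  rw [card_testRound]
  congr 1
  exact (Finset.sum_subtype _ (fun j => by simp) fun j => randProfit (bestChoice n) r (s j))

theorem measurable_train (m : ℕ) : Measurable fun s : Fin m → Outcome n => train 1 s :=
  measurable_pi_iff.2 fun _ => measurable_pi_apply _

theorem measurable_sampleMean_param {m k : ℕ} {Q : Policy n} (hQ : MeasurablePolicy Q) :
    Measurable fun q : (Fin k → Outcome n) × (TestRound m → Outcome n) =>
      sampleMean (randProfit (bestChoice n) (Q k q.1)) q.2 := by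
  refine (Finset.measurable_sum _ fun j _ => ?_).div_const _
  have h2 : Measurable fun q : (Fin k → Outcome n) × (TestRound m → Outcome n) => (q.1, q.2 j) :=
    measurable_fst.prodMk ((measurable_pi_apply j).comp measurable_snd)
  have h := (hQ k).1.comp h2
  exact h

theorem measurableSet_certified_param {m k : ℕ} {Q R : Policy n} (hQ : MeasurablePolicy Q)
    (hR : MeasurablePolicy R) (ε δ : ℝ) :
    MeasurableSet {q : (Fin k → Outcome n) × (TestRound m → Outcome n) |
      q.2 ∈ certified (randProfit (bestChoice n) (Q k q.1)) (randProfit (bestChoice n) (R k q.1))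
        ε δ} :=
  measurableSet_le (((measurable_sampleMean_param hQ).add_const _).add_const _)
    (((measurable_sampleMean_param hR).sub_const _).const_mul _)

theorem measurePreserving_train_test (μ : Measure (Outcome n)) [IsProbabilityMeasure μ] (m : ℕ) :
    MeasurePreserving (fun s : Fin m → Outcome n => (train 1 s, fun j : TestRound m => s j.1))
      (Measure.pi fun _ => μ) ((Measure.pi fun _ => μ).prod (Measure.pi fun _ => μ)) :=
  measurePreserving_blocks (fun _ : Fin m => μ) (Fin.castLE_injective (zeta_pred_le 1 m))
    Subtype.val_injective fun a b hab => by
      have h1 := a.isLt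
      have h2 := b.2
      rw [← hab] at h2
      simp only [Fin.val_castLE] at h2
      omega

theorem switchEvent_iff (κ : ℕ) {m : ℕ} (s : Fin m → Outcome n) (g r : PMF (OnlineAlg n)) :
    SwitchEvent (bestChoice n) 1 κ 1 s g r ↔ zeta 1 (m + 1) < m + 1 ∧
      (fun j : TestRound m => s j.1) ∈ certified (randProfit (bestChoice n) g)
        (randProfit (bestChoice n) r) (eps 1 κ 1 (m + 1)) (delta 1 κ 1 (m + 1)) := by
  unfold SwitchEvent certified
  rw [testMean_eq, testMean_eq, one_mul]
  rfl

variable [NeZero n] (κ : ℕ) (tie : PMF Bool)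

/-- The index `zeta 1 (m + 1) - 1` is positive but not syntactically a successor, so the defining
equation does not apply directly. -/
theorem singleSampleBaseline_of_pos {k : ℕ} (hk : 0 < k) (s : Fin k → Outcome n) :
    singleSampleBaseline n tie k s =
      tie.map fun strict => constThreshold n strict (Finset.univ.sup (s ⟨0, hk⟩).1) := by
  cases k with
  | zero => exact absurd hk (lt_irrefl _)
  | succ k => rfl

theorem measurablePolicy_baseline : MeasurablePolicy (singleSampleBaseline n tie) := by
  intro m
  cases m with
  | zero =>
    refine ⟨?_, fun s ω => randProfit_map_mem _ _ _⟩
    have h1 : ∀ q : (Fin 0 → Outcome n) × Outcome n,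
        randProfit (bestChoice n) (singleSampleBaseline n tie 0 q.1) q.2 =
        ∑ i, (PMF.uniformOfFintype (Fin n) i).toReal * profit (bestChoice n) (pickAlg i) q.2 :=
      fun q => randProfit_map _ _ _ _
    simp_rw [h1]
    exact Finset.measurable_sum _ fun i _ =>
      ((measurable_profit (pickAlg i)).comp measurable_snd).const_mul _
  | succ m =>
    refine ⟨?_, fun s ω => randProfit_map_mem _ _ _⟩
    have h1 : ∀ q : (Fin (m + 1) → Outcome n) × Outcome n,
        randProfit (bestChoice n) (singleSampleBaseline n tie (m + 1) q.1) q.2 =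
        ∑ b, (tie b).toReal *
          profit (bestChoice n) (constThreshold n b (Finset.univ.sup (q.1 0).1)) q.2 :=
      fun q => randProfit_map _ _ _ _
    simp_rw [h1]
    refine Finset.measurable_sum _ fun b _ => Measurable.const_mul ?_ _
    have h2 : Measurable fun s : Fin (m + 1) → Outcome n => Finset.univ.sup (s 0).1 :=
      measurable_sup_univ.comp (measurable_fst.comp (measurable_pi_apply 0))
    have h3 := ((measurableFamily_constThreshold (n := n) b).comp h2).measurable_profit
    exact h3

open Classical in
theorem randProfit_secretaryPolicy {m : ℕ} (s : Fin m → Outcome n) (ω : Outcome n) :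
    randProfit (bestChoice n) (secretaryPolicy n κ tie h m s) ω =
      if SwitchEvent (bestChoice n) 1 κ 1 s (singleSampleBaseline n tie _ (train 1 s))
        (PMF.pure (h _ (train 1 s)))
      then profit (bestChoice n) (h _ (train 1 s)) ω
      else randProfit (bestChoice n) (singleSampleBaseline n tie _ (train 1 s)) ω := by
  unfold secretaryPolicy switching
  split_ifs
  · rw [randProfit_pure]
  · rfl

theorem measurableSet_switchEvent (hh : IsEmpiricalOptimizer (bestChoice n) h) (m : ℕ) :
    MeasurableSet {s : Fin m → Outcome n | SwitchEvent (bestChoice n) 1 κ 1 s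
      (singleSampleBaseline n tie _ (train 1 s)) (PMF.pure (h _ (train 1 s)))} := by
  simp_rw [switchEvent_iff]
  refine (MeasurableSet.const _).inter ?_
  have h1 := measurableSet_certified_param (m := m) (k := zeta 1 (m + 1) - 1)
    (measurablePolicy_baseline (n := n) tie) (measurablePolicy_optimizer hh)
    (eps 1 κ 1 (m + 1)) (delta 1 κ 1 (m + 1))
  have h2 : Measurable fun s : Fin m → Outcome n => (train 1 s, fun j : TestRound m => s j.1) :=
    (measurable_train m).prodMk (measurable_pi_iff.2 fun j => measurable_pi_apply _)
  exact h2 h1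

theorem measurablePolicy_secretary (hh : IsEmpiricalOptimizer (bestChoice n) h) :
    MeasurablePolicy (secretaryPolicy n κ tie h) := by
  classical
  intro m
  have htr : Measurable fun q : (Fin m → Outcome n) × Outcome n => (train 1 q.1, q.2) :=
    ((measurable_train m).comp measurable_fst).prodMk measurable_snd
  refine ⟨?_, fun s ω => ?_⟩
  · simp_rw [randProfit_secretaryPolicy]
    refine Measurable.ite (measurable_fst (measurableSet_switchEvent κ tie hh m)) ?_ ?_
    · have h1 := (MeasurableFamily.measurable_profit (hh.measurable _)).comp htr
      exact h1
    · have h1 := (measurablePolicy_baseline (n := n) tie _).1.comp htr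
      exact h1
  · rw [randProfit_secretaryPolicy]
    split_ifs
    · exact profit_mem _ _
    · exact (measurablePolicy_baseline tie _).2 _ _

variable (𝔻 : Distributions n)

/-- Expected profit of the trained baseline. -/
def baselineValue (k : ℕ) (s : Fin k → Outcome n) : ℝ :=
  ∫ ω, randProfit (bestChoice n) (singleSampleBaseline n tie k s) ω ∂𝔻.law

theorem baselineValue_mem (k : ℕ) (s : Fin k → Outcome n) :
    baselineValue tie 𝔻 k s ∈ Set.Icc (0 : ℝ) 1 :=
  integral_mem_Icc fun _ => (measurablePolicy_baseline tie k).2 _ _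

theorem measurable_baselineValue (k : ℕ) : Measurable (baselineValue tie 𝔻 k) :=
  ((measurablePolicy_baseline tie k).1.stronglyMeasurable.integral_prod_right'
    (ν := 𝔻.law)).measurable

theorem baselineValue_of_pos {k : ℕ} (hk : 0 < k) (s : Fin k → Outcome n) :
    baselineValue tie 𝔻 k s =
      ∑ b, (tie b).toReal * thresholdValue 𝔻 b (Finset.univ.sup (s ⟨0, hk⟩).1) := by
  unfold baselineValue
  simp_rw [singleSampleBaseline_of_pos tie hk, randProfit_map]
  rw [integral_finsetSum _ fun b _ =>
    (integrable_of_mem_Icc (measurable_profit _) fun ω => profit_mem _ _).const_mul _]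
  simp_rw [integral_const_mul]
  rfl

theorem integral_baselineValue {k : ℕ} (hk : 0 < k) :
    ∫ s, baselineValue tie 𝔻 k s ∂(Measure.pi fun _ => 𝔻.law) =
      ∫ ω, ∑ b, (tie b).toReal * thresholdValue 𝔻 b (Finset.univ.sup ω.1) ∂𝔻.law := by
  simp_rw [baselineValue_of_pos tie 𝔻 hk]
  have hm : Measurable fun ω : Outcome n =>
      ∑ b, (tie b).toReal * thresholdValue 𝔻 b (Finset.univ.sup ω.1) :=
    Finset.measurable_sum _ fun b _ => ((measurable_thresholdValue 𝔻 b).comp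
      (measurable_sup_univ.comp measurable_fst)).const_mul _
  exact integral_comp_eval (μ := fun _ : Fin k => 𝔻.law) (i := ⟨0, hk⟩) hm.aestronglyMeasurable

/-- This covers rounds 1 and 2, where all past rounds are used for training and the baseline is
played. -/
theorem expectedProfit_of_no_test (hh : IsEmpiricalOptimizer (bestChoice n) h) {m : ℕ}
    (hm : ¬ zeta 1 (m + 1) < m + 1) :
    expectedProfit (bestChoice n) 𝔻 (secretaryPolicy n κ tie h) m =
      ∫ s, baselineValue tie 𝔻 (zeta 1 (m + 1) - 1) s ∂(Measure.pi fun _ => 𝔻.law) := by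
  classical
  rw [expectedProfit_eq (measurablePolicy_secretary κ tie hh)]
  have hno : ∀ s : Fin m → Outcome n, ¬ SwitchEvent (bestChoice n) 1 κ 1 s
      (singleSampleBaseline n tie _ (train 1 s)) (PMF.pure (h _ (train 1 s))) :=
    fun s hs => hm hs.1
  simp_rw [randProfit_secretaryPolicy, if_neg (hno _)]
  exact integral_comp_measurePreserving
    (measurePreserving_comp_injective (fun _ : Fin m => 𝔻.law)
      (Fin.castLE_injective (zeta_pred_le 1 m))) (measurable_baselineValue tie 𝔻 _)

open Classical in
-- Training, test and present rounds are independent: given the training rounds, the two candidates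
-- are fixed and the test rounds only decide between their expected profits.
theorem expectedProfit_of_test (hh : IsEmpiricalOptimizer (bestChoice n) h) {m : ℕ}
    (hm : zeta 1 (m + 1) < m + 1) :
    expectedProfit (bestChoice n) 𝔻 (secretaryPolicy n κ tie h) m =
      ∫ s, ∫ t : TestRound m → Outcome n, (if t ∈ certified
        (randProfit (bestChoice n) (singleSampleBaseline n tie (zeta 1 (m + 1) - 1) s))
        (randProfit (bestChoice n) (PMF.pure (h (zeta 1 (m + 1) - 1) s)))
        (eps 1 κ 1 (m + 1)) (delta 1 κ 1 (m + 1))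
        then freshProfit 𝔻.law (h (zeta 1 (m + 1) - 1)) s
        else baselineValue tie 𝔻 (zeta 1 (m + 1) - 1) s)
        ∂(Measure.pi fun _ => 𝔻.law) ∂(Measure.pi fun _ => 𝔻.law) := by
  rw [expectedProfit_eq (measurablePolicy_secretary κ tie hh)]
  set k := zeta 1 (m + 1) - 1 with hk
  let F : (Fin k → Outcome n) × (TestRound m → Outcome n) → ℝ := fun q =>
    if q.2 ∈ certified (randProfit (bestChoice n) (singleSampleBaseline n tie k q.1))
        (randProfit (bestChoice n) (PMF.pure (h k q.1)))
        (eps 1 κ 1 (m + 1)) (delta 1 κ 1 (m + 1))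
      then freshProfit 𝔻.law (h k) q.1 else baselineValue tie 𝔻 k q.1
  have hF : Measurable F := Measurable.ite
    (measurableSet_certified_param (measurablePolicy_baseline tie) (measurablePolicy_optimizer hh)
      _ _)
    ((measurable_freshProfit 𝔻.law (hh.measurable k)).comp measurable_fst)
    ((measurable_baselineValue tie 𝔻 k).comp measurable_fst)
  have hFb : ∀ q, F q ∈ Set.Icc (0 : ℝ) 1 := by
    intro q
    simp only [F]
    split_ifs
    · exact freshProfit_mem _ _
    · exact baselineValue_mem _ _ _ _
  have h1 : ∀ s : Fin m → Outcome n,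
      ∫ ω, randProfit (bestChoice n) (secretaryPolicy n κ tie h m s) ω ∂𝔻.law =
      F (train 1 s, fun j : TestRound m => s j.1) := by
    intro s
    simp_rw [randProfit_secretaryPolicy, switchEvent_iff]
    simp only [F, hm, true_and]
    split_ifs
    · rfl
    · rfl
  simp_rw [h1]
  rw [integral_comp_measurePreserving (measurePreserving_train_test 𝔻.law m) hF,
    integral_prod _ (integrable_of_mem_Icc hF hFb)]

end Secretary

end

end OptStop

namespace OptStop

noncomputable section

open MeasureTheory

/-! ### Estimates for the parameters of the switching rule -/

section Parameters

variable {κ m : ℕ}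

theorem two_le_zeta (hm : zeta 1 (m + 1) < m + 1) : 2 ≤ zeta 1 (m + 1) := by
  unfold zeta at *; omega

theorem zeta_pred_le_card (hm : zeta 1 (m + 1) < m + 1) :
    zeta 1 (m + 1) - 1 ≤ Fintype.card (TestRound m) := by
  rw [card_testRound]
  unfold zeta at *; omega

theorem one_le_log_zeta (hm : zeta 1 (m + 1) < m + 1) : 1 ≤ Real.log (4 * zeta 1 (m + 1)) := by
  have hz : (2 : ℝ) ≤ zeta 1 (m + 1) := by exact_mod_cast two_le_zeta hm
  rw [Real.le_log_iff_exp_le (by linarith)]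
  linarith [Real.exp_one_lt_d9]

theorem eps_nonneg : 0 ≤ eps 1 κ 1 (m + 1) := by
  unfold eps eps₁; positivity

/-- There are at least `ζ - 1` test rounds, which cancels the denominator in `ε²`: `2 · (ζ - 1) · 36
· 2κ log(4ζ)/(ζ - 1) = 144 κ log(4ζ)`. -/
theorem exp_eps_le (hm : zeta 1 (m + 1) < m + 1) :
    Real.exp (-(2 * Fintype.card (TestRound m) * eps 1 κ 1 (m + 1) ^ 2)) ≤
      Real.exp (-(144 * κ * Real.log (4 * zeta 1 (m + 1)))) := by
  have hz : (2 : ℝ) ≤ zeta 1 (m + 1) := by exact_mod_cast two_le_zeta hm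
  have hJ : (zeta 1 (m + 1) : ℝ) - 1 ≤ Fintype.card (TestRound m) := by
    have h1 := zeta_pred_le_card hm
    have h2 : zeta 1 (m + 1) ≤ Fintype.card (TestRound m) + 1 := by omega
    have h3 : (zeta 1 (m + 1) : ℝ) ≤ Fintype.card (TestRound m) + 1 := by exact_mod_cast h2
    linarith
  have hl := one_le_log_zeta hm
  unfold eps eps₁
  set z : ℝ := (zeta 1 (m + 1) : ℝ)
  have hq : 0 ≤ 2 * κ * Real.log (4 * z) / (z - 1) :=
    div_nonneg (by positivity) (by linarith)
  rw [Real.exp_le_exp, neg_le_neg_iff, mul_pow, Real.sq_sqrt hq]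
  have h4 : 144 * κ * Real.log (4 * z) =
      2 * (z - 1) * ((6 * 1) ^ 2 * (2 * κ * Real.log (4 * z) / (z - 1))) := by
    have : z - 1 ≠ 0 := by linarith
    field_simp
    ring
  rw [h4]
  gcongr

theorem exp_eps_le_inv_zeta (hκ : 1 ≤ κ) (hm : zeta 1 (m + 1) < m + 1) :
    Real.exp (-(2 * Fintype.card (TestRound m) * eps 1 κ 1 (m + 1) ^ 2)) ≤
      1 / (4 * zeta 1 (m + 1)) := by
  have hz : (2 : ℝ) ≤ zeta 1 (m + 1) := by exact_mod_cast two_le_zeta hm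
  have hl := one_le_log_zeta hm
  have hκ' : (1 : ℝ) ≤ κ := by exact_mod_cast hκ
  refine (exp_eps_le hm).trans ?_
  rw [one_div, ← Real.exp_log (show (0 : ℝ) < 4 * zeta 1 (m + 1) by linarith), ← Real.exp_neg,
    Real.exp_log (show (0 : ℝ) < 4 * zeta 1 (m + 1) by linarith), Real.exp_le_exp, neg_le_neg_iff]
  refine le_mul_of_one_le_left (by linarith) (by linarith)

/-- Twice this bound is exactly the surplus `1/(256 n²)` of the baseline. This is where `κ ≥ n` is
needed. -/
theorem exp_eps_le_inv_sq {n : ℕ} (hn : 1 ≤ n) (hκ : n ≤ κ) (hm : zeta 1 (m + 1) < m + 1) :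
    Real.exp (-(2 * Fintype.card (TestRound m) * eps 1 κ 1 (m + 1) ^ 2)) ≤
      1 / (512 * (n : ℝ) ^ 2) := by
  have hl := one_le_log_zeta hm
  have hn' : (1 : ℝ) ≤ n := by exact_mod_cast hn
  have hκ' : (n : ℝ) ≤ κ := by exact_mod_cast hκ
  refine (exp_eps_le hm).trans ?_
  have h1 : 512 * (n : ℝ) ^ 2 ≤ Real.exp (144 * κ * Real.log (4 * zeta 1 (m + 1))) := by
    calc 512 * (n : ℝ) ^ 2 ≤ (72 * n + 1) ^ 2 := by nlinarith
      _ ≤ Real.exp (72 * n) ^ 2 := by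
        gcongr
        exact Real.add_one_le_exp _
      _ = Real.exp (144 * n) := by rw [← Real.exp_nat_mul]; congr 1; push_cast; ring
      _ ≤ _ := by
        rw [Real.exp_le_exp]
        calc 144 * (n : ℝ) ≤ 144 * κ := by gcongr
          _ ≤ _ := le_mul_of_one_le_right (by positivity) hl
  rw [Real.exp_neg, ← one_div]
  exact one_div_le_one_div_of_le (by positivity) h1

theorem delta_nonneg : 0 ≤ delta 1 κ 1 (m + 1) := by
  unfold delta delta₀ delta₁; positivity

theorem delta_le (hκ : 1 ≤ κ) (hm : zeta 1 (m + 1) < m + 1) :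
    delta 1 κ 1 (m + 1) ≤ 3 / (2 * zeta 1 (m + 1)) := by
  have hz : (2 : ℝ) ≤ zeta 1 (m + 1) := by exact_mod_cast two_le_zeta hm
  have h1 := exp_eps_le_inv_zeta hκ hm
  have h2 : delta₁ κ (zeta 1 (m + 1)) ≤ 1 / (2 * zeta 1 (m + 1)) := by
    unfold delta₁
    refine one_div_le_one_div_of_le (by linarith) ?_
    have : (zeta 1 (m + 1) : ℝ) ≤ (zeta 1 (m + 1) : ℝ) ^ κ :=
      le_self_pow₀ (by linarith) (by omega)
    linarith
  have h3 : delta 1 κ 1 (m + 1) = 4 * Real.exp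
      (-(2 * Fintype.card (TestRound m) * eps 1 κ 1 (m + 1) ^ 2)) + delta₁ κ (zeta 1 (m + 1)) := by
    unfold delta delta₀ eps
    rw [card_testRound, one_pow, div_one]
    ring
  rw [h3]
  calc _ ≤ 4 * (1 / (4 * (zeta 1 (m + 1) : ℝ))) + 1 / (2 * zeta 1 (m + 1)) := by gcongr
    _ = _ := by field_simp; norm_num

theorem delta_le_one (hκ : 1 ≤ κ) (hm : zeta 1 (m + 1) < m + 1) : delta 1 κ 1 (m + 1) ≤ 1 := by
  have hz : (2 : ℝ) ≤ zeta 1 (m + 1) := by exact_mod_cast two_le_zeta hm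
  refine (delta_le hκ hm).trans ?_
  rw [div_le_one (by linarith)]
  linarith

theorem card_testRound_pos (hm : zeta 1 (m + 1) < m + 1) : 0 < Fintype.card (TestRound m) := by
  have := zeta_pred_le_card hm
  have := two_le_zeta hm
  omega

end Parameters

/-! ### Competitiveness and regret -/

section Guarantees

variable {n : ℕ}

theorem integral_randProfit_pure (μ : Measure (Outcome n)) {k : ℕ}
    (f : (Fin k → Outcome n) → OnlineAlg n) (s : Fin k → Outcome n) :
    ∫ ω, randProfit (bestChoice n) (PMF.pure (f s)) ω ∂μ = freshProfit μ f s := by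
  simp_rw [randProfit_pure]
  rfl

theorem measurable_randProfit_pure (a : OnlineAlg n) :
    Measurable (randProfit (bestChoice n) (PMF.pure a)) := by
  rw [funext (randProfit_pure (bestChoice n) a)]
  exact measurable_profit a

theorem randProfit_pure_mem (a : OnlineAlg n) (ω : Outcome n) :
    randProfit (bestChoice n) (PMF.pure a) ω ∈ Set.Icc (0 : ℝ) 1 := by
  rw [randProfit_pure]
  exact profit_mem _ _

theorem optOnline_le_one (𝔻 : Distributions n) : optOnline (bestChoice n) 𝔻 ≤ 1 :=
  (optOnline_le 𝔻).trans (integral_profit_mem 𝔻 _).2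

theorem expectedProfit_nonneg (𝔻 : Distributions n) {P : Policy n} (hP : MeasurablePolicy P) (m : ℕ) :
    0 ≤ expectedProfit (bestChoice n) 𝔻 P m :=
  integral_nonneg fun _ => ((hP m).2 _ _).1

variable [NeZero n] (κ : ℕ) (tie : PMF Bool)
  {h : (m : ℕ) → (Fin m → Outcome n) → OnlineAlg n} (𝔻 : Distributions n)

/-- Some position holds the maximum, and it is chosen with probability `1/n`. -/
theorem inv_le_baselineValue_zero (s : Fin 0 → Outcome n) :
    1 / (n : ℝ) ≤ baselineValue tie 𝔻 0 s := by
  have h1 : ∀ ω : Outcome n, 1 / (n : ℝ) ≤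
      randProfit (bestChoice n) (singleSampleBaseline n tie 0 s) ω := by
    intro ω
    have h2 : randProfit (bestChoice n) (singleSampleBaseline n tie 0 s) ω =
        ∑ i, (PMF.uniformOfFintype (Fin n) i).toReal * profit (bestChoice n) (pickAlg i) ω :=
      randProfit_map _ _ _ _
    obtain ⟨i, -, hi⟩ := Finset.exists_max_image Finset.univ ω.1
      (Finset.univ_nonempty (α := Fin n))
    have hi' : profit (bestChoice n) (pickAlg i) ω = 1 := by
      have hacc : ∀ j, Accepts (pickAlg i) ω j ↔ j = i := fun j => by simp [Accepts, pickAlg]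
      refine profit_eq_one ⟨i, (hacc i).2 rfl⟩ fun j hj => ?_
      rw [(hacc j).1 hj]
      exact eq_sup_of_forall_le fun k => hi k (Finset.mem_univ k)
    rw [h2]
    refine le_trans (le_of_eq ?_) (Finset.single_le_sum
      (f := fun i => (PMF.uniformOfFintype (Fin n) i).toReal * profit (bestChoice n) (pickAlg i) ω)
      (fun j _ => mul_nonneg ENNReal.toReal_nonneg (profit_mem _ _).1) (Finset.mem_univ i))
    simp [hi']
  have h3 := integral_mono (μ := 𝔻.law) (integrable_const (1 / (n : ℝ)))
    (integrable_of_mem_Icc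
      ((measurablePolicy_baseline (n := n) tie 0).1.comp (measurable_prodMk_left (x := s)))
      fun ω => (measurablePolicy_baseline tie 0).2 s ω) h1
  rw [integral_const, probReal_univ, one_smul] at h3
  exact h3

theorem competitiveAt_zero (hh : IsEmpiricalOptimizer (bestChoice n) h) :
    CompetitiveAt (bestChoice n) 𝔻 (secretaryPolicy n κ tie h) 0 (1 / n) := by
  unfold CompetitiveAt
  have hm : ¬ zeta 1 (0 + 1) < 0 + 1 := by decide
  rw [expectedProfit_of_no_test κ tie 𝔻 hh hm]
  have h1 : ∀ s : Fin (zeta 1 (0 + 1) - 1) → Outcome n,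
      1 / (n : ℝ) ≤ baselineValue tie 𝔻 (zeta 1 (0 + 1) - 1) s :=
    inv_le_baselineValue_zero tie 𝔻
  have h2 := integral_mono (μ := Measure.pi fun _ => 𝔻.law) (integrable_const (1 / (n : ℝ)))
    (integrable_of_mem_Icc (measurable_baselineValue tie 𝔻 (zeta 1 (0 + 1) - 1))
      (baselineValue_mem tie 𝔻 _)) h1
  refine (mul_le_of_le_one_right (by positivity) (optOffline_le_one 𝔻)).trans ?_
  simpa using h2

open Classical in
/-- Expected profit of the switching rule over the test sample, for a given training sample. -/
def switchValue (m : ℕ) (h : (m : ℕ) → (Fin m → Outcome n) → OnlineAlg n)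
    (s : Fin (zeta 1 (m + 1) - 1) → Outcome n) : ℝ :=
  ∫ t : TestRound m → Outcome n, (if t ∈ certified
    (randProfit (bestChoice n) (singleSampleBaseline n tie (zeta 1 (m + 1) - 1) s))
    (randProfit (bestChoice n) (PMF.pure (h (zeta 1 (m + 1) - 1) s)))
    (eps 1 κ 1 (m + 1)) (delta 1 κ 1 (m + 1))
    then freshProfit 𝔻.law (h (zeta 1 (m + 1) - 1)) s
    else baselineValue tie 𝔻 (zeta 1 (m + 1) - 1) s)
    ∂(Measure.pi fun _ => 𝔻.law)

variable {κ} {m : ℕ}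

theorem measurable_randProfit_baseline {k : ℕ} (s : Fin k → Outcome n) :
    Measurable (randProfit (bestChoice n) (singleSampleBaseline n tie k s)) :=
  (measurablePolicy_baseline (n := n) tie k).1.comp (measurable_prodMk_left (x := s))

theorem baselineValue_le_switchValue (hκ : 1 ≤ κ) (hm : zeta 1 (m + 1) < m + 1)
    (s : Fin (zeta 1 (m + 1) - 1) → Outcome n) :
    baselineValue tie 𝔻 _ s -
      2 * Real.exp (-(2 * Fintype.card (TestRound m) * eps 1 κ 1 (m + 1) ^ 2)) ≤
      switchValue κ tie 𝔻 m h s := by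
  have h1 := le_integral_switch_of_baseline (J := TestRound m) 𝔻.law
    (measurable_randProfit_baseline tie s) (measurable_randProfit_pure (h _ s))
    ((measurablePolicy_baseline tie _).2 s) (randProfit_pure_mem _)
    (card_testRound_pos hm) (eps_nonneg (κ := κ) (m := m)) delta_nonneg (delta_le_one hκ hm)
  rw [integral_randProfit_pure] at h1
  exact h1

theorem freshProfit_le_switchValue (hm : zeta 1 (m + 1) < m + 1)
    (s : Fin (zeta 1 (m + 1) - 1) → Outcome n) :
    freshProfit 𝔻.law (h _) s - (4 * eps 1 κ 1 (m + 1) + 2 * delta 1 κ 1 (m + 1) +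
      2 * Real.exp (-(2 * Fintype.card (TestRound m) * eps 1 κ 1 (m + 1) ^ 2))) ≤
      switchValue κ tie 𝔻 m h s := by
  have h1 := le_integral_switch_of_optimizer (J := TestRound m) 𝔻.law
    (measurable_randProfit_baseline tie s) (measurable_randProfit_pure (h _ s))
    ((measurablePolicy_baseline tie _).2 s) (randProfit_pure_mem _)
    (card_testRound_pos hm) (eps_nonneg (κ := κ) (m := m)) (delta_nonneg (κ := κ) (m := m))
  rw [integral_randProfit_pure] at h1
  refine le_trans (le_of_eq (by ring)) h1

theorem switchValue_mem (s : Fin (zeta 1 (m + 1) - 1) → Outcome n) :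
    switchValue κ tie 𝔻 m h s ∈ Set.Icc (0 : ℝ) 1 := by
  refine integral_mem_Icc fun t => ?_
  split_ifs
  · exact freshProfit_mem _ _
  · exact baselineValue_mem _ _ _ _

theorem measurable_switchValue (hh : IsEmpiricalOptimizer (bestChoice n) h) :
    Measurable (switchValue κ tie 𝔻 m h) := by
  classical
  have h1 : Measurable fun q : (Fin (zeta 1 (m + 1) - 1) → Outcome n) ×
      (TestRound m → Outcome n) => if q.2 ∈ certified
        (randProfit (bestChoice n) (singleSampleBaseline n tie (zeta 1 (m + 1) - 1) q.1))
        (randProfit (bestChoice n) (PMF.pure (h (zeta 1 (m + 1) - 1) q.1)))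
        (eps 1 κ 1 (m + 1)) (delta 1 κ 1 (m + 1))
      then freshProfit 𝔻.law (h (zeta 1 (m + 1) - 1)) q.1
      else baselineValue tie 𝔻 (zeta 1 (m + 1) - 1) q.1 := Measurable.ite
    (measurableSet_certified_param (m := m) (k := zeta 1 (m + 1) - 1)
      (measurablePolicy_baseline (n := n) tie) (measurablePolicy_optimizer hh)
      (eps 1 κ 1 (m + 1)) (delta 1 κ 1 (m + 1)))
    ((measurable_freshProfit 𝔻.law (hh.measurable _)).comp measurable_fst)
    ((measurable_baselineValue tie 𝔻 _).comp measurable_fst)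
  exact (h1.stronglyMeasurable.integral_prod_right' (ν := Measure.pi fun _ => 𝔻.law)).measurable

theorem integrable_switchValue (hh : IsEmpiricalOptimizer (bestChoice n) h) :
    Integrable (switchValue κ tie 𝔻 m h) (Measure.pi fun _ => 𝔻.law) :=
  integrable_of_mem_Icc (measurable_switchValue tie 𝔻 hh) (switchValue_mem tie 𝔻)

theorem expectedProfit_eq_switchValue (hh : IsEmpiricalOptimizer (bestChoice n) h)
    (hm : zeta 1 (m + 1) < m + 1) :
    expectedProfit (bestChoice n) 𝔻 (secretaryPolicy n κ tie h) m =
      ∫ s, switchValue κ tie 𝔻 m h s ∂(Measure.pi fun _ => 𝔻.law) :=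
  expectedProfit_of_test κ tie 𝔻 hh hm

/-- Since `optOffline` is at most one, it suffices to win with probability `1/4`. The surplus of the
single-sample rule covers the error probability of the test. -/
theorem competitiveAt_of_one_le (hh : IsEmpiricalOptimizer (bestChoice n) h) (hκ : n ≤ κ)
    (htie : tie = PMF.uniformOfFintype Bool ∨ 𝔻.Atomless) (hm1 : 1 ≤ m) :
    CompetitiveAt (bestChoice n) 𝔻 (secretaryPolicy n κ tie h) m (1 / 4) := by
  have hn : 1 ≤ n := NeZero.one_le
  have hk : 0 < zeta 1 (m + 1) - 1 := by unfold zeta; omega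
  have hb := integral_baseline_ge 𝔻 htie
  rw [← integral_baselineValue tie 𝔻 hk] at hb
  refine (mul_le_of_le_one_right (by norm_num) (optOffline_le_one 𝔻)).trans ?_
  by_cases hm : zeta 1 (m + 1) < m + 1
  · rw [expectedProfit_eq_switchValue tie 𝔻 hh hm]
    have hi : Integrable (baselineValue tie 𝔻 (zeta 1 (m + 1) - 1))
        (Measure.pi fun _ => 𝔻.law) :=
      integrable_of_mem_Icc (measurable_baselineValue tie 𝔻 _) (baselineValue_mem tie 𝔻 _)
    have h1 := integral_mono (hi.sub (integrable_const _)) (integrable_switchValue tie 𝔻 hh)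
      (baselineValue_le_switchValue (h := h) tie 𝔻 (hn.trans hκ) hm)
    simp only [Pi.sub_apply] at h1
    rw [integral_sub hi (integrable_const _), integral_const, probReal_univ, one_smul] at h1
    have h2 := exp_eps_le_inv_sq hn hκ hm
    have h3 : 1 / (256 * (n : ℝ) ^ 2) = 2 * (1 / (512 * (n : ℝ) ^ 2)) := by
      field_simp
      norm_num
    linarith
  · rw [expectedProfit_of_no_test κ tie 𝔻 hh hm]
    have : 0 ≤ 1 / (256 * (n : ℝ) ^ 2) := by positivity
    linarith

/-- Everything is measured in units of `R = √(L log(4ζ)/(ζ - 1))`: the generalization gap is at most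
`3R`, `4ε ≤ 48R`, `2δ ≤ 3/ζ ≤ 3R`, and the deviation term is at most `R/2`. The total is below
`55R`. -/
theorem optOnline_sub_expectedProfit_le_of_test (hh : IsEmpiricalOptimizer (bestChoice n) h)
    (hκ : 1 ≤ κ) {L : ℝ} (hL : 1 ≤ L) (hκL : κ ≤ 2 * L) {K : Finset (LabelPrefix n)}
    (hKpos : 0 < K.card) (hK : ∀ᵐ ω ∂𝔻.law, ∀ i, (⟨i, labelsUpTo ω.2 i⟩ : LabelPrefix n) ∈ K)
    (hKL : K.card ≤ 3 * L) (hm : zeta 1 (m + 1) < m + 1) :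
    optOnline (bestChoice n) 𝔻 - expectedProfit (bestChoice n) 𝔻 (secretaryPolicy n κ tie h) m ≤
      55 * Real.sqrt (L * Real.log (4 * zeta 1 (m + 1)) / ((zeta 1 (m + 1) : ℝ) - 1)) := by
  have hz2 := two_le_zeta hm
  have hz : (2 : ℝ) ≤ zeta 1 (m + 1) := by exact_mod_cast hz2
  have hl := one_le_log_zeta hm
  have hgap := integral_gap_le (μ := 𝔻.law) hh (m := zeta 1 (m + 1) - 1) (by omega) hKpos hK
    (isEssThreshold_optimalAlg 𝔻)
  have hopt := optOnline_le 𝔻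
  have hi : Integrable (freshProfit 𝔻.law (h (zeta 1 (m + 1) - 1)))
      (Measure.pi fun _ => 𝔻.law) :=
    integrable_of_mem_Icc (measurable_freshProfit 𝔻.law (hh.measurable _)) (freshProfit_mem _)
  have hsw := integral_mono (hi.sub (integrable_const _)) (integrable_switchValue tie 𝔻 hh)
    (freshProfit_le_switchValue (κ := κ) tie 𝔻 hm)
  simp only [Pi.sub_apply] at hsw
  rw [integral_sub hi (integrable_const _), integral_const, probReal_univ, one_smul,
    ← expectedProfit_eq_switchValue tie 𝔻 hh hm] at hsw
  have ha := exp_eps_le_inv_zeta hκ hm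
  have hδ := delta_le hκ hm
  have hcast : ((zeta 1 (m + 1) - 1 : ℕ) : ℝ) = (zeta 1 (m + 1) : ℝ) - 1 := by
    rw [Nat.cast_sub (by omega), Nat.cast_one]
  rw [hcast] at hgap
  have hε : eps 1 κ 1 (m + 1) = 6 * Real.sqrt (2 * κ * Real.log (4 * zeta 1 (m + 1)) /
      ((zeta 1 (m + 1) : ℝ) - 1)) := by
    unfold eps eps₁
    rw [mul_one]
  set z : ℝ := (zeta 1 (m + 1) : ℝ)
  have hz1 : 0 < z - 1 := by linarith
  set R := Real.sqrt (L * Real.log (4 * z) / (z - 1)) with hR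
  have hsqrt : ∀ c x : ℝ, 0 ≤ c → x ≤ c ^ 2 * (L * Real.log (4 * z) / (z - 1)) →
      Real.sqrt x ≤ c * R := fun c x hc hx => by
    refine (Real.sqrt_le_sqrt hx).trans (le_of_eq ?_)
    rw [Real.sqrt_mul (sq_nonneg c), Real.sqrt_sq hc]
  have h1 : Real.sqrt (2 * K.card * Real.log (2 * (z - 1) + 1) / (z - 1)) ≤ 3 * R := by
    refine hsqrt 3 _ (by norm_num) ?_
    have hlog : Real.log (2 * (z - 1) + 1) ≤ Real.log (4 * z) :=
      Real.log_le_log (by linarith) (by linarith)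
    have hlog0 : 0 ≤ Real.log (2 * (z - 1) + 1) := Real.log_nonneg (by linarith)
    rw [← mul_div_assoc]
    refine div_le_div_of_nonneg_right ?_ hz1.le
    calc 2 * K.card * Real.log (2 * (z - 1) + 1) ≤ 2 * (3 * L) * Real.log (4 * z) := by gcongr
      _ ≤ 3 ^ 2 * (L * Real.log (4 * z)) := by nlinarith
  have h2 : eps 1 κ 1 (m + 1) ≤ 6 * (2 * R) := by
    rw [hε]
    refine mul_le_mul_of_nonneg_left (hsqrt 2 _ (by norm_num) ?_) (by norm_num)
    rw [← mul_div_assoc]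
    refine div_le_div_of_nonneg_right ?_ hz1.le
    calc 2 * κ * Real.log (4 * z) ≤ 2 * (2 * L) * Real.log (4 * z) := by gcongr
      _ = 2 ^ 2 * (L * Real.log (4 * z)) := by ring
  have h3 : 1 / z ≤ R := by
    refine Real.le_sqrt_of_sq_le ?_
    rw [div_pow, one_pow]
    refine div_le_div₀ (by positivity) (one_le_mul_of_one_le_of_one_le hL hl) hz1 ?_
    nlinarith
  have h4 : 3 / (2 * z) = 3 / 2 * (1 / z) := by field_simp
  have h5 : 1 / (4 * z) = 1 / 4 * (1 / z) := by field_simp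
  have hR0 : 0 ≤ R := Real.sqrt_nonneg _
  linarith

theorem optOnline_sub_expectedProfit_le (hh : IsEmpiricalOptimizer (bestChoice n) h)
    (hκ : 1 ≤ κ) {L : ℝ} (hL : 1 ≤ L) (hκL : κ ≤ 2 * L) {K : Finset (LabelPrefix n)}
    (hKpos : 0 < K.card) (hK : ∀ᵐ ω ∂𝔻.law, ∀ i, (⟨i, labelsUpTo ω.2 i⟩ : LabelPrefix n) ∈ K)
    (hKL : K.card ≤ 3 * L) {T : ℕ} (hT : 2 ≤ T) (hmT : m < T) :
    optOnline (bestChoice n) 𝔻 - expectedProfit (bestChoice n) 𝔻 (secretaryPolicy n κ tie h) m ≤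
      275 * Real.sqrt (L * Real.log T) * (1 / Real.sqrt (m + 1)) := by
  have hT' : (2 : ℝ) ≤ T := by exact_mod_cast hT
  have hlogT : 1 / 2 ≤ Real.log T := by
    have h1 := Real.log_two_gt_d9
    have h2 := Real.log_le_log (by norm_num) hT'
    linarith
  have hsplit : Real.sqrt (L * Real.log T) * (1 / Real.sqrt (m + 1)) =
      Real.sqrt (L * Real.log T * (1 / (m + 1))) := by
    rw [Real.sqrt_mul (x := L * Real.log T) (by positivity), Real.sqrt_div zero_le_one,
      Real.sqrt_one]
  rw [mul_assoc, hsplit]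
  by_cases hm : zeta 1 (m + 1) < m + 1
  · have hz2 : (2 : ℝ) ≤ zeta 1 (m + 1) := by exact_mod_cast two_le_zeta hm
    have hl := one_le_log_zeta hm
    have hzT : (zeta 1 (m + 1) : ℝ) ≤ T := by
      have : zeta 1 (m + 1) ≤ T := by omega
      exact_mod_cast this
    -- The training sample is a fixed fraction of all rounds; the factor `6` leaves room for the
    -- small values of `m`.
    have hzm : (m : ℝ) + 1 ≤ 6 * ((zeta 1 (m + 1) : ℝ) - 1) := by
      have : m + 1 + 6 ≤ 6 * zeta 1 (m + 1) := by unfold zeta at *; omega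
      have h' : (m : ℝ) + 1 + 6 ≤ 6 * zeta 1 (m + 1) := by exact_mod_cast this
      linarith
    have hlog : Real.log (4 * zeta 1 (m + 1)) ≤ 3 * Real.log T := by
      have h3 : (3 : ℝ) * Real.log T = Real.log ((T : ℝ) ^ 3) := by
        rw [Real.log_pow]
        norm_num
      rw [h3]
      exact Real.log_le_log (by linarith) (by nlinarith [mul_self_nonneg ((T : ℝ) - 2)])
    refine (optOnline_sub_expectedProfit_le_of_test tie 𝔻 hh hκ hL hκL hKpos hK hKL hm).trans ?_
    -- The factors `3` (from `4ζ ≤ T³`) and `6` give `18 ≤ 5²`, so the constant becomes `55 · 5 =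
    -- 275`.
    have h1 : L * Real.log (4 * zeta 1 (m + 1)) / ((zeta 1 (m + 1) : ℝ) - 1) ≤
        5 ^ 2 * (L * Real.log T * (1 / (m + 1))) := by
      calc _ ≤ L * (3 * Real.log T) / (((m : ℝ) + 1) / 6) := by
            gcongr
            linarith
        _ = 18 * (L * Real.log T * (1 / (m + 1))) := by field_simp; ring
        _ ≤ _ := by gcongr; norm_num
    calc _ ≤ 55 * Real.sqrt (5 ^ 2 * (L * Real.log T * (1 / (m + 1)))) := by gcongr
      _ = _ := by
        rw [Real.sqrt_mul (by norm_num), Real.sqrt_sq (by norm_num)]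
        ring
  · have hm2 : (m : ℝ) ≤ 1 := by
      have : m ≤ 1 := by unfold zeta at *; omega
      exact_mod_cast this
    have h1 := optOnline_le_one 𝔻
    have h2 := expectedProfit_nonneg 𝔻 (measurablePolicy_secretary κ tie hh) m
    -- In the first two rounds the loss is at most one, which is below `275 · (1/2)`.
    have h3 : (1 / 2 : ℝ) ≤ Real.sqrt (L * Real.log T * (1 / (m + 1))) := by
      refine Real.le_sqrt_of_sq_le ?_
      calc (1 / 2 : ℝ) ^ 2 = 1 * (1 / 2) * (1 / (1 + 1)) := by norm_num
        _ ≤ _ := by gcongr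
    linarith

/-- Telescoping: `1/√(T+1) ≤ 2√(T+1) - 2√T`. -/
theorem sum_inv_sqrt_le (T : ℕ) :
    ∑ m ∈ Finset.range T, 1 / Real.sqrt (m + 1) ≤ 2 * Real.sqrt T := by
  induction T with
  | zero => simp
  | succ T ih =>
    rw [Finset.sum_range_succ]
    push_cast
    have ha : 0 ≤ Real.sqrt T := Real.sqrt_nonneg _
    have hb : 0 < Real.sqrt (T + 1) := Real.sqrt_pos.2 (by positivity)
    have ha2 := Real.sq_sqrt (show (0 : ℝ) ≤ T by positivity)
    have hb2 := Real.sq_sqrt (show (0 : ℝ) ≤ T + 1 by positivity)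
    set a := Real.sqrt T
    set b := Real.sqrt (T + 1)
    have h : 1 / b ≤ 2 * b - 2 * a := by
      rw [div_le_iff₀ hb]
      nlinarith [sq_nonneg (b - a)]
    linarith

theorem regret_le (hh : IsEmpiricalOptimizer (bestChoice n) h)
    (hκ : 1 ≤ κ) {L : ℝ} (hL : 1 ≤ L) (hκL : κ ≤ 2 * L) {K : Finset (LabelPrefix n)}
    (hKpos : 0 < K.card) (hK : ∀ᵐ ω ∂𝔻.law, ∀ i, (⟨i, labelsUpTo ω.2 i⟩ : LabelPrefix n) ∈ K)
    (hKL : K.card ≤ 3 * L) {T : ℕ} (hT : 2 ≤ T) :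
    regret (bestChoice n) 𝔻 (secretaryPolicy n κ tie h) T ≤
      550 * Real.sqrt (L * T * Real.log T) := by
  rw [regret_eq (measurablePolicy_secretary κ tie hh)]
  have hlogT : 0 ≤ Real.log T := Real.log_nonneg (by exact_mod_cast (by omega : 1 ≤ T))
  calc _ ≤ ∑ t : Fin T, 275 * Real.sqrt (L * Real.log T) * (1 / Real.sqrt (t.val + 1)) :=
        Finset.sum_le_sum fun t _ =>
          optOnline_sub_expectedProfit_le tie 𝔻 hh hκ hL hκL hKpos hK hKL hT t.isLt
    _ = 275 * Real.sqrt (L * Real.log T) * ∑ m ∈ Finset.range T, 1 / Real.sqrt (m + 1) := by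
        rw [Finset.mul_sum, Fin.sum_univ_eq_sum_range
          (fun t => 275 * Real.sqrt (L * Real.log T) * (1 / Real.sqrt (t + 1))) T]
    _ ≤ 275 * Real.sqrt (L * Real.log T) * (2 * Real.sqrt T) := by
        gcongr
        exact sum_inv_sqrt_le T
    _ = 550 * Real.sqrt (L * T * Real.log T) := by
        rw [show L * T * Real.log T = L * Real.log T * T by ring,
          Real.sqrt_mul (mul_nonneg (by linarith) hlogT)]
        ring

/-- Takes `K` to be all label prefixes and `L = n!`; the choice of `K` does not involve the order
law. -/
theorem regret_le_general (hh : IsEmpiricalOptimizer (bestChoice n) h) (hκ : 1 ≤ κ)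
    (hκn : κ ≤ 2 * n.factorial) {T : ℕ} (hT : 2 ≤ T) :
    regret (bestChoice n) 𝔻 (secretaryPolicy n κ tie h) T ≤
      550 * Real.sqrt (n.factorial * T * Real.log T) := by
  have hL : 1 ≤ n.factorial := n.factorial_pos
  have : Nonempty (LabelPrefix n) := ⟨⟨0, labelsUpTo (Equiv.refl _) 0⟩⟩
  refine regret_le tie 𝔻 hh hκ (by exact_mod_cast hL) (by exact_mod_cast hκn)
    (K := Finset.univ) (Finset.card_pos.2 Finset.univ_nonempty)
    (Filter.Eventually.of_forall fun _ _ => Finset.mem_univ _) ?_ hT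
  rw [Finset.card_univ]
  exact_mod_cast card_labelPrefix_le n

theorem regret_le_of_isAdversarialOrder (hh : IsEmpiricalOptimizer (bestChoice n) h)
    (h𝔻 : 𝔻.IsAdversarialOrder) {T : ℕ} (hT : 2 ≤ T) :
    regret (bestChoice n) 𝔻 (secretaryPolicy n n tie h) T ≤
      550 * Real.sqrt (n * T * Real.log T) := by
  have hn : 1 ≤ n := NeZero.one_le
  have hn' : (1 : ℝ) ≤ n := by exact_mod_cast hn
  refine regret_le tie 𝔻 hh hn hn' (by linarith) ?_ (labelPrefix_mem_of_adversarial h𝔻) ?_ hT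
  · rw [Finset.card_map, Finset.card_univ, Fintype.card_fin]
    exact hn
  · rw [Finset.card_map, Finset.card_univ, Fintype.card_fin]
    linarith

end Guarantees

end

end OptStop

/-! ### The main theorem -/

theorem mainTheorem9 :
    -- empirical optimizers exist
    (∀ n : ℕ, 1 ≤ n → ∃ h, OptStop.IsEmpiricalOptimizer (OptStop.bestChoice n) h) ∧
    -- and every one of them yields the guarantees
    ∃ C : ℝ, 0 < C ∧
      ∀ (n : ℕ) [NeZero n] (tie : PMF Bool)
        (h : (m : ℕ) → (Fin m → OptStop.Outcome n) → OptStop.OnlineAlg n),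
        OptStop.IsEmpiricalOptimizer (OptStop.bestChoice n) h →
        -- adversarial order
        (∀ 𝔻 : OptStop.Distributions n, 𝔻.IsAdversarialOrder →
          OptStop.CompetitiveAt (OptStop.bestChoice n) 𝔻
            (OptStop.secretaryPolicy n n tie h) 0 (1 / n) ∧
          (tie = PMF.uniformOfFintype Bool ∨ 𝔻.Atomless → ∀ m : ℕ, 1 ≤ m →
            OptStop.CompetitiveAt (OptStop.bestChoice n) 𝔻
              (OptStop.secretaryPolicy n n tie h) m (1 / 4)) ∧
          ∀ T : ℕ, 2 ≤ T →
            OptStop.regret (OptStop.bestChoice n) 𝔻 (OptStop.secretaryPolicy n n tie h) T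
              ≤ C * Real.sqrt (n * T * Real.log T)) ∧
        -- general order
        (∀ κ : ℕ, n ≤ κ → κ ≤ 2 * n.factorial → ∀ 𝔻 : OptStop.Distributions n,
          OptStop.CompetitiveAt (OptStop.bestChoice n) 𝔻
            (OptStop.secretaryPolicy n κ tie h) 0 (1 / n) ∧
          (tie = PMF.uniformOfFintype Bool ∨ 𝔻.Atomless → ∀ m : ℕ, 1 ≤ m →
            OptStop.CompetitiveAt (OptStop.bestChoice n) 𝔻
              (OptStop.secretaryPolicy n κ tie h) m (1 / 4)) ∧
          ∀ T : ℕ, 2 ≤ T →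
            OptStop.regret (OptStop.bestChoice n) 𝔻 (OptStop.secretaryPolicy n κ tie h) T
              ≤ C * Real.sqrt (n.factorial * T * Real.log T)) := by
  refine ⟨fun n _ => OptStop.exists_isEmpiricalOptimizer n, 550, by norm_num, ?_⟩
  intro n _ tie h hh
  have hn : 1 ≤ n := NeZero.one_le
  exact ⟨fun 𝔻 h𝔻 => ⟨OptStop.competitiveAt_zero n tie 𝔻 hh,
      fun htie _ hm => OptStop.competitiveAt_of_one_le tie 𝔻 hh le_rfl htie hm,
      fun _ hT => OptStop.regret_le_of_isAdversarialOrder tie 𝔻 hh h𝔻 hT⟩,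
    fun κ hκ hκn 𝔻 => ⟨OptStop.competitiveAt_zero κ tie 𝔻 hh,
      fun htie _ hm => OptStop.competitiveAt_of_one_le tie 𝔻 hh hκ htie hm,
      fun _ hT => OptStop.regret_le_general tie 𝔻 hh (hn.trans hκ) hκn hT⟩⟩
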